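/- **Infrared bound for the transverse field Ising model.** Let $d\ge 0$, $N\ge1$ be integers, let $\beta,\delta>0$ and $\lambda\ge0$, and let $\Lambda=(\mathbb Z/2N)^d$ be the torus with unit vectors $e_1,\dots,e_d$. Nearest-neighbour sums $\sum_{x\sim y}$ run over the edges $\{x,x+e_j\}$, $x\in\Lambda$, $1\le j\le d$ (each edge once if $N\ge2$; if $N=1$ neighbours are joined by two edges). Let $E$ be the probability measure governing independent Poisson processes $D_x$ ($x\in\Lambda$) of intensity $\delta$ on $[0,\beta)$, each conditioned to have an even number of points, and, independently, independent $\xi_x$ ($x\in\Lambda$) uniform on $\{0,1\}$. Put $\sigma(x,t)=(-1)^{\xi_x+|D_x\cap[0,t]|}$. The space–time Ising measure $\mu$ is $$\mu(f)=\frac1Z\,E\Big[f(\sigma)\exp\Big(\lambda\sum_{x\sim y}\int_0^\beta\sigma(x,t)\sigma(y,t)\,dt\Big)\Big],\qquad Z=E\Big[\exp\Big(\lambda\sum_{x\sim y}\int_0^\beta\sigma(x,t)\sigma(y,t)\,dt\Big)\Big].$$ Let $c((x,s),(y,t))=\mu(\sigma(x,s)\sigma(y,t))$ be the Schwinger function.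 For $k\in\frac{2\pi}{2N}\Lambda$ and $l\in\frac{2\pi}{\beta}\mathbb Z$ let $$\hat c(k,l)=\sum_{x\in\Lambda}\int_0^\beta c((0,0),(x,t))\,e^{ik\cdot x}e^{ilt}\,dt,\qquad \hat L(k)=\sum_{j=1}^d(1-\cos k_j).$$ 1. For all such $k,l$ with $2\lambda\hat L(k)+l^2/(2\delta)>0$, the number $\hat c(k,l)$ is real and $$\hat c(k,l)\le\frac{2\lambda\hat L(k)+48\,l^2/(2\delta)}{\big(2\lambda\hat L(k)+l^2/(2\delta)\big)^2},\qquad \hat c(k,l)\le\frac{48}{2\lambda\hat L(k)+l^2/(2\delta)}.$$ 2. Let $H=-\lambda\sum_{x\sim y}\sigma^{(3)}_x\sigma^{(3)}_y-\delta\sum_{x\in\Lambda}\sigma^{(1)}_x$ on $\bigotimes_{x\in\Lambda}\mathbb C^2$, where $\sigma^{(1)}_x,\sigma^{(3)}_x$ are the Pauli matrices $\begin{pmatrix}0&1\\1&0\end{pmatrix},\begin{pmatrix}1&0\\0&-1\end{pmatrix}$ acting at $x$, and let $$b(x)=\frac1{\operatorname{tr}(e^{-\beta H})}\int_0^\beta\operatorname{tr}\big(e^{-(\beta-t)H}\sigma^{(3)}_x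 e^{-tH}\sigma^{(3)}_0\big)\,dt$$ be the Duhamel two-point function. Then $\int_0^\beta c((0,0),(x,t))\,dt=b(x)$ for every $x\in\Lambda$. Consequently, with $\hat b(k)=\sum_{x\in\Lambda}b(x)e^{ik\cdot x}$, for every $k\in\frac{2\pi}{2N}\Lambda$ with $2\lambda\hat L(k)>0$ the case $l=0$ reads $$\hat c(k,0)=\hat b(k)\le\frac1{2\lambda\hat L(k)}$$ (the Dyson–Lieb–Simon bound), where $\hat b(k)$ is real. -/

import Mathlib

open MeasureTheory ProbabilityTheory

noncomputable section

namespace SpaceTimeIsing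

/-- The discrete torus `Λ = (ℤ/2N)^d`. -/
abbrev Torus (d N : ℕ) : Type := Fin d → ZMod (2 * N)

/-! ### Poisson processes and the a priori measure -/

/-- A finite configuration of points in time: the number `n` of points and their positions. -/
abbrev Points : Type := Σ n : ℕ, (Fin n → ℝ)

/-- The number `|D|` of points of a configuration. -/
def Points.size (D : Points) : ℕ := D.1

/-- The number `|D ∩ [0,t]|` of points at times in `[0,t]`. -/
def Points.count (D : Points) (t : ℝ) : ℕ := Nat.card {i : Fin D.1 // D.2 i ∈ Set.Icc 0 t}

/-- The law of the Poisson process of intensity `δ` on `[0,β)`: the number of points has the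
Poisson distribution with mean `δβ` and, given that number, the positions are independent and
uniform on `[0,β)`. -/
def poissonProcess (β δ : ℝ) : Measure Points :=
  Measure.sum fun n : ℕ =>
    poissonMeasure (δ * β).toNNReal {n} •
      (Measure.pi fun _ : Fin n => volume[|Set.Ico (0 : ℝ) β]).map (Sigma.mk n)

/-- The Poisson process conditioned to have an even number of points. -/
def evenPoissonProcess (β δ : ℝ) : Measure Points :=
  (poissonProcess β δ)[|{D | Even D.size}]

/-- The pairs `(D, ξ)`, where `D = (D_x)` and `ξ = (ξ_x)` for `x ∈ Λ`. -/
abbrev Config (d N : ℕ) : Type := (Torus d N → Points) × (Torus d N → Fin 2)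

/-- The measure `E`: the `D_x` are independent Poisson processes conditioned to have even size,
the `ξ_x` are independent and uniform on `{0,1}`, and `D`, `ξ` are independent. -/
def aPriori (d N : ℕ) [NeZero N] (β δ : ℝ) : Measure (Config d N) :=
  (Measure.pi fun _ : Torus d N => evenPoissonProcess β δ).prod
    (Measure.pi fun _ : Torus d N => uniformOn (Set.univ : Set (Fin 2)))

/-- The spin `σ(x,t) = (-1)^(ξ_x + |D_x ∩ [0,t]|)`. -/
def spin {d N : ℕ} (ω : Config d N) (x : Torus d N) (t : ℝ) : ℝ :=
  (-1) ^ ((ω.2 x : ℕ) + (ω.1 x).count t)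

/-! ### The space–time Ising measure -/

/-- `∑_{x ∼ y} σ(x) σ(y)`, the sum over the pairs `(x + e_j, x)`, where `e_j` is a unit vector.
For `N ≥ 2` each nearest-neighbour edge of the torus occurs exactly once; for `N = 1` the
neighbours `x + e_j` and `x - e_j` coincide and are joined by two edges. -/
def bondSum {d N : ℕ} [NeZero N] {R : Type*} [Semiring R] (u : Torus d N → R) : R :=
  ∑ x : Torus d N, ∑ j : Fin d, u (x + Pi.single j 1) * u x

/-- The exponent `λ ∑_{x ∼ y} ∫_0^β σ(x,t) σ(y,t) dt`. -/
def action {d N : ℕ} [NeZero N] (β lam : ℝ) (σ : Torus d N → ℝ → ℝ) : ℝ :=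
  lam * ∫ t in (0 : ℝ)..β, bondSum fun x => σ x t

/-- The space–time Ising measure `μ`, with `μ(f) = Z⁻¹ E[f(σ) exp(action σ)]`.  It is a measure
on space–time spin configurations, with the σ-algebra generated by the evaluations
`σ ↦ σ(x,t)`.  (`Measure.tilted` includes the normalization by `Z = E[exp(action σ)]`.) -/
def stIsing (d N : ℕ) [NeZero N] (β δ lam : ℝ) : Measure (Torus d N → ℝ → ℝ) :=
  ((aPriori d N β δ).tilted fun ω => action β lam (spin ω)).map spin

/-- The Schwinger function `c((x,s),(y,t)) = μ(σ(x,s) σ(y,t))`, for `0 ≤ s, t < β`. -/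
def schwinger {d N : ℕ} [NeZero N] (β δ lam : ℝ) (x : Torus d N) (s : ℝ) (y : Torus d N) (t : ℝ) :
    ℝ :=
  ∫ σ, σ x s * σ y t ∂(stIsing d N β δ lam)

/-! ### Fourier transforms -/

/-- The set `(2π/2N) Λ` of momenta. -/
def momenta (d N : ℕ) : Set (Fin d → ℝ) :=
  Set.range fun (m : Torus d N) (j : Fin d) => 2 * Real.pi / (2 * N) * (m j).val

/-- The set `(2π/β) ℤ` of frequencies. -/
def frequencies (β : ℝ) : Set ℝ := Set.range fun n : ℤ => 2 * Real.pi / β * n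

/-- `k · x`, with the coordinates of `x` represented in `{0, …, 2N-1}`. -/
def dot {d N : ℕ} (k : Fin d → ℝ) (x : Torus d N) : ℝ := ∑ j, k j * (x j).val

/-- `ĉ(k,l) = ∑_x ∫_0^β c((0,0),(x,t)) e^{ik·x} e^{ilt} dt`. -/
def schwingerHat (d N : ℕ) [NeZero N] (β δ lam : ℝ) (k : Fin d → ℝ) (l : ℝ) : ℂ :=
  ∑ x : Torus d N, ∫ t in (0 : ℝ)..β,
    (schwinger β δ lam 0 0 x t : ℂ) * Complex.exp (Complex.I * (dot k x : ℂ)) *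
      Complex.exp (Complex.I * (l : ℂ) * (t : ℂ))

/-- `L̂(k) = ∑_j (1 - cos k_j)`. -/
def laplaceHat {d : ℕ} (k : Fin d → ℝ) : ℝ := ∑ j, (1 - Real.cos (k j))

/-! ### The quantum model and the Duhamel two-point function -/

/-- Operators on `⊗_{x ∈ Λ} ℂ²`, as matrices in the product basis. -/
abbrev Op (d N : ℕ) : Type := Matrix (Torus d N → Fin 2) (Torus d N → Fin 2) ℂ

open Classical in
/-- The operator that acts as `A` on the tensor factor `x` and as the identity on the others. -/
def siteOp {d N : ℕ} (A : Matrix (Fin 2) (Fin 2) ℂ) (x : Torus d N) : Op d N :=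
  fun s s' => if ∀ y, y ≠ x → s y = s' y then A (s x) (s' x) else 0

/-- The Pauli operator `σ_x^{(3)}`. -/
def pauli3 {d N : ℕ} (x : Torus d N) : Op d N := siteOp !![1, 0; 0, -1] x

/-- The Pauli operator `σ_x^{(1)}`. -/
def pauli1 {d N : ℕ} (x : Torus d N) : Op d N := siteOp !![0, 1; 1, 0] x

/-- `H = -λ ∑_{x ∼ y} σ_x^{(3)} σ_y^{(3)} - δ ∑_x σ_x^{(1)}`. -/
def hamiltonian (d N : ℕ) [NeZero N] (δ lam : ℝ) : Op d N :=
  -((lam : ℂ) • bondSum fun x : Torus d N => (pauli3 x : Op d N)) -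
    (δ : ℂ) • ∑ x : Torus d N, pauli1 x

/-- The Duhamel two-point function
`b(x) = tr(e^{-βH})⁻¹ ∫_0^β tr(e^{-(β-t)H} σ_x^{(3)} e^{-tH} σ_0^{(3)}) dt`. -/
def duhamel (d N : ℕ) [NeZero N] (β δ lam : ℝ) (x : Torus d N) : ℂ :=
  (∫ t in (0 : ℝ)..β,
    (NormedSpace.exp (((-(β - t) : ℝ) : ℂ) • hamiltonian d N δ lam) * pauli3 x *
      NormedSpace.exp (((-t : ℝ) : ℂ) • hamiltonian d N δ lam) * pauli3 0).trace) /
    (NormedSpace.exp (((-β : ℝ) : ℂ) • hamiltonian d N δ lam)).trace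

/-- `b̂(k) = ∑_x b(x) e^{ik·x}`. -/
def duhamelHat (d N : ℕ) [NeZero N] (β δ lam : ℝ) (k : Fin d → ℝ) : ℂ :=
  ∑ x : Torus d N, duhamel d N β δ lam x * Complex.exp (Complex.I * (dot k x : ℂ))

end SpaceTimeIsing

end

open MeasureTheory ProbabilityTheory

noncomputable section

set_option linter.unusedSectionVars false

namespace SpaceTimeIsing

/-! ### Multiplicative functionals of the Poisson process -/

theorem measurableSet_sigma_iff {ι : Type*} {X : ι → Type*} [∀ i, MeasurableSpace (X i)]
    {s : Set (Sigma X)} : MeasurableSet s ↔ ∀ i, MeasurableSet (Sigma.mk i ⁻¹' s) := by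
  rw [Sigma.instMeasurableSpace, MeasurableSpace.measurableSet_iInf]
  rfl

theorem measurable_sigma_iff {ι γ : Type*} {X : ι → Type*} [∀ i, MeasurableSpace (X i)]
    [MeasurableSpace γ] {f : Sigma X → γ} :
    Measurable f ↔ ∀ i, Measurable fun x => f ⟨i, x⟩ := by
  refine ⟨fun h i s hs => measurableSet_sigma_iff.1 (h hs) i, fun h s hs => ?_⟩
  exact measurableSet_sigma_iff.2 fun i => h i hs

theorem measurable_sigmaMk {ι : Type*} {X : ι → Type*} [∀ i, MeasurableSpace (X i)] (i : ι) :
    Measurable (Sigma.mk i : X i → Sigma X) := fun _ hs => measurableSet_sigma_iff.1 hs i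

theorem measurableEmbedding_sigmaMk {ι : Type*} {X : ι → Type*} [∀ i, MeasurableSpace (X i)]
    (i : ι) : MeasurableEmbedding (Sigma.mk i : X i → Sigma X) where
  injective := sigma_mk_injective
  measurable := measurable_sigmaMk i
  measurableSet_image' s hs := measurableSet_sigma_iff.2 fun j => by
    by_cases h : j = i
    · subst h
      rwa [Set.preimage_image_eq _ sigma_mk_injective]
    · convert! MeasurableSet.empty
      ext x
      simp only [Set.mem_preimage, Set.mem_image, Sigma.mk.injEq, Set.mem_empty_iff_false,
        iff_false, not_exists, not_and]
      rintro y - rfl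
      exact (h rfl).elim

/-- Measurability on the product of a countable disjoint union with another space. -/
theorem measurable_sigma_prod {ι γ Y : Type*} [Countable ι] {X : ι → Type*}
    [∀ i, MeasurableSpace (X i)] [MeasurableSpace Y] [MeasurableSpace γ] {f : Sigma X × Y → γ}
    (h : ∀ i, Measurable fun p : X i × Y => f (⟨i, p.1⟩, p.2)) : Measurable f := by
  intro s hs
  have : f ⁻¹' s = ⋃ i, Prod.map (Sigma.mk i) id ''
      ((fun p : X i × Y => f (⟨i, p.1⟩, p.2)) ⁻¹' s) := by
    ext ⟨⟨i, x⟩, y⟩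
    simp only [Set.mem_preimage, Set.mem_iUnion, Set.mem_image, Prod.exists, Prod.map_apply, id,
      Prod.mk.injEq]
    constructor
    · exact fun hx => ⟨i, x, y, hx, rfl, rfl⟩
    · rintro ⟨i', x', y', hx, h1, rfl⟩
      rw [← h1]
      exact hx
  rw [this]
  exact MeasurableSet.iUnion fun i =>
    ((measurableEmbedding_sigmaMk i).prodMap MeasurableEmbedding.id).measurableSet_image' (h i hs)

/-- The product of the values of `g` at the points of a configuration. -/
def Points.prodOver (g : ℝ → ℝ) (D : Points) : ℝ := ∏ i, g (D.2 i)

theorem Points.measurable_prodOver {g : ℝ → ℝ} (hg : Measurable g) :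
    Measurable (Points.prodOver g) :=
  measurable_sigma_iff.2 fun n =>
    Finset.measurable_prod Finset.univ (f := fun (i : Fin n) (x : Fin n → ℝ) => g (x i))
      fun i _ => hg.comp (measurable_pi_apply i)

theorem Points.abs_prodOver_le {g : ℝ → ℝ} (hg : ∀ t, |g t| ≤ 1) (D : Points) :
    |D.prodOver g| ≤ 1 := by
  rw [Points.prodOver, Finset.abs_prod]
  exact Finset.prod_le_one (fun _ _ => abs_nonneg _) fun _ _ => hg _

theorem Points.prodOver_mul (g h : ℝ → ℝ) (D : Points) :
    D.prodOver (fun t => g t * h t) = D.prodOver g * D.prodOver h := Finset.prod_mul_distrib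

theorem Points.prodOver_neg (g : ℝ → ℝ) (D : Points) :
    D.prodOver (fun t => -g t) = (-1) ^ D.size * D.prodOver g := by
  simp [Points.prodOver, Points.size, Finset.prod_neg]

theorem Points.prodOver_one (D : Points) : D.prodOver (fun _ => 1) = 1 := by
  simp [Points.prodOver]

/-- The sign flip at the points in `[0,t]`. -/
def flipBefore (t p : ℝ) : ℝ := if p ∈ Set.Icc 0 t then -1 else 1

theorem measurable_flipBefore (t : ℝ) : Measurable (flipBefore t) :=
  Measurable.ite measurableSet_Icc measurable_const measurable_const

theorem abs_flipBefore (t p : ℝ) : |flipBefore t p| = 1 := by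
  unfold flipBefore; split_ifs <;> simp

theorem Points.neg_one_pow_count (D : Points) (t : ℝ) :
    (-1 : ℝ) ^ D.count t = D.prodOver (flipBefore t) := by
  classical
  unfold Points.count Points.prodOver flipBefore
  rw [Nat.card_eq_fintype_card, Fintype.card_subtype, Finset.prod_ite]
  simp

instance isProbabilityMeasure_uniformTime {β : ℝ} [hβ : Fact (0 < β)] :
    IsProbabilityMeasure (volume[|Set.Ico (0 : ℝ) β]) :=
  cond_isProbabilityMeasure_of_finite (by simp [hβ.out]) (by simp)

theorem integral_uniformTime {β : ℝ} (hβ : 0 < β) (g : ℝ → ℝ) :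
    ∫ t, g t ∂(volume[|Set.Ico (0 : ℝ) β]) = β⁻¹ * ∫ t in (0 : ℝ)..β, g t := by
  rw [ProbabilityTheory.cond, integral_smul_measure, intervalIntegral.integral_of_le hβ.le,
    integral_Ico_eq_integral_Ioc]
  simp [hβ.le]

instance isProbabilityMeasure_poissonProcess {β δ : ℝ} [hβ : Fact (0 < β)] :
    IsProbabilityMeasure (poissonProcess β δ) where
  measure_univ := by
    have h : ∀ n : ℕ, (poissonMeasure (δ * β).toNNReal {n} •
      (Measure.pi fun _ : Fin n => volume[|Set.Ico (0 : ℝ) β]).map (Sigma.mk n : _ → Points))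
        Set.univ = poissonMeasure (δ * β).toNNReal {n} := fun n => by
      rw [Measure.smul_apply, Measure.map_apply (measurable_sigmaMk n) MeasurableSet.univ]
      simp
    rw [poissonProcess, Measure.sum_apply _ MeasurableSet.univ]
    simp_rw [h]
    have := (poissonMeasure (δ * β).toNNReal).tsum_indicator_apply_singleton Set.univ
      MeasurableSet.univ
    simpa using this

theorem integral_prodOver_poissonProcess {β δ : ℝ} (hβ : 0 < β) (hδ : 0 < δ) {g : ℝ → ℝ}
    (hg : Measurable g) (hg1 : ∀ t, |g t| ≤ 1) :
    ∫ D, D.prodOver g ∂(poissonProcess β δ) =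
      Real.exp (-(δ * β)) * Real.exp (δ * ∫ t in (0 : ℝ)..β, g t) := by
  have : Fact (0 < β) := ⟨hβ⟩
  have hInt : Integrable (Points.prodOver g) (poissonProcess β δ) :=
    Integrable.of_bound (Points.measurable_prodOver hg).aestronglyMeasurable 1
      (Filter.Eventually.of_forall fun D => Points.abs_prodOver_le hg1 D)
  have hs := hasSum_integral_measure hInt
  rw [← poissonProcess] at hs
  have hn : ∀ n : ℕ, ∫ D, Points.prodOver g D ∂(poissonMeasure (δ * β).toNNReal {n} •
      (Measure.pi fun _ : Fin n => volume[|Set.Ico (0 : ℝ) β]).map (Sigma.mk n : _ → Points)) =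
        Real.exp (-(δ * β)) * ((δ * ∫ t in (0 : ℝ)..β, g t) ^ n / n.factorial) := fun n => by
    rw [integral_smul_measure, integral_map (measurable_sigmaMk n).aemeasurable
      (Points.measurable_prodOver hg).aestronglyMeasurable]
    have : ∀ x : Fin n → ℝ, Points.prodOver g ⟨n, x⟩ = ∏ i, g (x i) := fun x => rfl
    simp_rw [this]
    rw [integral_fintype_prod_eq_pow, integral_uniformTime hβ, poissonMeasure_singleton,
      Fintype.card_fin, ENNReal.toReal_ofReal (by positivity),
      Real.coe_toNNReal _ (by positivity), smul_eq_mul, mul_pow, mul_pow, mul_pow, inv_pow]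
    field_simp
  simp_rw [hn] at hs
  refine hs.unique (HasSum.mul_left _ ?_)
  rw [Real.exp_eq_exp_ℝ]
  exact NormedSpace.expSeries_div_hasSum_exp _

theorem measurableSet_even_size : MeasurableSet {D : Points | Even D.size} :=
  measurableSet_sigma_iff.2 fun n => by
    by_cases h : Even n <;> simp [Points.size, h]

theorem setIntegral_even_prodOver {β δ : ℝ} (hβ : 0 < β) (hδ : 0 < δ) {g : ℝ → ℝ}
    (hg : Measurable g) (hg1 : ∀ t, |g t| ≤ 1) :
    ∫ D in {D : Points | Even D.size}, D.prodOver g ∂(poissonProcess β δ) =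
      Real.exp (-(δ * β)) * Real.cosh (δ * ∫ t in (0 : ℝ)..β, g t) := by
  have : Fact (0 < β) := ⟨hβ⟩
  have hInt : ∀ {f : ℝ → ℝ}, Measurable f → (∀ t, |f t| ≤ 1) →
      Integrable (Points.prodOver f) (poissonProcess β δ) := fun hf hf1 =>
    Integrable.of_bound (Points.measurable_prodOver hf).aestronglyMeasurable 1
      (Filter.Eventually.of_forall fun D => Points.abs_prodOver_le hf1 D)
  have hng1 : ∀ t, |(fun t => -g t) t| ≤ 1 := fun t => by simpa using hg1 t
  rw [← integral_indicator measurableSet_even_size]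
  have : ∀ D : Points, Set.indicator {D : Points | Even D.size} (fun D => D.prodOver g) D =
      (D.prodOver g + D.prodOver (fun t => -g t)) / 2 := fun D => by
    rw [Points.prodOver_neg, Set.indicator_apply]
    by_cases h : Even D.size
    · simp [h]
    · simp [h, (Nat.not_even_iff_odd.1 h).neg_one_pow]
  simp_rw [this]
  rw [integral_div, integral_add (hInt hg hg1) (hInt (f := fun t => -g t) hg.neg hng1),
    integral_prodOver_poissonProcess hβ hδ hg hg1,
    integral_prodOver_poissonProcess hβ hδ (g := fun t => -g t) hg.neg hng1, intervalIntegral.integral_neg,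
    Real.cosh_eq, mul_neg]
  ring

theorem measureReal_even_poissonProcess {β δ : ℝ} (hβ : 0 < β) (hδ : 0 < δ) :
    (poissonProcess β δ).real {D : Points | Even D.size} =
      Real.exp (-(δ * β)) * Real.cosh (δ * β) := by
  have := setIntegral_even_prodOver hβ hδ (g := fun _ => 1) measurable_const (by simp)
  simpa [Points.prodOver_one] using this

theorem measure_even_poissonProcess_ne_zero {β δ : ℝ} (hβ : 0 < β) (hδ : 0 < δ) :
    poissonProcess β δ {D : Points | Even D.size} ≠ 0 := fun h => by
  have h1 := measureReal_even_poissonProcess hβ hδ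
  rw [Measure.real, h, ENNReal.toReal_zero] at h1
  exact (mul_pos (Real.exp_pos _) (Real.cosh_pos (δ * β))).ne h1

theorem isProbabilityMeasure_evenPoissonProcess {β δ : ℝ} (hβ : 0 < β) (hδ : 0 < δ) :
    IsProbabilityMeasure (evenPoissonProcess β δ) := by
  have : Fact (0 < β) := ⟨hβ⟩
  exact cond_isProbabilityMeasure (measure_even_poissonProcess_ne_zero hβ hδ)

/-- The expectation of a multiplicative functional of the even Poisson process. -/
theorem integral_prodOver_evenPoissonProcess {β δ : ℝ} (hβ : 0 < β) (hδ : 0 < δ) {g : ℝ → ℝ}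
    (hg : Measurable g) (hg1 : ∀ t, |g t| ≤ 1) :
    ∫ D, D.prodOver g ∂(evenPoissonProcess β δ) =
      Real.cosh (δ * ∫ t in (0 : ℝ)..β, g t) / Real.cosh (δ * β) := by
  have h := measureReal_even_poissonProcess hβ hδ
  rw [Measure.real] at h
  rw [evenPoissonProcess, ProbabilityTheory.cond, integral_smul_measure,
    setIntegral_even_prodOver hβ hδ hg hg1, ENNReal.toReal_inv, h, smul_eq_mul]
  have := Real.cosh_pos (δ * β)
  field_simp

/-! ### Measurability of the spins -/

theorem spin_eq_mul {d N : ℕ} (ω : Config d N) (x : Torus d N) (t : ℝ) :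
    spin ω x t = (-1) ^ (ω.2 x : ℕ) * (ω.1 x).prodOver (flipBefore t) := by
  rw [spin, pow_add, Points.neg_one_pow_count]

theorem spin_eq_or {d N : ℕ} (ω : Config d N) (x : Torus d N) (t : ℝ) :
    spin ω x t = 1 ∨ spin ω x t = -1 := neg_one_pow_eq_or ℝ _

theorem abs_spin {d N : ℕ} (ω : Config d N) (x : Torus d N) (t : ℝ) : |spin ω x t| = 1 := by
  rcases spin_eq_or ω x t with h | h <;> simp [h]

theorem measurable_prodOver_flipBefore :
    Measurable fun p : Points × ℝ => p.1.prodOver (flipBefore p.2) := by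
  refine measurable_sigma_prod fun n => ?_
  refine Finset.measurable_prod Finset.univ
    (f := fun (i : Fin n) (p : (Fin n → ℝ) × ℝ) => flipBefore p.2 (p.1 i)) fun i _ => ?_
  refine Measurable.ite ?_ measurable_const measurable_const
  have h1 : Measurable fun p : (Fin n → ℝ) × ℝ => p.1 i :=
    (measurable_pi_apply i).comp measurable_fst
  exact (measurableSet_le measurable_const h1).inter (measurableSet_le h1 measurable_snd)

theorem measurable_spin_uncurry {d N : ℕ} (x : Torus d N) :
    Measurable fun p : Config d N × ℝ => spin p.1 x p.2 := by
  simp_rw [spin_eq_mul]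
  refine Measurable.mul ?_ ?_
  · exact (measurable_of_countable fun a : Fin 2 => (-1 : ℝ) ^ (a : ℕ)).comp
      ((measurable_pi_apply x).comp (measurable_snd.comp measurable_fst))
  · exact measurable_prodOver_flipBefore.comp
      (f := fun p : Config d N × ℝ => (p.1.1 x, p.2))
      (((measurable_pi_apply x).comp (measurable_fst.comp measurable_fst)).prodMk measurable_snd)

theorem measurable_spin_left {d N : ℕ} (x : Torus d N) (t : ℝ) :
    Measurable fun ω : Config d N => spin ω x t :=
  (measurable_spin_uncurry x).comp (measurable_id.prodMk measurable_const)

theorem measurable_spin_right {d N : ℕ} (ω : Config d N) (x : Torus d N) :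
    Measurable fun t => spin ω x t :=
  (measurable_spin_uncurry x).comp (measurable_const.prodMk measurable_id)

theorem measurable_spin {d N : ℕ} : Measurable (spin : Config d N → Torus d N → ℝ → ℝ) :=
  measurable_pi_iff.2 fun x => measurable_pi_iff.2 fun t => measurable_spin_left x t

/-! ### Diagonal matrices and tensor powers of the flip semigroup -/

/-- The spin value of a basis label. -/
def sgn (a : Fin 2) : ℝ := (-1) ^ (a : ℕ)

@[simp] theorem sgn_zero : sgn 0 = 1 := by simp [sgn]
@[simp] theorem sgn_one : sgn 1 = -1 := by simp [sgn]

variable {d N : ℕ} [NeZero N]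

/-- Real operators on the spin space. -/
abbrev RealOp (d N : ℕ) : Type := Matrix (Torus d N → Fin 2) (Torus d N → Fin 2) ℝ

/-- Multiplication by a function of the spins. -/
def diagOf (f : (Torus d N → ℝ) → ℝ) : RealOp d N :=
  Matrix.diagonal fun s => f fun x => sgn (s x)

/-- The entries of `exp (c σ⁽¹⁾)`. -/
def flipKernel (c : ℝ) (a b : Fin 2) : ℝ := if a = b then Real.cosh c else Real.sinh c

theorem sum_flipKernel_mul (c c' : ℝ) (a b : Fin 2) :
    ∑ e, flipKernel c a e * flipKernel c' e b = flipKernel (c + c') a b := by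
  fin_cases a <;> fin_cases b <;>
    simp [flipKernel, Real.cosh_add, Real.sinh_add] <;> ring

theorem flipKernel_mul_sgn (c : ℝ) (a b : Fin 2) (n : ℕ) :
    flipKernel c a b * sgn b ^ n = sgn a ^ n * flipKernel ((-1) ^ n * c) a b := by
  rcases neg_one_pow_eq_or ℝ n with h | h <;> fin_cases a <;> fin_cases b <;>
    simp [flipKernel, h]

/-- The operator `exp (∑ₓ cₓ σₓ⁽¹⁾)`. -/
def flipMat (c : Torus d N → ℝ) : RealOp d N := fun s s' => ∏ x, flipKernel (c x) (s x) (s' x)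

theorem sum_prod_eq_prod_sum (F : Torus d N → Fin 2 → ℝ) :
    ∑ s : Torus d N → Fin 2, ∏ x, F x (s x) = ∏ x, ∑ a, F x a := by
  rw [Finset.prod_univ_sum, Fintype.piFinset_univ]

theorem flipMat_mul (c c' : Torus d N → ℝ) :
    flipMat c * flipMat c' = flipMat fun x => c x + c' x := by
  ext s s'
  simp only [Matrix.mul_apply, flipMat, ← Finset.prod_mul_distrib, ← sum_flipKernel_mul]
  exact sum_prod_eq_prod_sum fun x a => flipKernel (c x) (s x) a * flipKernel (c' x) a (s' x)

theorem flipMat_zero : (flipMat fun _ => 0 : RealOp d N) = 1 := by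
  ext s s'
  simp only [flipMat, flipKernel, Real.cosh_zero, Real.sinh_zero, Matrix.one_apply]
  by_cases h : s = s'
  · simp [h]
  · obtain ⟨x, hx⟩ := Function.ne_iff.1 h
    rw [Finset.prod_eq_zero (Finset.mem_univ x) (if_neg hx), if_neg h]

/-- The monomial `∏ₓ vₓ ^ bₓ`. -/
def monom (b : Torus d N → ℕ) (v : Torus d N → ℝ) : ℝ := ∏ x, v x ^ b x

theorem monom_add (a b : Torus d N → ℕ) (v : Torus d N → ℝ) :
    monom (a + b) v = monom a v * monom b v := by
  simp [monom, pow_add, Finset.prod_mul_distrib]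

theorem flipMat_mul_diagOf_monom (c : Torus d N → ℝ) (b : Torus d N → ℕ) :
    flipMat c * diagOf (monom b) = diagOf (monom b) * flipMat fun x => (-1) ^ b x * c x := by
  ext s s'
  rw [diagOf, Matrix.mul_diagonal, Matrix.diagonal_mul]
  simp only [flipMat, monom, ← Finset.prod_mul_distrib, flipKernel_mul_sgn]

theorem trace_diagOf_monom_mul_flipMat (c : Torus d N → ℝ) (b : Torus d N → ℕ) :
    (diagOf (monom b) * flipMat c).trace = ∏ x, (1 + (-1) ^ b x) * Real.cosh (c x) := by
  have h : (diagOf (monom b) * flipMat c).trace =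
      ∑ s : Torus d N → Fin 2, ∏ x, (fun y a => sgn a ^ b y * Real.cosh (c y)) x (s x) := by
    simp [Matrix.trace, diagOf, Matrix.diagonal_mul, flipMat, monom, flipKernel,
      Finset.prod_mul_distrib]
  rw [h, sum_prod_eq_prod_sum fun y a => sgn a ^ b y * Real.cosh (c y)]
  simp [add_mul]

theorem diagOf_mul (f g : (Torus d N → ℝ) → ℝ) :
    diagOf f * diagOf g = diagOf fun v => f v * g v := Matrix.diagonal_mul_diagonal _ _

theorem diagOf_one : (diagOf fun _ => 1 : RealOp d N) = 1 := Matrix.diagonal_one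

/-- Every function of finitely many signs is a combination of square-free monomials. -/
theorem exists_monom_expansion (f : (Torus d N → ℝ) → ℝ) :
    ∃ coef : Finset (Torus d N) → ℝ, ∀ v : Torus d N → ℝ, (∀ x, v x = 1 ∨ v x = -1) →
      f v = ∑ A, coef A * monom (fun x => if x ∈ A then 1 else 0) v := by
  refine ⟨fun A => ∑ s : Torus d N → Fin 2,
    f (fun x => sgn (s x)) * (1 / 2) ^ Fintype.card (Torus d N) * ∏ x ∈ A, sgn (s x),
    fun v hv => ?_⟩
  obtain ⟨s₀, rfl⟩ : ∃ s₀ : Torus d N → Fin 2, v = fun x => sgn (s₀ x) := by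
    refine ⟨fun x => if v x = 1 then 0 else 1, funext fun x => ?_⟩
    rcases hv x with h | h <;> norm_num [h]
  have hm : ∀ (A : Finset (Torus d N)) (v : Torus d N → ℝ),
      monom (fun x => if x ∈ A then 1 else 0) v = ∏ x ∈ A, v x := fun A v => by
    simp only [monom, pow_ite, pow_one, pow_zero]
    rw [Finset.prod_ite_mem, Finset.univ_inter]
  simp only [hm, Finset.sum_mul]
  rw [Finset.sum_comm]
  have h2 : ∀ s : Torus d N → Fin 2, ∑ A, f (fun x => sgn (s x)) *
      (1 / 2) ^ Fintype.card (Torus d N) * (∏ x ∈ A, sgn (s x)) * ∏ x ∈ A, sgn (s₀ x) =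
        if s = s₀ then f (fun x => sgn (s x)) else 0 := fun s => by
    simp only [mul_assoc, ← Finset.prod_mul_distrib, ← Finset.mul_sum]
    have h3 : ∑ A : Finset (Torus d N), ∏ x ∈ A, sgn (s x) * sgn (s₀ x) =
        ∏ x, (1 + sgn (s x) * sgn (s₀ x)) := by
      rw [Finset.prod_one_add, Finset.powerset_univ]
    rw [h3, ← Finset.card_univ, ← Finset.prod_const, ← Finset.prod_mul_distrib]
    have h4 : ∀ a b : Fin 2, (1 / 2 * (1 + sgn a * sgn b) : ℝ) = if a = b then 1 else 0 := by
      intro a b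
      fin_cases a <;> fin_cases b <;> norm_num
    simp only [h4]
    by_cases h : s = s₀
    · simp [h]
    · obtain ⟨x, hx⟩ := Function.ne_iff.1 h
      rw [Finset.prod_eq_zero (Finset.mem_univ x) (if_neg hx), if_neg h, mul_zero]
  rw [Finset.sum_congr rfl fun s _ => h2 s]
  simp

/-! ### The a priori measure -/

theorem isProbabilityMeasure_uniformOn_fin_two :
    IsProbabilityMeasure (uniformOn (Set.univ : Set (Fin 2))) :=
  isProbabilityMeasure_uniformOn Set.finite_univ Set.univ_nonempty

theorem isProbabilityMeasure_aPriori {β δ : ℝ} (hβ : 0 < β) (hδ : 0 < δ) :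
    IsProbabilityMeasure (aPriori d N β δ) := by
  have := isProbabilityMeasure_evenPoissonProcess hβ hδ
  have := isProbabilityMeasure_uniformOn_fin_two
  unfold aPriori
  infer_instance

theorem integral_sgn_pow (n : ℕ) :
    ∫ a, sgn a ^ n ∂(uniformOn (Set.univ : Set (Fin 2))) = (1 + (-1) ^ n) / 2 := by
  have := isProbabilityMeasure_uniformOn_fin_two
  rw [integral_fintype (Integrable.of_finite)]
  have h : ∀ a : Fin 2, (uniformOn (Set.univ : Set (Fin 2))).real {a} = 1 / 2 := fun a => by
    rw [Measure.real, uniformOn_univ]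
    simp
  simp [h]
  ring

theorem measurable_comp_spin (f : (Torus d N → ℝ) → ℝ) (t : ℝ) :
    Measurable fun ω : Config d N => f fun x => spin ω x t := by
  obtain ⟨coef, hc⟩ := exists_monom_expansion f
  have : (fun ω : Config d N => f fun x => spin ω x t) = fun ω =>
      ∑ A, coef A * monom (fun x => if x ∈ A then 1 else 0) fun x => spin ω x t :=
    funext fun ω => hc _ fun x => spin_eq_or ω x t
  rw [this]
  unfold monom
  exact Finset.measurable_sum _ fun A _ => measurable_const.mul
    (Finset.measurable_prod _ fun x _ => (measurable_spin_left x t).pow_const _)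

theorem exists_abs_comp_spin_le (f : (Torus d N → ℝ) → ℝ) :
    ∃ C, ∀ (ω : Config d N) (t : ℝ), |f fun x => spin ω x t| ≤ C := by
  obtain ⟨coef, hc⟩ := exists_monom_expansion f
  refine ⟨∑ A, |coef A|, fun ω t => ?_⟩
  rw [hc _ fun x => spin_eq_or ω x t]
  refine (Finset.abs_sum_le_sum_abs _ _).trans (Finset.sum_le_sum fun A _ => ?_)
  simp [abs_mul, monom, Finset.abs_prod, abs_spin]

/-- The product of the functionals `∏_{p ∈ Dₓ} gₓ(p)` and of powers of the initial spins. -/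
def siteWeight (g : Torus d N → ℝ → ℝ) (b : Torus d N → ℕ) (ω : Config d N) : ℝ :=
  (∏ x, (ω.1 x).prodOver (g x)) * ∏ x, sgn (ω.2 x) ^ b x

theorem siteWeight_mul_monom_spin (g : Torus d N → ℝ → ℝ) (a b : Torus d N → ℕ) (t : ℝ)
    (ω : Config d N) :
    siteWeight g b ω * monom a (fun x => spin ω x t) =
      siteWeight (fun x p => g x p * flipBefore t p ^ a x) (a + b) ω := by
  have hp : ∀ (D : Points) (n : ℕ),
      D.prodOver (fun p => flipBefore t p ^ n) = D.prodOver (flipBefore t) ^ n := fun D n =>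
    Finset.prod_pow _ _ _
  simp only [siteWeight, monom, spin_eq_mul, Points.prodOver_mul, hp, mul_pow,
    Finset.prod_mul_distrib, Pi.add_apply, pow_add, sgn]
  ring

theorem measurable_siteWeight {g : Torus d N → ℝ → ℝ} (hg : ∀ x, Measurable (g x))
    (b : Torus d N → ℕ) : Measurable (siteWeight g b) := by
  refine Measurable.mul (Finset.measurable_prod Finset.univ
    (f := fun x (ω : Config d N) => (ω.1 x).prodOver (g x)) fun x _ => ?_)
    (Finset.measurable_prod Finset.univ
      (f := fun x (ω : Config d N) => sgn (ω.2 x) ^ b x) fun x _ => ?_)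
  · exact (Points.measurable_prodOver (hg x)).comp ((measurable_pi_apply x).comp measurable_fst)
  · exact ((measurable_of_countable sgn).comp
      ((measurable_pi_apply x).comp measurable_snd)).pow_const _

theorem abs_siteWeight_le {g : Torus d N → ℝ → ℝ} (hg : ∀ x t, |g x t| ≤ 1)
    (b : Torus d N → ℕ) (ω : Config d N) : |siteWeight g b ω| ≤ 1 := by
  simp only [siteWeight, abs_mul, Finset.abs_prod, abs_pow, sgn, abs_neg, abs_one, one_pow,
    Finset.prod_const_one, mul_one]
  exact Finset.prod_le_one (fun _ _ => abs_nonneg _) fun x _ => Points.abs_prodOver_le (hg x) _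

theorem integral_siteWeight {β δ : ℝ} (hβ : 0 < β) (hδ : 0 < δ) {g : Torus d N → ℝ → ℝ}
    (hg : ∀ x, Measurable (g x)) (hg1 : ∀ x t, |g x t| ≤ 1) (b : Torus d N → ℕ) :
    ∫ ω, siteWeight g b ω ∂(aPriori d N β δ) =
      (diagOf (monom b) * flipMat fun x => δ * ∫ t in (0 : ℝ)..β, g x t).trace /
        (2 * Real.cosh (δ * β)) ^ Fintype.card (Torus d N) := by
  have := isProbabilityMeasure_evenPoissonProcess hβ hδ
  have := isProbabilityMeasure_uniformOn_fin_two
  unfold aPriori siteWeight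
  rw [integral_prod_mul (μ := Measure.pi fun _ : Torus d N => evenPoissonProcess β δ)
      (f := fun D : Torus d N → Points => ∏ x, (D x).prodOver (g x))
      (g := fun ξ : Torus d N → Fin 2 => ∏ x, sgn (ξ x) ^ b x),
    integral_fintype_prod_eq_prod (f := fun x (D : Points) => D.prodOver (g x)),
    integral_fintype_prod_eq_prod (f := fun x (a : Fin 2) => sgn a ^ b x),
    trace_diagOf_monom_mul_flipMat, ← Finset.card_univ, ← Finset.prod_const,
    ← Finset.prod_div_distrib, ← Finset.prod_mul_distrib]
  refine Finset.prod_congr rfl fun x _ => ?_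
  rw [integral_sgn_pow, integral_prodOver_evenPoissonProcess hβ hδ (hg x) (hg1 x)]
  have := Real.cosh_pos (δ * β)
  field_simp

/-! ### Expectations of products of functions of the spins at successive times

A time-ordered product is encoded as a list of pairs `(f, s)` of a function of the spins and a
duration; the head of the list is the latest factor. -/

/-- The total duration of a list. -/
def duration (l : List (((Torus d N → ℝ) → ℝ) × ℝ)) : ℝ := (l.map Prod.snd).sum

@[simp] theorem duration_cons (p : ((Torus d N → ℝ) → ℝ) × ℝ)
    (l : List (((Torus d N → ℝ) → ℝ) × ℝ)) : duration (p :: l) = p.2 + duration l := by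
  simp [duration]

/-- The product of the functions in the list, each evaluated at the spins at its time. -/
def pathFun : List (((Torus d N → ℝ) → ℝ) × ℝ) → Config d N → ℝ
  | [], _ => 1
  | p :: l, ω => pathFun l ω * p.1 fun x => spin ω x (duration l)

/-- The corresponding product of operators. -/
def pathOp (δ : ℝ) : List (((Torus d N → ℝ) → ℝ) × ℝ) → RealOp d N
  | [] => 1
  | p :: l => pathOp δ l * (diagOf p.1 * flipMat fun _ => δ * p.2)

theorem measurable_pathFun (l : List (((Torus d N → ℝ) → ℝ) × ℝ)) : Measurable (pathFun l) := by
  induction l with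
  | nil => exact measurable_const
  | cons p l ih => exact ih.mul (measurable_comp_spin p.1 _)

theorem exists_abs_pathFun_le (l : List (((Torus d N → ℝ) → ℝ) × ℝ)) :
    ∃ C, ∀ ω, |pathFun l ω| ≤ C := by
  induction l with
  | nil => exact ⟨1, fun ω => by simp [pathFun]⟩
  | cons p l ih =>
    obtain ⟨C, hC⟩ := ih
    obtain ⟨C', hC'⟩ := exists_abs_comp_spin_le p.1
    refine ⟨C * C', fun ω => ?_⟩
    rw [pathFun, abs_mul]
    exact mul_le_mul (hC ω) (hC' ω _) (abs_nonneg _) ((abs_nonneg _).trans (hC ω))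

theorem integral_siteWeight_mul_pathFun {β δ : ℝ} (hβ : 0 < β) (hδ : 0 < δ)
    (l : List (((Torus d N → ℝ) → ℝ) × ℝ)) (hl : ∀ p ∈ l, 0 ≤ p.2) (hlβ : duration l ≤ β)
    (g : Torus d N → ℝ → ℝ) (b : Torus d N → ℕ) (hg : ∀ x, Measurable (g x))
    (hg1 : ∀ x t, |g x t| ≤ 1) (hgb : ∀ x, ∀ t ∈ Set.Icc 0 (duration l), g x t = (-1) ^ b x) :
    ∫ ω, siteWeight g b ω * pathFun l ω ∂(aPriori d N β δ) =
      (pathOp δ l * (diagOf (monom b) *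
        flipMat fun x => δ * ∫ t in (duration l)..β, g x t)).trace /
          (2 * Real.cosh (δ * β)) ^ Fintype.card (Torus d N) := by
  have := isProbabilityMeasure_aPriori (d := d) (N := N) hβ hδ
  induction l generalizing g b with
  | nil => simpa [pathFun, pathOp, duration] using integral_siteWeight hβ hδ hg hg1 b
  | cons p l ih =>
    obtain ⟨f, s⟩ := p
    have hs : 0 ≤ s := hl (f, s) List.mem_cons_self
    have hl' : ∀ p ∈ l, 0 ≤ p.2 := fun p hp => hl p (List.mem_cons_of_mem _ hp)
    have hl0 : 0 ≤ duration l := List.sum_nonneg fun a ha => by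
      obtain ⟨p, hp, rfl⟩ := List.mem_map.1 ha
      exact hl' p hp
    rw [duration_cons] at hlβ hgb
    simp only at hlβ hgb
    obtain ⟨coef, hc⟩ := exists_monom_expansion f
    set ind : Finset (Torus d N) → Torus d N → ℕ := fun A x => if x ∈ A then 1 else 0
    have hG : ∀ A x, Measurable fun p => g x p * flipBefore (duration l) p ^ ind A x :=
      fun A x => (hg x).mul ((measurable_flipBefore _).pow_const _)
    have hG1 : ∀ A x p, |g x p * flipBefore (duration l) p ^ ind A x| ≤ 1 := fun A x p => by
      rw [abs_mul, abs_pow, abs_flipBefore, one_pow, mul_one]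
      exact hg1 x p
    have hexp : ∀ ω : Config d N, siteWeight g b ω * pathFun ((f, s) :: l) ω =
        ∑ A, coef A * (siteWeight (fun x p => g x p * flipBefore (duration l) p ^ ind A x)
          (ind A + b) ω * pathFun l ω) := fun ω => by
      simp only [pathFun]
      rw [hc _ fun x => spin_eq_or ω x _]
      simp only [← siteWeight_mul_monom_spin, Finset.mul_sum]
      exact Finset.sum_congr rfl fun A _ => by ring
    have hD : diagOf f = ∑ A, coef A • diagOf (monom (ind A)) := by
      ext s s'
      rw [Matrix.sum_apply]
      by_cases h : s = s'
      · subst h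
        simp only [diagOf, Matrix.diagonal_apply_eq, Matrix.smul_apply, smul_eq_mul]
        refine hc _ fun x => ?_
        exact neg_one_pow_eq_or ℝ _
      · simp [diagOf, h]
    simp_rw [hexp]
    rw [integral_finsetSum]
    swap
    · intro A _
      refine Integrable.const_mul ?_ _
      obtain ⟨C, hC⟩ := exists_abs_pathFun_le l
      refine Integrable.of_bound ((measurable_siteWeight (hG A) _).mul
        (measurable_pathFun l)).aestronglyMeasurable (1 * C) (Filter.Eventually.of_forall fun ω => ?_)
      rw [Real.norm_eq_abs, abs_mul]
      exact mul_le_mul (abs_siteWeight_le (hG1 A) _ ω) (hC ω) (abs_nonneg _) zero_le_one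
    rw [pathOp, hD, Finset.sum_mul, Finset.mul_sum, Finset.sum_mul, Matrix.trace_sum,
      Finset.sum_div]
    refine Finset.sum_congr rfl fun A _ => ?_
    rw [integral_const_mul, ih hl' (by linarith) _ (ind A + b) (hG A) (hG1 A)]
    swap
    · intro x t ht
      rw [hgb x t ⟨ht.1, ht.2.trans (by linarith)⟩, flipBefore, if_pos ht, Pi.add_apply, pow_add,
        mul_comm]
    simp only [Matrix.smul_mul, Matrix.mul_smul, Matrix.trace_smul, smul_eq_mul]
    rw [mul_div_assoc, mul_assoc (pathOp δ l), mul_assoc (diagOf (monom (ind A))),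
      ← mul_assoc (flipMat _), flipMat_mul_diagOf_monom, mul_assoc (diagOf (monom b)),
      flipMat_mul, ← mul_assoc (diagOf (monom (ind A))), diagOf_mul]
    have hm : (fun v : Torus d N → ℝ => monom (ind A) v * monom b v) = monom (ind A + b) :=
      funext fun v => (monom_add _ _ v).symm
    rw [hm]
    congr 5
    congr 1
    funext x
    have hi : ∀ u v, IntervalIntegrable (g x) volume u v := fun u v =>
      (intervalIntegrable_const (c := (1 : ℝ))).mono_fun (hg x).aestronglyMeasurable
        (Filter.Eventually.of_forall fun t => by simpa using hg1 x t)
    have h1 : ∫ t in (duration l)..β, g x t * flipBefore (duration l) t ^ ind A x =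
        ∫ t in (duration l)..β, g x t := by
      refine intervalIntegral.integral_congr_ae (Filter.Eventually.of_forall fun t ht => ?_)
      rw [Set.uIoc_of_le (by linarith)] at ht
      rw [flipBefore, if_neg fun h => absurd h.2 (not_le.2 ht.1), one_pow, mul_one]
    have h2 : ∫ t in (duration l)..(s + duration l), g x t = s * (-1) ^ b x := by
      rw [intervalIntegral.integral_congr (g := fun _ => (-1) ^ b x)]
      · simp
      · intro t ht
        rw [Set.uIcc_of_le (by linarith)] at ht
        exact hgb x t ⟨hl0.trans ht.1, ht.2⟩
    rw [h1, ← intervalIntegral.integral_add_adjacent_intervals (hi _ (s + duration l)) (hi _ _),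
      h2, duration_cons]
    ring

/-- The expectation of a time-ordered product is a trace. -/
theorem integral_pathFun {β δ : ℝ} (hβ : 0 < β) (hδ : 0 < δ)
    (l : List (((Torus d N → ℝ) → ℝ) × ℝ)) (hl : ∀ p ∈ l, 0 ≤ p.2) (hlβ : duration l = β) :
    ∫ ω, pathFun l ω ∂(aPriori d N β δ) =
      (pathOp δ l).trace / (2 * Real.cosh (δ * β)) ^ Fintype.card (Torus d N) := by
  have h := integral_siteWeight_mul_pathFun hβ hδ l hl hlβ.le (fun _ _ => 1) (fun _ => 0)
    (fun _ => measurable_const) (by simp) (by simp)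
  have h1 : siteWeight (d := d) (N := N) (fun _ _ => 1) (fun _ => 0) = fun _ => 1 := by
    funext ω
    simp [siteWeight, Points.prodOver_one]
  have h2 : (monom fun _ => 0 : (Torus d N → ℝ) → ℝ) = fun _ => 1 := by
    funext v
    simp [monom]
  simpa [h1, h2, flipMat_zero, hlβ, diagOf_one] using h

/-! ### A product formula for exponentials -/

section ProductFormula
open Filter Asymptotics Topology

theorem norm_pow_sub_pow_le {𝔸 : Type*} [NormedRing 𝔸] [NormOneClass 𝔸] {x y : 𝔸} {M : ℝ}
    (hM : 1 ≤ M) (hx : ‖x‖ ≤ M) (hy : ‖y‖ ≤ M) (n : ℕ) :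
    ‖x ^ n - y ^ n‖ ≤ n * M ^ n * ‖x - y‖ := by
  have hM0 : 0 ≤ M := zero_le_one.trans hM
  induction n with
  | zero => simp
  | succ n ih =>
    have e : x ^ (n + 1) - y ^ (n + 1) = x ^ n * (x - y) + (x ^ n - y ^ n) * y := by
      rw [pow_succ, pow_succ]; noncomm_ring
    have h1 : ‖x ^ n * (x - y)‖ ≤ M ^ n * ‖x - y‖ :=
      (norm_mul_le _ _).trans (mul_le_mul_of_nonneg_right
        ((norm_pow_le x n).trans (pow_le_pow_left₀ (norm_nonneg _) hx n)) (norm_nonneg _))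
    have h2 : ‖(x ^ n - y ^ n) * y‖ ≤ n * M ^ n * ‖x - y‖ * M :=
      (norm_mul_le _ _).trans (mul_le_mul ih hy (norm_nonneg _) (by positivity))
    have h3 : M ^ n * ‖x - y‖ ≤ M ^ (n + 1) * ‖x - y‖ :=
      mul_le_mul_of_nonneg_right (pow_le_pow_right₀ hM n.le_succ) (norm_nonneg _)
    rw [e]
    refine (norm_add_le _ _).trans ((add_le_add (h1.trans h3) h2).trans_eq ?_)
    push_cast
    ring

/-- If `F 0 = 1` and `F' 0 = a` then `F (t / n) ^ n` tends to `exp (t a)`. -/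
theorem tendsto_pow_of_hasDerivAt {𝔸 : Type*} [NormedRing 𝔸] [NormedAlgebra ℝ 𝔸]
    [NormedAlgebra ℚ 𝔸] [NormOneClass 𝔸] [CompleteSpace 𝔸] {F : ℝ → 𝔸} {a : 𝔸} (h0 : F 0 = 1)
    (hF : HasDerivAt F a 0) (t : ℝ) :
    Tendsto (fun n : ℕ => F (t / n) ^ n) atTop (𝓝 (NormedSpace.exp (t • a))) := by
  have hE : HasDerivAt (fun u : ℝ => NormedSpace.exp (u • a)) a 0 := by
    simpa using hasDerivAt_exp_smul_const a (0 : ℝ)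
  have ht : Tendsto (fun n : ℕ => t / n) atTop (𝓝 0) := tendsto_const_div_atTop_nhds_zero_nat t
  have bound : ∀ {G : ℝ → 𝔸}, G 0 = 1 → HasDerivAt G a 0 →
      ∃ C, 0 ≤ C ∧ ∀ᶠ u in 𝓝 (0 : ℝ), ‖G u‖ ≤ Real.exp (C * |u|) := by
    intro G hG0 hG
    obtain ⟨C, hC, hCb⟩ := hG.isBigO_sub.exists_nonneg
    refine ⟨C, hC, hCb.bound.mono fun u hu => ?_⟩
    rw [hG0, sub_zero, Real.norm_eq_abs] at hu
    calc ‖G u‖ = ‖(G u - 1) + 1‖ := by rw [sub_add_cancel]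
      _ ≤ C * |u| + 1 := (norm_add_le _ _).trans (by rw [norm_one]; linarith)
      _ ≤ _ := Real.add_one_le_exp _
  obtain ⟨C₁, hC₁, hb₁⟩ := bound h0 hF
  obtain ⟨C₂, hC₂, hb₂⟩ := bound (by simp) hE
  have hdiff : (fun u => F u - NormedSpace.exp (u • a)) =o[𝓝 0] fun u : ℝ => u := by
    have := hasDerivAt_iff_isLittleO.1 (hF.sub hE)
    simpa [h0] using this
  have hlim : Tendsto (fun n : ℕ => (n : ℝ) * ‖F (t / n) - NormedSpace.exp ((t / n) • a)‖)
      atTop (𝓝 0) := by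
    have h1 := (isBigO_refl (fun n : ℕ => (n : ℝ)) atTop).mul_isLittleO
      (hdiff.norm_left.comp_tendsto ht)
    have h2 : (fun n : ℕ => (n : ℝ) * (t / n)) =O[atTop] fun _ => (1 : ℝ) := by
      refine IsBigO.of_bound |t| (Eventually.of_forall fun n => ?_)
      rcases Nat.eq_zero_or_pos n with rfl | hn
      · simp
      · rw [mul_div_cancel₀ _ (by positivity)]
        simp
    exact (isLittleO_one_iff ℝ).1 (h1.trans_isBigO h2)
  have hsub : Tendsto (fun n : ℕ => F (t / n) ^ n - NormedSpace.exp ((t / n) • a) ^ n)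
      atTop (𝓝 0) := by
    have hlim' := hlim.const_mul (Real.exp ((C₁ + C₂) * |t|))
    rw [mul_zero] at hlim'
    refine squeeze_zero_norm' ?_ hlim'
    filter_upwards [ht.eventually hb₁, ht.eventually hb₂, eventually_gt_atTop 0]
      with n h1 h2 hn
    have e1 : Real.exp (C₁ * |t / n|) ≤ Real.exp ((C₁ + C₂) * |t / n|) :=
      Real.exp_le_exp.2 (mul_le_mul_of_nonneg_right (by linarith) (abs_nonneg _))
    have e2 : Real.exp (C₂ * |t / n|) ≤ Real.exp ((C₁ + C₂) * |t / n|) :=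
      Real.exp_le_exp.2 (mul_le_mul_of_nonneg_right (by linarith) (abs_nonneg _))
    refine (norm_pow_sub_pow_le (Real.one_le_exp (by positivity)) (h1.trans e1) (h2.trans e2)
      n).trans_eq ?_
    rw [← Real.exp_nat_mul, abs_div, Nat.abs_cast]
    have : (n : ℝ) * ((C₁ + C₂) * (|t| / n)) = (C₁ + C₂) * |t| := by
      field_simp
    rw [this]
    ring
  have hconst : (fun n : ℕ => NormedSpace.exp ((t / n) • a) ^ n) =ᶠ[atTop]
      fun _ => NormedSpace.exp (t • a) := by
    filter_upwards [eventually_gt_atTop 0] with n hn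
    rw [← NormedSpace.exp_nsmul, ← Nat.cast_smul_eq_nsmul ℝ, smul_smul,
      mul_div_cancel₀ _ (by positivity)]
  have := hsub.add ((tendsto_congr' hconst).2 tendsto_const_nhds)
  simpa using this

end ProductFormula

/-! ### Riemann sums -/

section RiemannSums
open Filter Topology

theorem riemannSum_eq_integral (f : ℝ → ℝ) {n : ℕ} (hn : 0 < n) :
    ∑ m ∈ Finset.range n, (1 / n : ℝ) * f (m / n) =
      ∫ u in (0 : ℝ)..1, f (⌊u * n⌋₊ / n) := by
  have hn' : (0 : ℝ) < n := by exact_mod_cast hn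
  have hpiece : ∀ m : ℕ, Set.EqOn (fun u : ℝ => f (⌊u * n⌋₊ / n)) (fun _ => f (m / n))
      (Set.Ioo ((m : ℝ) / n) (((m + 1 : ℕ) : ℝ) / n)) := by
    intro m u hu
    have h1 : (m : ℝ) < u * n := (div_lt_iff₀ hn').1 hu.1
    have h2 : u * n < ((m + 1 : ℕ) : ℝ) := (lt_div_iff₀ hn').1 hu.2
    have : ⌊u * n⌋₊ = m := (Nat.floor_eq_iff ((Nat.cast_nonneg m).trans h1.le)).2 ⟨h1.le, by exact_mod_cast h2⟩
    simp only [this]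
  have hle : ∀ m : ℕ, (m : ℝ) / n ≤ ((m + 1 : ℕ) : ℝ) / n := fun m => by gcongr; simp
  have hInt : ∀ m < n, IntervalIntegrable (fun u : ℝ => f (⌊u * n⌋₊ / n)) volume
      ((m : ℝ) / n) (((m + 1 : ℕ) : ℝ) / n) := fun m _ => by
    rw [intervalIntegrable_iff_integrableOn_Ioo_of_le (hle m)]
    exact (integrableOn_const (by simp) (by simp)).congr_fun (hpiece m).symm measurableSet_Ioo
  have h := intervalIntegral.sum_integral_adjacent_intervals (μ := volume)
    (f := fun u : ℝ => f (⌊u * n⌋₊ / n)) (a := fun m : ℕ => (m : ℝ) / n) (n := n) hInt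
  simp only [Nat.cast_zero, zero_div, div_self hn'.ne'] at h
  rw [← h]
  refine Finset.sum_congr rfl fun m _ => ?_
  rw [intervalIntegral.integral_of_le (hle m), integral_Ioc_eq_integral_Ioo,
    setIntegral_congr_fun measurableSet_Ioo (hpiece m), setIntegral_const]
  simp only [measureReal_def, Real.volume_Ioo, smul_eq_mul]
  rw [ENNReal.toReal_ofReal (by linarith [hle m])]
  push_cast
  ring

theorem tendsto_riemannSum_unit {f : ℝ → ℝ} (hf : Measurable f) {C : ℝ} (hC : ∀ t, |f t| ≤ C)
    {S : Set ℝ} (hS : S.Countable) (hcont : ∀ t ∉ S, ContinuousAt f t) :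
    Tendsto (fun n : ℕ => ∑ m ∈ Finset.range n, (1 / n : ℝ) * f (m / n)) atTop
      (𝓝 (∫ u in (0 : ℝ)..1, f u)) := by
  have heq : (fun n : ℕ => ∫ u in (0 : ℝ)..1, f (⌊u * n⌋₊ / n)) =ᶠ[atTop]
      fun n : ℕ => ∑ m ∈ Finset.range n, (1 / n : ℝ) * f (m / n) := by
    filter_upwards [eventually_gt_atTop 0] with n hn
    exact (riemannSum_eq_integral f hn).symm
  refine Tendsto.congr' heq ?_
  refine intervalIntegral.tendsto_integral_filter_of_dominated_convergence (fun _ => C) ?_ ?_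
    intervalIntegrable_const ?_
  · refine Eventually.of_forall fun n => Measurable.aestronglyMeasurable ?_
    exact hf.comp (((measurable_from_nat (f := fun k : ℕ => (k : ℝ))).comp
      (Nat.measurable_floor.comp (measurable_id.mul_const _))).div_const _)
  · exact Eventually.of_forall fun n => Eventually.of_forall fun u _ => hC _
  · filter_upwards [(hS.ae_notMem volume)] with u hu hu'
    rw [Set.uIoc_of_le zero_le_one] at hu'
    exact (hcont u hu).tendsto.comp
      ((tendsto_nat_floor_mul_div_atTop hu'.1.le).comp tendsto_natCast_atTop_atTop)

/-- Left Riemann sums of a bounded function with countably many discontinuities. -/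
theorem tendsto_riemannSum {f : ℝ → ℝ} (hf : Measurable f) {C : ℝ} (hC : ∀ t, |f t| ≤ C)
    {S : Set ℝ} (hS : S.Countable) (hcont : ∀ t ∉ S, ContinuousAt f t) (a b : ℝ) :
    Tendsto (fun n : ℕ => ∑ m ∈ Finset.range n, (b - a) / n * f (a + m * ((b - a) / n))) atTop
      (𝓝 (∫ t in a..b, f t)) := by
  rcases eq_or_ne a b with rfl | hab
  · simp
  have hba : b - a ≠ 0 := sub_ne_zero.2 hab.symm
  have hlin : Continuous fun u : ℝ => a + (b - a) * u := by fun_prop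
  have h := (tendsto_riemannSum_unit (f := fun u => f (a + (b - a) * u))
    (hf.comp hlin.measurable) (fun t => hC _)
    (S := (fun u : ℝ => a + (b - a) * u) ⁻¹' S)
    (hS.preimage_of_injOn fun u _ v _ huv => by simpa [hba] using huv)
    (fun t ht => ContinuousAt.comp (f := fun u : ℝ => a + (b - a) * u) (hcont _ ht)
      hlin.continuousAt)).const_mul (b - a)
  have e : (b - a) * ∫ u in (0 : ℝ)..1, f (a + (b - a) * u) = ∫ t in a..b, f t := by
    rw [intervalIntegral.integral_comp_add_mul _ hba]
    simp [hba]
  rw [e] at h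
  refine h.congr fun n => ?_
  rw [Finset.mul_sum]
  refine Finset.sum_congr rfl fun m _ => ?_
  rw [← mul_assoc, mul_one_div]
  congr 2
  ring


theorem flipBefore_eventuallyEq {t p : ℝ} (h : p ≠ t) :
    ∀ᶠ u in 𝓝 t, flipBefore u p = flipBefore t p := by
  rcases lt_or_gt_of_ne h with h | h
  · filter_upwards [lt_mem_nhds h] with u hu
    simp [flipBefore, hu.le, h.le]
  · filter_upwards [gt_mem_nhds h] with u hu
    simp [flipBefore, not_le.2 hu, not_le.2 h]

/-- The set of all flip times of a configuration. -/
def flipTimes (ω : Config d N) : Set ℝ := ⋃ x, Set.range (ω.1 x).2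

theorem countable_flipTimes (ω : Config d N) : (flipTimes ω).Countable :=
  Set.countable_iUnion fun _ => Set.countable_range _

theorem spin_eventuallyEq (ω : Config d N) {t : ℝ} (ht : t ∉ flipTimes ω) :
    ∀ᶠ u in 𝓝 t, (fun x => spin ω x u) = fun x => spin ω x t := by
  have h : ∀ᶠ u in 𝓝 t, ∀ x, spin ω x u = spin ω x t := by
    refine eventually_all.2 fun x => ?_
    have : ∀ᶠ u in 𝓝 t, ∀ i, flipBefore u ((ω.1 x).2 i) = flipBefore t ((ω.1 x).2 i) :=
      eventually_all.2 fun i => flipBefore_eventuallyEq fun h =>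
        ht (Set.mem_iUnion.2 ⟨x, i, h⟩)
    filter_upwards [this] with u hu
    rw [spin_eq_mul, spin_eq_mul]
    simp only [Points.prodOver, hu]
  exact h.mono fun u hu => funext hu

theorem measurable_comp_spin_right (f : (Torus d N → ℝ) → ℝ) (ω : Config d N) :
    Measurable fun t => f fun x => spin ω x t := by
  obtain ⟨coef, hc⟩ := exists_monom_expansion f
  have : (fun t => f fun x => spin ω x t) = fun t =>
      ∑ A, coef A * monom (fun x => if x ∈ A then 1 else 0) fun x => spin ω x t :=
    funext fun t => hc _ fun x => spin_eq_or ω x t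
  rw [this]
  unfold monom
  exact Finset.measurable_sum _ fun A _ => measurable_const.mul
    (Finset.measurable_prod _ fun x _ => (measurable_spin_right ω x).pow_const _)

theorem intervalIntegrable_comp_spin (f : (Torus d N → ℝ) → ℝ) (ω : Config d N) (a b : ℝ) :
    IntervalIntegrable (fun t => f fun x => spin ω x t) volume a b := by
  obtain ⟨C, hC⟩ := exists_abs_comp_spin_le f
  exact (intervalIntegrable_const (c := C)).mono_fun
    (measurable_comp_spin_right f ω).aestronglyMeasurable
    (Eventually.of_forall fun t => (hC ω t).trans (le_abs_self C))

theorem tendsto_riemannSum_comp_spin (f : (Torus d N → ℝ) → ℝ) (ω : Config d N) (a b : ℝ) :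
    Tendsto (fun n : ℕ => ∑ m ∈ Finset.range n,
      (b - a) / n * f fun x => spin ω x (a + m * ((b - a) / n))) atTop
      (𝓝 (∫ t in a..b, f fun x => spin ω x t)) := by
  obtain ⟨C, hC⟩ := exists_abs_comp_spin_le f
  refine tendsto_riemannSum (f := fun t => f fun x => spin ω x t)
    (measurable_comp_spin_right f ω) (hC ω) (countable_flipTimes ω) (fun t ht => ?_) a b
  refine continuousAt_const.congr (f := fun _ => f fun x => spin ω x t) ?_
  exact (spin_eventuallyEq ω ht).mono fun u hu => congrArg f hu.symm

theorem measurable_integral_comp_spin (f : (Torus d N → ℝ) → ℝ) (a b : ℝ) :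
    Measurable fun ω : Config d N => ∫ t in a..b, f fun x => spin ω x t := by
  refine measurable_of_tendsto_metrizable (f := fun (n : ℕ) (ω : Config d N) =>
    ∑ m ∈ Finset.range n, (b - a) / n * f fun x => spin ω x (a + m * ((b - a) / n)))
    (fun n => ?_) ?_
  · exact Finset.measurable_sum _ fun m _ => measurable_const.mul (measurable_comp_spin _ _)
  · exact tendsto_pi_nhds.2 fun ω => tendsto_riemannSum_comp_spin f ω a b

theorem exists_abs_integral_comp_spin_le (f : (Torus d N → ℝ) → ℝ) (a b : ℝ) :
    ∃ C, ∀ ω : Config d N, |∫ t in a..b, f fun x => spin ω x t| ≤ C := by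
  obtain ⟨C, hC⟩ := exists_abs_comp_spin_le f
  refine ⟨C * |b - a|, fun ω => ?_⟩
  rw [← Real.norm_eq_abs]
  exact intervalIntegral.norm_integral_le_of_norm_le_const fun t _ => hC ω t

end RiemannSums

/-! ### The generator -/

/-- The real operator `σₓ⁽¹⁾`. -/
def flipAt (x : Torus d N) : RealOp d N := fun s s' =>
  if ∀ y, y ≠ x → s y = s' y then (if s x = s' x then 0 else 1) else 0

/-- The generator `-H = λ ∑ σ⁽³⁾σ⁽³⁾ + δ ∑ σ⁽¹⁾` as a real operator. -/
def generator (d N : ℕ) [NeZero N] (δ lam : ℝ) : RealOp d N :=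
  lam • diagOf bondSum + δ • ∑ x, flipAt x

/-- One step of the discretized dynamics. -/
def stepOp (δ lam τ : ℝ) : RealOp d N :=
  diagOf (fun v => Real.exp (τ * (lam * bondSum v))) * flipMat fun _ => δ * τ

theorem stepOp_zero (δ lam : ℝ) : (stepOp δ lam 0 : RealOp d N) = 1 := by
  simp [stepOp, flipMat_zero, diagOf_one]

theorem hasDerivAt_flipKernel (δ : ℝ) (a b : Fin 2) :
    HasDerivAt (fun τ => flipKernel (δ * τ) a b) (if a = b then 0 else δ) 0 := by
  have h : HasDerivAt (fun τ : ℝ => δ * τ) δ 0 := by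
    simpa using (hasDerivAt_id (0 : ℝ)).const_mul δ
  unfold flipKernel
  split_ifs
  · simpa using h.cosh
  · simpa using h.sinh

theorem hasDerivAt_stepOp_apply (δ lam : ℝ) (s s' : Torus d N → Fin 2) :
    HasDerivAt (fun τ => (stepOp δ lam τ : RealOp d N) s s') (generator d N δ lam s s') 0 := by
  classical
  set B : ℝ := bondSum fun x => sgn (s x)
  have h1 : HasDerivAt (fun τ : ℝ => Real.exp (τ * (lam * B))) (lam * B) 0 := by
    simpa using ((hasDerivAt_id (0 : ℝ)).mul_const (lam * B)).exp
  have h2 := HasDerivAt.fun_finsetProd (u := (Finset.univ : Finset (Torus d N)))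
    fun x _ => hasDerivAt_flipKernel δ (s x) (s' x)
  have h := h1.mul h2
  have e : (fun τ => (stepOp δ lam τ : RealOp d N) s s') =
      (fun τ : ℝ => Real.exp (τ * (lam * B))) * fun τ => ∏ x, flipKernel (δ * τ) (s x) (s' x) := by
    funext τ
    simp [stepOp, diagOf, Matrix.diagonal_mul, flipMat, B]
  rw [e]
  convert! h using 1
  have h0 : ∀ y, flipKernel (δ * 0) (s y) (s' y) = if s y = s' y then 1 else 0 := fun y => by
    simp [flipKernel]
  simp only [h0]
  simp only [zero_mul, Real.exp_zero, one_mul, generator, Matrix.add_apply, Matrix.smul_apply,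
    smul_eq_mul, Matrix.sum_apply, Finset.mul_sum, Finset.prod_ite_zero, Finset.prod_const_one]
  congr 1
  · by_cases h : s = s'
    · subst h
      simp [diagOf, B]
    · have : ¬ ∀ i, s i = s' i := fun h' => h (funext h')
      simp [diagOf, h, this]
  · refine Finset.sum_congr rfl fun x _ => ?_
    simp only [flipAt, Finset.mem_erase, Finset.mem_univ, and_true]
    split_ifs <;> simp

section Topology
open Filter Topology
open scoped Matrix.Norms.Operator

theorem hasDerivAt_stepOp (δ lam : ℝ) :
    HasDerivAt (fun τ => (stepOp δ lam τ : RealOp d N)) (generator d N δ lam) 0 := by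
  have e : ∀ M : RealOp d N, M = ∑ s, ∑ s', M s s' • Matrix.single s s' (1 : ℝ) := fun M => by
    conv_lhs => rw [Matrix.matrix_eq_sum_single M]
    simp [Matrix.smul_single]
  rw [e (generator d N δ lam), show (fun τ => (stepOp δ lam τ : RealOp d N)) = fun τ =>
    ∑ s, ∑ s', (stepOp δ lam τ : RealOp d N) s s' • Matrix.single s s' (1 : ℝ) from
      funext fun τ => e _]
  exact HasDerivAt.fun_sum fun s _ => HasDerivAt.fun_sum fun s' _ =>
    (hasDerivAt_stepOp_apply δ lam s s').smul_const _

theorem tendsto_stepOp_pow (δ lam t : ℝ) :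
    Tendsto (fun n : ℕ => (stepOp δ lam (t / n) : RealOp d N) ^ n) atTop
      (𝓝 (NormedSpace.exp (t • generator d N δ lam))) :=
  tendsto_pow_of_hasDerivAt (stepOp_zero δ lam) (hasDerivAt_stepOp δ lam) t

end Topology

/-! ### Time-ordered products on a grid -/

/-- The Boltzmann factor of a time step. -/
def boltz (lam τ : ℝ) (v : Torus d N → ℝ) : ℝ := Real.exp (τ * (lam * bondSum v))

theorem duration_replicate_append (lam τ : ℝ) (n : ℕ)
    (l : List (((Torus d N → ℝ) → ℝ) × ℝ)) :
    duration (List.replicate n (boltz lam τ, τ) ++ l) = duration l + n * τ := by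
  simp [duration, add_comm]

theorem pathFun_replicate_append (lam τ : ℝ) (n : ℕ)
    (l : List (((Torus d N → ℝ) → ℝ) × ℝ)) (ω : Config d N) :
    pathFun (List.replicate n (boltz lam τ, τ) ++ l) ω = pathFun l ω *
      Real.exp (lam * ∑ m ∈ Finset.range n,
        τ * bondSum fun x => spin ω x (duration l + m * τ)) := by
  induction n with
  | zero => simp
  | succ n ih =>
    rw [List.replicate_succ, List.cons_append, pathFun, ih, duration_replicate_append,
      Finset.sum_range_succ, mul_add lam, Real.exp_add, mul_assoc]
    simp only [boltz]
    congr 3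
    ring

theorem pathOp_append (δ : ℝ) (l l' : List (((Torus d N → ℝ) → ℝ) × ℝ)) :
    pathOp δ (l ++ l') = pathOp δ l' * pathOp δ l := by
  induction l with
  | nil => simp [pathOp]
  | cons p l ih => rw [List.cons_append, pathOp, ih, pathOp, mul_assoc]

theorem pathOp_replicate (δ lam τ : ℝ) (n : ℕ) :
    pathOp δ (List.replicate n (boltz lam τ, τ)) = (stepOp δ lam τ : RealOp d N) ^ n := by
  induction n with
  | zero => simp [pathOp]
  | succ n ih => rw [List.replicate_succ, pathOp, ih, pow_succ]; rfl

/-- The grid refining `0 ≤ s ≤ t ≤ β`, with `F` inserted at time `s` and `G` at time `t`. -/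
def gridList (β lam s t : ℝ) (F G : (Torus d N → ℝ) → ℝ) (n : ℕ) :
    List (((Torus d N → ℝ) → ℝ) × ℝ) :=
  List.replicate n (boltz lam ((β - t) / n), (β - t) / n) ++ (G, 0) ::
    (List.replicate n (boltz lam ((t - s) / n), (t - s) / n) ++ (F, 0) ::
      (List.replicate n (boltz lam ((s - 0) / n), (s - 0) / n) ++ []))

theorem pathOp_gridList (β δ lam s t : ℝ) (F G : (Torus d N → ℝ) → ℝ) (n : ℕ) :
    pathOp δ (gridList β lam s t F G n) =
      stepOp δ lam (s / n) ^ n * diagOf F * stepOp δ lam ((t - s) / n) ^ n * diagOf G *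
        stepOp δ lam ((β - t) / n) ^ n := by
  rw [gridList, pathOp_append, pathOp, pathOp_append, pathOp, pathOp_append, pathOp_replicate,
    pathOp_replicate, pathOp_replicate]
  simp [pathOp, flipMat_zero]

theorem duration_gridList (β lam s t : ℝ) (F G : (Torus d N → ℝ) → ℝ) {n : ℕ} (hn : 0 < n) :
    duration (gridList β lam s t F G n) = β := by
  have : (n : ℝ) ≠ 0 := by positivity
  simp only [gridList, duration_replicate_append, duration_cons, mul_div_cancel₀ _ this]
  simp [duration]

theorem pathFun_gridList (β lam s t : ℝ) (F G : (Torus d N → ℝ) → ℝ) {n : ℕ} (hn : 0 < n)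
    (ω : Config d N) :
    pathFun (gridList β lam s t F G n) ω = F (fun x => spin ω x s) * G (fun x => spin ω x t) *
      Real.exp (lam * (
        ∑ m ∈ Finset.range n, (s - 0) / n * bondSum (fun x => spin ω x (0 + m * ((s - 0) / n))) +
        ∑ m ∈ Finset.range n, (t - s) / n * bondSum (fun x => spin ω x (s + m * ((t - s) / n))) +
        ∑ m ∈ Finset.range n,
          (β - t) / n * bondSum (fun x => spin ω x (t + m * ((β - t) / n))))) := by
  have hn' : (n : ℝ) ≠ 0 := by positivity
  have d0 : duration ([] : List (((Torus d N → ℝ) → ℝ) × ℝ)) = 0 := by simp [duration]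
  simp only [gridList, pathFun_replicate_append, pathFun, duration_replicate_append,
    duration_cons, mul_div_cancel₀ _ hn', d0, zero_add, one_mul, sub_zero, add_sub_cancel]
  rw [mul_add, mul_add, Real.exp_add, Real.exp_add]
  ring

/-! ### The Feynman–Kac formula -/

/-- The semigroup `e^{-tH}` as a real operator. -/
def semigroup (d N : ℕ) [NeZero N] (δ lam t : ℝ) : RealOp d N :=
  NormedSpace.exp (t • generator d N δ lam)

theorem semigroup_mul (δ lam s t : ℝ) :
    semigroup d N δ lam s * semigroup d N δ lam t = semigroup d N δ lam (s + t) := by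
  rw [semigroup, semigroup, semigroup, add_smul, Matrix.exp_add_of_commute]
  exact ((Commute.refl _).smul_left _).smul_right _

theorem semigroup_zero (δ lam : ℝ) : semigroup d N δ lam 0 = 1 := by
  simp [semigroup, NormedSpace.exp_zero]

theorem action_spin_eq (β lam : ℝ) (ω : Config d N) (s t : ℝ) :
    action β lam (spin ω) = lam * (
      (∫ u in (0 : ℝ)..s, bondSum fun x => spin ω x u) +
      (∫ u in s..t, bondSum fun x => spin ω x u) + ∫ u in t..β, bondSum fun x => spin ω x u) := by
  have hi := intervalIntegrable_comp_spin (bondSum (R := ℝ)) ω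
  rw [intervalIntegral.integral_add_adjacent_intervals (hi _ _) (hi _ _),
    intervalIntegral.integral_add_adjacent_intervals (hi _ _) (hi _ _), action]

theorem measurable_action_spin (β lam : ℝ) :
    Measurable fun ω : Config d N => action β lam (spin ω) :=
  (measurable_integral_comp_spin bondSum 0 β).const_mul lam

theorem abs_riemannSum_le {f : ℝ → ℝ} {C : ℝ} (hC : ∀ t, |f t| ≤ C) {a b : ℝ} (hab : a ≤ b)
    (n : ℕ) : |∑ m ∈ Finset.range n, (b - a) / n * f (a + m * ((b - a) / n))| ≤ (b - a) * C := by
  have hC0 : 0 ≤ C := (abs_nonneg _).trans (hC 0)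
  have hba := sub_nonneg.2 hab
  refine (Finset.abs_sum_le_sum_abs _ _).trans ?_
  refine (Finset.sum_le_sum (g := fun _ => (b - a) / n * C) fun m _ => ?_).trans ?_
  · rw [abs_mul, abs_of_nonneg (by positivity)]
    exact mul_le_mul_of_nonneg_left (hC _) (by positivity)
  · rw [Finset.sum_const, Finset.card_range, nsmul_eq_mul]
    rcases Nat.eq_zero_or_pos n with rfl | hn
    · simpa using mul_nonneg hba hC0
    · rw [← mul_assoc, mul_div_cancel₀ _ (by positivity)]

theorem exists_abs_action_spin_le (β lam : ℝ) :
    ∃ C, ∀ ω : Config d N, |action β lam (spin ω)| ≤ C := by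
  obtain ⟨C, hC⟩ := exists_abs_integral_comp_spin_le (d := d) (N := N) bondSum 0 β
  refine ⟨|lam| * C, fun ω => ?_⟩
  rw [action, abs_mul]
  exact mul_le_mul_of_nonneg_left (hC ω) (abs_nonneg _)

open Filter Topology in
/-- The Feynman–Kac formula with two insertions. -/
theorem integral_mul_exp_action {β δ lam : ℝ} (hβ : 0 < β) (hδ : 0 < δ) {s t : ℝ}
    (hs : 0 ≤ s) (hst : s ≤ t) (htβ : t ≤ β) (F G : (Torus d N → ℝ) → ℝ) :
    ∫ ω, F (fun x => spin ω x s) * G (fun x => spin ω x t) * Real.exp (action β lam (spin ω))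
        ∂(aPriori d N β δ) =
      (semigroup d N δ lam s * diagOf F * semigroup d N δ lam (t - s) * diagOf G *
        semigroup d N δ lam (β - t)).trace /
          (2 * Real.cosh (δ * β)) ^ Fintype.card (Torus d N) := by
  have := isProbabilityMeasure_aPriori (d := d) (N := N) hβ hδ
  obtain ⟨C, hC⟩ := exists_abs_comp_spin_le (d := d) (N := N) bondSum
  obtain ⟨CF, hCF⟩ := exists_abs_comp_spin_le F
  obtain ⟨CG, hCG⟩ := exists_abs_comp_spin_le G
  have hlim : Tendsto (fun n : ℕ => ∫ ω, pathFun (gridList β lam s t F G n) ω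
      ∂(aPriori d N β δ)) atTop (𝓝 (∫ ω, F (fun x => spin ω x s) * G (fun x => spin ω x t) *
        Real.exp (action β lam (spin ω)) ∂(aPriori d N β δ))) := by
    refine tendsto_integral_filter_of_dominated_convergence
      (fun _ => CF * CG * Real.exp (|lam| * (s * C + (t - s) * C + (β - t) * C))) ?_ ?_
      (integrable_const _) ?_
    · exact Eventually.of_forall fun n => (measurable_pathFun _).aestronglyMeasurable
    · filter_upwards [eventually_gt_atTop 0] with n hn
      refine Eventually.of_forall fun ω => ?_
      have h1 := abs_riemannSum_le (hC ω) hs n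
      have h2 := abs_riemannSum_le (hC ω) hst n
      have h3 := abs_riemannSum_le (hC ω) htβ n
      rw [pathFun_gridList β lam s t F G hn, Real.norm_eq_abs, abs_mul, abs_mul, Real.abs_exp]
      refine mul_le_mul (mul_le_mul (hCF ω s) (hCG ω t) (abs_nonneg _)
        ((abs_nonneg _).trans (hCF ω s))) (Real.exp_le_exp.2 ?_) (Real.exp_nonneg _)
        (mul_nonneg ((abs_nonneg _).trans (hCF ω s)) ((abs_nonneg _).trans (hCG ω t)))
      refine (le_abs_self _).trans ?_
      rw [abs_mul]
      refine mul_le_mul_of_nonneg_left ((abs_add_three _ _ _).trans ?_) (abs_nonneg _)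
      rw [sub_zero] at h1
      gcongr
      simpa using h1
    · refine Eventually.of_forall fun ω => ?_
      have h1 := tendsto_riemannSum_comp_spin bondSum ω 0 s
      have h2 := tendsto_riemannSum_comp_spin bondSum ω s t
      have h3 := tendsto_riemannSum_comp_spin bondSum ω t β
      have h := ((((h1.add h2).add h3).const_mul lam).rexp).const_mul
        (F (fun x => spin ω x s) * G (fun x => spin ω x t))
      rw [← action_spin_eq] at h
      refine h.congr' ?_
      filter_upwards [eventually_gt_atTop 0] with n hn
      rw [pathFun_gridList β lam s t F G hn]
  refine tendsto_nhds_unique hlim ?_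
  have hop : Tendsto (fun n : ℕ => (pathOp δ (gridList β lam s t F G n)).trace /
      (2 * Real.cosh (δ * β)) ^ Fintype.card (Torus d N)) atTop (𝓝 ((semigroup d N δ lam s *
        diagOf F * semigroup d N δ lam (t - s) * diagOf G *
        semigroup d N δ lam (β - t)).trace /
          (2 * Real.cosh (δ * β)) ^ Fintype.card (Torus d N))) := by
    simp_rw [pathOp_gridList]
    refine Tendsto.div_const ?_ _
    refine ((continuous_id.matrix_trace).tendsto _).comp ?_
    exact ((((tendsto_stepOp_pow δ lam s).mul tendsto_const_nhds).mul
      (tendsto_stepOp_pow δ lam (t - s))).mul tendsto_const_nhds).mul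
      (tendsto_stepOp_pow δ lam (β - t))
  refine hop.congr' ?_
  filter_upwards [eventually_gt_atTop 0] with n hn
  refine (integral_pathFun hβ hδ _ (fun p hp => ?_) (duration_gridList β lam s t F G hn)).symm
  have h1 : 0 ≤ (β - t) / n := div_nonneg (by linarith) n.cast_nonneg
  have h2 : 0 ≤ (t - s) / n := div_nonneg (by linarith) n.cast_nonneg
  have h3 : 0 ≤ (s - 0) / n := div_nonneg (by linarith) n.cast_nonneg
  simp only [gridList, List.mem_append, List.mem_cons, List.mem_replicate, List.not_mem_nil,
    or_false] at hp
  rcases hp with ⟨-, rfl⟩ | rfl | ⟨-, rfl⟩ | rfl | ⟨-, rfl⟩ <;> simp_all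

/-- The real operator `σₓ⁽³⁾`. -/
def spinOp (x : Torus d N) : RealOp d N := diagOf fun v => v x

/-- The unnormalized imaginary-time two-point function. -/
def traceTwoPoint (β δ lam : ℝ) (x y : Torus d N) (t : ℝ) : ℝ :=
  (spinOp x * semigroup d N δ lam t * spinOp y * semigroup d N δ lam (β - t)).trace

theorem integral_exp_action {β δ lam : ℝ} (hβ : 0 < β) (hδ : 0 < δ) :
    ∫ ω, Real.exp (action β lam (spin ω)) ∂(aPriori d N β δ) =
      (semigroup d N δ lam β).trace / (2 * Real.cosh (δ * β)) ^ Fintype.card (Torus d N) := by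
  have h := integral_mul_exp_action (d := d) (N := N) (lam := lam) hβ hδ le_rfl hβ.le le_rfl
    (fun _ => 1) (fun _ => 1)
  simpa [diagOf_one, semigroup_zero] using h

theorem integrable_exp_action {β δ : ℝ} (lam : ℝ) (hβ : 0 < β) (hδ : 0 < δ) :
    Integrable (fun ω => Real.exp (action β lam (spin ω))) (aPriori d N β δ) := by
  have := isProbabilityMeasure_aPriori (d := d) (N := N) hβ hδ
  obtain ⟨C, hC⟩ := exists_abs_action_spin_le (d := d) (N := N) β lam
  refine Integrable.of_bound (measurable_action_spin β lam).exp.aestronglyMeasurable (Real.exp C)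
    (Filter.Eventually.of_forall fun ω => ?_)
  rw [Real.norm_eq_abs, Real.abs_exp]
  exact Real.exp_le_exp.2 ((le_abs_self _).trans (hC ω))

theorem integral_exp_action_pos {β δ : ℝ} (lam : ℝ) (hβ : 0 < β) (hδ : 0 < δ) :
    0 < ∫ ω, Real.exp (action β lam (spin ω)) ∂(aPriori d N β δ) := by
  have := isProbabilityMeasure_aPriori (d := d) (N := N) hβ hδ
  exact integral_exp_pos (integrable_exp_action lam hβ hδ)

theorem trace_semigroup_pos {β δ : ℝ} (lam : ℝ) (hβ : 0 < β) (hδ : 0 < δ) :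
    0 < (semigroup d N δ lam β).trace := by
  have h := integral_exp_action_pos (d := d) (N := N) lam hβ hδ
  rw [integral_exp_action hβ hδ] at h
  have hc := Real.cosh_pos (δ * β)
  exact (div_pos_iff_of_pos_right (by positivity)).1 h

theorem schwinger_eq_div {β δ lam : ℝ} (x : Torus d N) (s : ℝ) (y : Torus d N) (t : ℝ) :
    schwinger β δ lam x s y t =
      (∫ ω, spin ω x s * spin ω y t * Real.exp (action β lam (spin ω)) ∂(aPriori d N β δ)) /
        ∫ ω, Real.exp (action β lam (spin ω)) ∂(aPriori d N β δ) := by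
  rw [schwinger, stIsing, integral_map measurable_spin.aemeasurable, integral_tilted,
    ← integral_div]
  · refine integral_congr_ae (Filter.Eventually.of_forall fun ω => ?_)
    simp only [smul_eq_mul]
    ring
  · have h : ∀ (x : Torus d N) (t : ℝ), Measurable fun σ : Torus d N → ℝ → ℝ => σ x t :=
      fun x t => (measurable_pi_apply t).comp (measurable_pi_apply x)
    exact ((h x s).mul (h y t)).aestronglyMeasurable

theorem trace_semigroup_cycle (β δ lam s t : ℝ) (B C : RealOp d N) :
    (semigroup d N δ lam s * B * semigroup d N δ lam (t - s) * C *
      semigroup d N δ lam (β - t)).trace =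
        (B * semigroup d N δ lam (t - s) * C * semigroup d N δ lam (β - (t - s))).trace := by
  rw [Matrix.trace_mul_comm _ (semigroup d N δ lam (β - t))]
  simp only [← mul_assoc, semigroup_mul]
  rw [Matrix.trace_mul_comm _ (semigroup d N δ lam (β - (t - s))),
    show β - (t - s) = β - t + s by ring]
  simp only [mul_assoc]

theorem schwinger_eq_traceTwoPoint {β δ lam : ℝ} (hβ : 0 < β) (hδ : 0 < δ) {s t : ℝ}
    (hs : 0 ≤ s) (hst : s ≤ t) (htβ : t ≤ β) (x y : Torus d N) :
    schwinger β δ lam x s y t =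
      traceTwoPoint β δ lam x y (t - s) / (semigroup d N δ lam β).trace := by
  have hc := Real.cosh_pos (δ * β)
  have hZ := trace_semigroup_pos (d := d) (N := N) lam hβ hδ
  have h := integral_mul_exp_action (d := d) (N := N) (lam := lam) hβ hδ hs hst htβ
    (fun v => v x) (fun v => v y)
  rw [schwinger_eq_div, integral_exp_action hβ hδ]
  simp only [trace_semigroup_cycle] at h
  rw [h, traceTwoPoint, spinOp, spinOp]
  field_simp

/-! ### Reflections of the torus -/

/-- The sum of a symmetric function over the nearest-neighbour pairs. -/
def edgeSum {α : Type*} (ψ : α → α → ℝ) (u : Torus d N → α) : ℝ :=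
  ∑ x, ∑ j, ψ (u (x + Pi.single j 1)) (u x)

/-- The half torus of the points whose `i`-th coordinate is one of `a, …, a + N - 1`. -/
def InHalf (i : Fin d) (a : ZMod (2 * N)) (x : Torus d N) : Prop := (x i - a).val < N

/-- The reflection that exchanges the half torus and its complement. -/
def reflect (i : Fin d) (a : ZMod (2 * N)) (x : Torus d N) : Torus d N :=
  Function.update x i (2 * a - 1 - x i)

theorem val_neg_one_sub (y : ZMod (2 * N)) : (-1 - y).val = 2 * N - 1 - y.val := by
  have hN := NeZero.pos N
  have hy := ZMod.val_lt y
  have h : (-1 - y : ZMod (2 * N)) = ((2 * N - 1 - y.val : ℕ) : ZMod (2 * N)) := by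
    rw [Nat.cast_sub (by omega), Nat.cast_sub (by omega), ZMod.natCast_self, ZMod.natCast_zmod_val]
    simp
  rw [h, ZMod.val_natCast_of_lt (by omega)]

section Reflection
variable (i : Fin d) (a : ZMod (2 * N))

theorem reflect_reflect (x : Torus d N) : reflect i a (reflect i a x) = x := by
  simp [reflect]

theorem inHalf_reflect (x : Torus d N) : InHalf i a (reflect i a x) ↔ ¬ InHalf i a x := by
  have h : reflect i a x i - a = -1 - (x i - a) := by
    simp only [reflect, Function.update_self]; ring
  have hy := ZMod.val_lt (x i - a)
  rw [InHalf, InHalf, h, val_neg_one_sub]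
  omega

theorem inHalf_add_single_of_ne {j : Fin d} (hj : j ≠ i) (x : Torus d N) :
    InHalf i a (x + Pi.single j 1) ↔ InHalf i a x := by
  simp [InHalf, Pi.single_eq_of_ne hj.symm]

theorem reflect_add_single_of_ne {j : Fin d} (hj : j ≠ i) (x : Torus d N) :
    reflect i a (x + Pi.single j 1) = reflect i a x + Pi.single j 1 := by
  funext m
  by_cases hm : m = i
  · subst hm
    simp [reflect, Pi.single_eq_of_ne hj.symm]
  · simp [reflect, hm]

theorem reflect_add_single_add_single (x : Torus d N) :
    reflect i a (x + Pi.single i 1) + Pi.single i 1 = reflect i a x := by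
  funext m
  by_cases hm : m = i
  · subst hm
    simp only [reflect, Pi.add_apply, Function.update_self, Pi.single_eq_same]
    ring
  · simp [reflect, hm]

theorem add_single_eq_reflect {x : Torus d N}
    (h : ¬ (InHalf i a x ↔ InHalf i a (x + Pi.single i 1))) :
    x + Pi.single i 1 = reflect i a x := by
  have hN := NeZero.pos N
  set y : ZMod (2 * N) := x i - a with hy
  have hlt := ZMod.val_lt y
  have e1 : (x + Pi.single i 1 : Torus d N) i - a = y + 1 := by simp [hy]; ring
  have key : y + 1 = -1 - y := by
    apply ZMod.val_injective
    rw [val_neg_one_sub]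
    rw [InHalf, InHalf, e1, ← hy] at h
    rcases (show y.val + 1 < 2 * N ∨ y.val + 1 = 2 * N by omega) with hc | hc
    · have : (y + 1).val = y.val + 1 := by
        rw [ZMod.val_add_of_lt, ZMod.val_one'' (by omega)]
        rwa [ZMod.val_one'' (by omega)]
      rw [this] at h ⊢
      omega
    · have : y + 1 = 0 := by
        have h2 : ((y.val + 1 : ℕ) : ZMod (2 * N)) = 0 := by rw [hc, ZMod.natCast_self]
        simpa using h2
      rw [this, ZMod.val_zero]
      omega
  funext m
  by_cases hm : m = i
  · subst hm
    have : (x + Pi.single m 1 : Torus d N) m = a + (y + 1) := by rw [← e1]; ring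
    rw [this, key, reflect, Function.update_self, hy]
    ring
  · simp [reflect, hm]

/-- The reflection as a permutation. -/
def reflectEquiv : Torus d N ≃ Torus d N :=
  ⟨reflect i a, reflect i a, reflect_reflect i a, reflect_reflect i a⟩

/-- The exchange of the edges in direction `i` by the reflection, in terms of base points. -/
def reflectEdgeEquiv : Torus d N ≃ Torus d N :=
  ⟨fun x => reflect i a (x + Pi.single i 1), fun x => reflect i a (x + Pi.single i 1),
    fun x => by simp only [reflect_add_single_add_single, reflect_reflect],
    fun x => by simp only [reflect_add_single_add_single, reflect_reflect]⟩

open Classical in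
/-- The part of `edgeSum` from the edges inside the half torus. -/
def innerSum {α : Type*} (ψ : α → α → ℝ) (u : Torus d N → α) : ℝ :=
  ∑ x, ∑ j, if InHalf i a x ∧ InHalf i a (x + Pi.single j 1) then
    ψ (u (x + Pi.single j 1)) (u x) else 0

open Classical in
/-- The projection of the torus to the half torus. -/
def toHalf (x : Torus d N) : Torus d N := if InHalf i a x then x else reflect i a x

theorem inHalf_toHalf (x : Torus d N) : InHalf i a (toHalf i a x) := by
  unfold toHalf
  split_ifs with h
  · exact h
  · exact (inHalf_reflect i a x).2 h

theorem toHalf_of_inHalf {x : Torus d N} (h : InHalf i a x) : toHalf i a x = x := if_pos h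

theorem toHalf_reflect (x : Torus d N) : toHalf i a (reflect i a x) = toHalf i a x := by
  unfold toHalf
  by_cases h : InHalf i a x
  · rw [if_pos h, if_neg (by rw [inHalf_reflect]; exact not_not.2 h), reflect_reflect]
  · rw [if_neg h, if_pos ((inHalf_reflect i a x).2 h)]

open Classical in
/-- The indicator of the edges in direction `i` that cross the reflection plane. -/
def crossing (x : Torus d N) : ℝ :=
  if InHalf i a x ↔ InHalf i a (x + Pi.single i 1) then 0 else 1

theorem crossing_sq (x : Torus d N) : crossing i a x ^ 2 = crossing i a x := by
  unfold crossing; split_ifs <;> simp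

theorem crossing_nonneg (x : Torus d N) : 0 ≤ crossing i a x := by
  unfold crossing; split_ifs <;> simp

theorem innerSum_comp_reflect {α : Type*} {ψ : α → α → ℝ} (hψ : ∀ p q, ψ p q = ψ q p)
    (u : Torus d N → α) [DecidablePred (InHalf (N := N) i a)] :
    innerSum i a ψ (u ∘ reflect i a) =
      ∑ x, ∑ j, if ¬ InHalf i a x ∧ ¬ InHalf i a (x + Pi.single j 1) then
        ψ (u (x + Pi.single j 1)) (u x) else 0 := by
  unfold innerSum
  rw [Finset.sum_comm, Finset.sum_comm (s := Finset.univ (α := Torus d N))]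
  refine Finset.sum_congr rfl fun j _ => ?_
  by_cases hj : j = i
  · subst hj
    rw [← Equiv.sum_comp (reflectEdgeEquiv j a)]
    refine Finset.sum_congr rfl fun x _ => ?_
    simp only [reflectEdgeEquiv, Equiv.coe_fn_mk, reflect_add_single_add_single, inHalf_reflect,
      Function.comp_apply, reflect_reflect]
    rw [hψ]
    congr 1
    simp only [and_comm]
  · rw [← Equiv.sum_comp (reflectEquiv i a)]
    refine Finset.sum_congr rfl fun x _ => ?_
    simp only [reflectEquiv, Equiv.coe_fn_mk, ← reflect_add_single_of_ne i a hj, inHalf_reflect,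
      Function.comp_apply, reflect_reflect]

/-- Decomposition of an edge sum along the reflection plane. -/
theorem edgeSum_eq {α : Type*} {ψ : α → α → ℝ} (hψ : ∀ p q, ψ p q = ψ q p)
    (u : Torus d N → α) :
    edgeSum ψ u = innerSum i a ψ u + innerSum i a ψ (u ∘ reflect i a) +
      ∑ x, crossing i a x * ψ (u (toHalf i a x)) (u (reflect i a (toHalf i a x))) := by
  classical
  have hcross : ∑ x, crossing i a x * ψ (u (toHalf i a x)) (u (reflect i a (toHalf i a x))) =
      ∑ x, ∑ j, if (InHalf i a x ↔ InHalf i a (x + Pi.single j 1)) then 0 else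
        ψ (u (x + Pi.single j 1)) (u x) := by
    refine Finset.sum_congr rfl fun x _ => ?_
    rw [Finset.sum_eq_single i]
    · unfold crossing
      by_cases h : InHalf i a x ↔ InHalf i a (x + Pi.single i 1)
      · rw [if_pos h, if_pos h, zero_mul]
      · rw [if_neg h, if_neg h, one_mul, add_single_eq_reflect i a h]
        unfold toHalf
        split_ifs
        · exact hψ _ _
        · rw [reflect_reflect]
    · intro j _ hj
      rw [if_pos (inHalf_add_single_of_ne i a hj x).symm]
    · simp
  rw [hcross, innerSum_comp_reflect i a hψ, innerSum, edgeSum, ← Finset.sum_add_distrib,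
    ← Finset.sum_add_distrib]
  refine Finset.sum_congr rfl fun x _ => ?_
  rw [← Finset.sum_add_distrib, ← Finset.sum_add_distrib]
  refine Finset.sum_congr rfl fun j _ => ?_
  by_cases h1 : InHalf i a x <;> by_cases h2 : InHalf i a (x + Pi.single j 1) <;> simp [h1, h2]

theorem innerSum_congr {α : Type*} (ψ : α → α → ℝ) {u v : Torus d N → α}
    (h : ∀ x, InHalf i a x → u x = v x) : innerSum i a ψ u = innerSum i a ψ v := by
  unfold innerSum
  refine Finset.sum_congr rfl fun x _ => Finset.sum_congr rfl fun j _ => ?_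
  split_ifs with hx
  · rw [h _ hx.1, h _ hx.2]
  · rfl

/-- The edge sum of a reflection-symmetric configuration. -/
theorem edgeSum_comp_toHalf {α : Type*} {ψ : α → α → ℝ} (hψ : ∀ p q, ψ p q = ψ q p)
    (hψ0 : ∀ p, ψ p p = 0) (u : Torus d N → α) :
    edgeSum ψ (u ∘ toHalf i a) = 2 * innerSum i a ψ u := by
  rw [edgeSum_eq i a hψ, innerSum_congr i a ψ (u := u ∘ toHalf i a) (v := u)
    fun x hx => by simp [toHalf_of_inHalf i a hx],
    innerSum_congr i a ψ (u := (u ∘ toHalf i a) ∘ reflect i a) (v := u)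
    fun x hx => by simp [toHalf_reflect, toHalf_of_inHalf i a hx]]
  simp [toHalf_reflect, hψ0]
  ring

end Reflection

/-! ### Gaussian domination -/

/-- The square of the Euclidean distance. -/
def sqDist {ι : Type*} [Fintype ι] (p q : ι → ℝ) : ℝ := ∑ m, (p m - q m) ^ 2

theorem sqDist_comm {ι : Type*} [Fintype ι] (p q : ι → ℝ) : sqDist p q = sqDist q p :=
  Finset.sum_congr rfl fun _ _ => by ring

theorem sqDist_nonneg {ι : Type*} [Fintype ι] (p q : ι → ℝ) : 0 ≤ sqDist p q :=
  Finset.sum_nonneg fun _ _ => sq_nonneg _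

theorem lintegral_exp_sum_gaussian {κ : Type*} [Fintype κ] (c : κ → ℝ) :
    ∫⁻ g, ENNReal.ofReal (Real.exp (∑ k, c k * g k))
        ∂(Measure.pi fun _ : κ => gaussianReal 0 1) =
      ENNReal.ofReal (Real.exp (∑ k, c k ^ 2 / 2)) := by
  have hInt : Integrable (fun g : κ → ℝ => Real.exp (∑ k, c k * g k))
      (Measure.pi fun _ : κ => gaussianReal 0 1) := by
    simp_rw [Real.exp_sum]
    exact Integrable.fintype_prod fun k => integrable_exp_mul_gaussianReal (c k)
  rw [← ofReal_integral_eq_lintegral_ofReal hInt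
    (Filter.Eventually.of_forall fun _ => Real.exp_nonneg _)]
  congr 1
  simp_rw [Real.exp_sum]
  rw [integral_fintype_prod_eq_prod (f := fun k (x : ℝ) => Real.exp (c k * x))]
  refine Finset.prod_congr rfl fun k _ => ?_
  have := congrFun (mgf_fun_id_gaussianReal (μ := 0) (v := 1)) (c k)
  simpa [mgf] using this

section ReflectionPositivity

variable {ι : Type*} [Fintype ι] (i : Fin d) (a : ZMod (2 * N))

/-- The factor of the Boltzmann weight that belongs to the half torus, in the presence of the
auxiliary Gaussian field `g`. -/
def halfWeight (g : Torus d N × ι → ℝ) (u : Torus d N → ι → ℝ) : ℝ :=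
  Real.exp (-(1 / 2) * innerSum i a sqDist u + ∑ k : Torus d N × ι,
    crossing i a k.1 * (g k * u (toHalf i a k.1) k.2 - u (toHalf i a k.1) k.2 ^ 2))

theorem halfWeight_congr (g : Torus d N × ι → ℝ) {u v : Torus d N → ι → ℝ}
    (h : ∀ x, InHalf i a x → u x = v x) : halfWeight i a g u = halfWeight i a g v := by
  simp only [halfWeight, innerSum_congr i a sqDist h, h _ (inHalf_toHalf i a _)]

theorem ofReal_exp_edgeSum_eq_lintegral (u : Torus d N → ι → ℝ) :
    ENNReal.ofReal (Real.exp (-(1 / 2) * edgeSum sqDist u)) =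
      ∫⁻ g, ENNReal.ofReal (halfWeight i a g u) *
        ENNReal.ofReal (halfWeight i a g (u ∘ reflect i a))
          ∂(Measure.pi fun _ : Torus d N × ι => gaussianReal 0 1) := by
  set p : Torus d N × ι → ℝ := fun k => u (toHalf i a k.1) k.2
  set q : Torus d N × ι → ℝ := fun k => u (reflect i a (toHalf i a k.1)) k.2
  set c : Torus d N × ι → ℝ := fun k => crossing i a k.1 * (p k + q k)
  set K : ℝ := -(1 / 2) * innerSum i a sqDist u + -(1 / 2) * innerSum i a sqDist (u ∘ reflect i a) -
    ∑ k : Torus d N × ι, crossing i a k.1 * (p k ^ 2 + q k ^ 2)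
  have h1 : ∀ g : Torus d N × ι → ℝ, ENNReal.ofReal (halfWeight i a g u) *
      ENNReal.ofReal (halfWeight i a g (u ∘ reflect i a)) =
        ENNReal.ofReal (Real.exp K) * ENNReal.ofReal (Real.exp (∑ k, c k * g k)) := fun g => by
    rw [halfWeight, halfWeight, ← ENNReal.ofReal_mul (Real.exp_nonneg _),
      ← ENNReal.ofReal_mul (Real.exp_nonneg _), ← Real.exp_add, ← Real.exp_add]
    congr 2
    have : ∑ k, c k * g k = ∑ k : Torus d N × ι,
        crossing i a k.1 * (g k * p k - p k ^ 2) + ∑ k : Torus d N × ι,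
        crossing i a k.1 * (g k * q k - q k ^ 2) +
        ∑ k : Torus d N × ι, crossing i a k.1 * (p k ^ 2 + q k ^ 2) := by
      rw [← Finset.sum_add_distrib, ← Finset.sum_add_distrib]
      exact Finset.sum_congr rfl fun k _ => by ring
    rw [this]
    simp only [K, p, q, Function.comp_apply]
    ring
  simp_rw [h1]
  rw [lintegral_const_mul' _ _ ENNReal.ofReal_ne_top, lintegral_exp_sum_gaussian,
    ← ENNReal.ofReal_mul (Real.exp_nonneg _), ← Real.exp_add]
  congr 2
  rw [edgeSum_eq i a sqDist_comm]
  have h2 : ∑ x, crossing i a x * sqDist (u (toHalf i a x)) (u (reflect i a (toHalf i a x))) =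
      ∑ k : Torus d N × ι, crossing i a k.1 * (p k - q k) ^ 2 := by
    simp only [sqDist, Finset.mul_sum]
    rw [Fintype.sum_prod_type]
  have h3 : ∑ k, c k ^ 2 / 2 = ∑ k : Torus d N × ι, crossing i a k.1 * (p k ^ 2 + q k ^ 2) -
      (1 / 2) * ∑ k : Torus d N × ι, crossing i a k.1 * (p k - q k) ^ 2 := by
    rw [Finset.mul_sum, ← Finset.sum_sub_distrib]
    refine Finset.sum_congr rfl fun k _ => ?_
    simp only [c, mul_pow, crossing_sq]
    ring
  rw [h2, h3]
  simp only [K]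
  ring

variable {Ω : Type*} [MeasurableSpace Ω]

/-- The partition function with a field that shifts the spins. -/
def shiftedZ (ρ : Measure Ω) (S : Ω → ι → ℝ) (h : Torus d N → ℝ) : ENNReal :=
  ∫⁻ ω, ENNReal.ofReal (Real.exp (-(1 / 2) * edgeSum sqDist fun x m => S (ω x) m - h x))
    ∂(Measure.pi fun _ : Torus d N => ρ)

theorem measurable_halfWeight {S : Ω → ι → ℝ} (hS : Measurable S) (h : Torus d N → ℝ) :
    Measurable fun p : (Torus d N → Ω) × (Torus d N × ι → ℝ) =>
      halfWeight i a p.2 fun x m => S (p.1 x) m - h x := by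
  have hu : ∀ x m, Measurable fun p : (Torus d N → Ω) × (Torus d N × ι → ℝ) =>
      S (p.1 x) m - h x := fun x m =>
    ((measurable_pi_apply m).comp (hS.comp ((measurable_pi_apply x).comp
      measurable_fst))).sub_const _
  have hg : ∀ k, Measurable fun p : (Torus d N → Ω) × (Torus d N × ι → ℝ) => p.2 k := fun k =>
    (measurable_pi_apply k).comp measurable_snd
  refine Measurable.exp (Measurable.add (measurable_const.mul ?_) ?_)
  · refine Finset.measurable_sum _ fun x _ => Finset.measurable_sum _ fun j _ => ?_
    split_ifs
    · exact Finset.measurable_sum _ fun m _ => ((hu _ m).sub (hu _ m)).pow_const 2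
    · exact measurable_const
  · exact Finset.measurable_sum _ fun k _ =>
      measurable_const.mul (((hg k).mul (hu _ _)).sub ((hu _ _).pow_const 2))

/-- Functions of the spins in the two halves are independent. -/
theorem lintegral_mul_comp_reflect (ρ : Measure Ω) [IsProbabilityMeasure ρ]
    {F G : (Torus d N → Ω) → ENNReal} (hF : Measurable F) (hG : Measurable G)
    (hF' : ∀ ω ω', (∀ x, InHalf i a x → ω x = ω' x) → F ω = F ω')
    (hG' : ∀ ω ω', (∀ x, InHalf i a x → ω x = ω' x) → G ω = G ω') :
    ∫⁻ ω, F ω * G (ω ∘ reflect i a) ∂(Measure.pi fun _ : Torus d N => ρ) =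
      (∫⁻ ω, F ω ∂(Measure.pi fun _ : Torus d N => ρ)) *
        ∫⁻ ω, G ω ∂(Measure.pi fun _ : Torus d N => ρ) := by
  classical
  obtain ⟨o⟩ : Nonempty Ω := ρ.nonempty_of_neZero
  have hθ : MeasurePreserving (fun ω : Torus d N → Ω => ω ∘ reflect i a)
      (Measure.pi fun _ : Torus d N => ρ) (Measure.pi fun _ : Torus d N => ρ) := by
    convert! measurePreserving_piCongrLeft (fun _ : Torus d N => ρ) (reflectEquiv i a) using 1
    funext ω x
    have := Equiv.piCongrLeft_apply_apply (fun _ : Torus d N => Ω) (reflectEquiv i a) ω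
      (reflect i a x)
    simp only [reflectEquiv, Equiv.coe_fn_mk, reflect_reflect] at this
    exact this.symm
  set T : Finset (Torus d N) := Finset.univ.filter fun x => InHalf i a x
  set T' : Finset (Torus d N) := Finset.univ.filter fun x => ¬ InHalf i a x
  have hind := (iIndepFun_pi (μ := fun _ : Torus d N => ρ) (X := fun _ => id)
    fun _ => aemeasurable_id).indepFun_finset T T' (Finset.disjoint_filter_filter_not _ _ _)
    fun x => measurable_pi_apply x
  set ext : ∀ R : Finset (Torus d N), (R → Ω) → Torus d N → Ω :=
    fun R w x => if hx : x ∈ R then w ⟨x, hx⟩ else o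
  have hext : ∀ R, Measurable (ext R) := fun R => measurable_pi_iff.2 fun x => by
    by_cases hx : x ∈ R
    · simpa only [ext, hx, dif_pos] using measurable_pi_apply (⟨x, hx⟩ : R)
    · simpa only [ext, hx, dif_neg, not_false_eq_true] using measurable_const
  have hind2 := hind.comp (hF.comp (hext T)) (hG.comp (hθ.measurable.comp (hext T')))
  have e1 : ((F ∘ ext T) ∘ fun (ω : Torus d N → Ω) (x : T) => id (ω x)) = F := by
    funext ω
    refine hF' _ _ fun x hx => ?_
    simp [ext, T, hx]
  have e2 : ((G ∘ (fun ω : Torus d N → Ω => ω ∘ reflect i a) ∘ ext T') ∘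
      fun (ω : Torus d N → Ω) (x : T') => id (ω x)) = fun ω => G (ω ∘ reflect i a) := by
    funext ω
    refine hG' _ _ fun x hx => ?_
    have : ¬ InHalf i a (reflect i a x) := by rw [inHalf_reflect]; exact not_not.2 hx
    simp [ext, T', this]
  rw [e1, e2] at hind2
  refine (lintegral_mul_eq_lintegral_mul_lintegral_of_indepFun'' hF.aemeasurable
    (hG.comp hθ.measurable).aemeasurable hind2).trans ?_
  congr 1
  exact hθ.lintegral_comp hG

theorem shiftedZ_eq_lintegral (ρ : Measure Ω) [IsProbabilityMeasure ρ] {S : Ω → ι → ℝ}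
    (hS : Measurable S) (h : Torus d N → ℝ) :
    shiftedZ ρ S h = ∫⁻ g,
      (∫⁻ ω, ENNReal.ofReal (halfWeight i a g fun x m => S (ω x) m - h x)
        ∂(Measure.pi fun _ : Torus d N => ρ)) *
      (∫⁻ ω, ENNReal.ofReal (halfWeight i a g fun x m => S (ω x) m - h (reflect i a x))
        ∂(Measure.pi fun _ : Torus d N => ρ))
        ∂(Measure.pi fun _ : Torus d N × ι => gaussianReal 0 1) := by
  have hθ : Measurable fun ω : Torus d N → Ω => ω ∘ reflect i a :=
    measurable_pi_iff.2 fun x => measurable_pi_apply _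
  unfold shiftedZ
  simp_rw [ofReal_exp_edgeSum_eq_lintegral i a]
  rw [lintegral_lintegral_swap]
  · refine lintegral_congr fun g => ?_
    have hm : ∀ h' : Torus d N → ℝ, Measurable fun ω : Torus d N → Ω =>
        ENNReal.ofReal (halfWeight i a g fun x m => S (ω x) m - h' x) := fun h' =>
      ((measurable_halfWeight i a hS h').comp
        (measurable_id.prodMk measurable_const)).ennreal_ofReal
    have hc : ∀ (h' : Torus d N → ℝ) (ω ω' : Torus d N → Ω),
        (∀ x, InHalf i a x → ω x = ω' x) →
          ENNReal.ofReal (halfWeight i a g fun x m => S (ω x) m - h' x) =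
          ENNReal.ofReal (halfWeight i a g fun x m => S (ω' x) m - h' x) := fun h' ω ω' hω => by
      exact congrArg ENNReal.ofReal (halfWeight_congr i a g fun x hx => by simp only [hω x hx])
    exact lintegral_mul_comp_reflect i a ρ (hm h) (hm fun x => h (reflect i a x)) (hc _) (hc _)
  · refine Measurable.aemeasurable ?_
    refine (measurable_halfWeight i a hS h).ennreal_ofReal.mul ?_
    exact ((measurable_halfWeight i a hS fun x => h (reflect i a x)).comp
      ((hθ.comp measurable_fst).prodMk measurable_snd)).ennreal_ofReal

/-- The Cauchy–Schwarz inequality from reflection positivity. -/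
theorem shiftedZ_sq_le (ρ : Measure Ω) [IsProbabilityMeasure ρ] {S : Ω → ι → ℝ}
    (hS : Measurable S) (h : Torus d N → ℝ) :
    shiftedZ ρ S h ^ 2 ≤ shiftedZ ρ S (h ∘ toHalf i a) *
      shiftedZ ρ S (h ∘ reflect i a ∘ toHalf i a) := by
  set I : (Torus d N → ℝ) → (Torus d N × ι → ℝ) → ENNReal := fun h g =>
    ∫⁻ ω, ENNReal.ofReal (halfWeight i a g fun x m => S (ω x) m - h x)
      ∂(Measure.pi fun _ : Torus d N => ρ)
  have hI : ∀ h, Measurable (I h) := fun h =>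
    (measurable_halfWeight i a hS h).ennreal_ofReal.lintegral_prod_left'
  have hIc : ∀ h h' : Torus d N → ℝ, (∀ x, InHalf i a x → h x = h' x) → I h = I h' :=
    fun h h' hh => by
      funext g
      refine lintegral_congr fun ω => ?_
      exact congrArg ENNReal.ofReal (halfWeight_congr i a g fun x hx => by simp only [hh x hx])
  have hsym : ∀ h : Torus d N → ℝ, shiftedZ ρ S (h ∘ toHalf i a) =
      ∫⁻ g, I h g ^ (2 : ℝ) ∂(Measure.pi fun _ : Torus d N × ι => gaussianReal 0 1) := fun h => by
    rw [shiftedZ_eq_lintegral i a ρ hS]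
    refine lintegral_congr fun g => ?_
    change I (h ∘ toHalf i a) g * I (fun x => (h ∘ toHalf i a) (reflect i a x)) g = _
    rw [hIc (h ∘ toHalf i a) h fun x hx => by simp [toHalf_of_inHalf i a hx],
      hIc (fun x => (h ∘ toHalf i a) (reflect i a x)) h fun x hx => by
        simp [toHalf_reflect, toHalf_of_inHalf i a hx], ENNReal.rpow_two, sq]
  have hCS := ENNReal.lintegral_mul_le_Lp_mul_Lq
    (Measure.pi fun _ : Torus d N × ι => gaussianReal 0 1) Real.HolderConjugate.two_two
    (hI h).aemeasurable (hI fun x => h (reflect i a x)).aemeasurable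
  rw [← hsym h, ← hsym fun x => h (reflect i a x)] at hCS
  have e : shiftedZ ρ S h = ∫⁻ g, (I h * I fun x => h (reflect i a x)) g
      ∂(Measure.pi fun _ : Torus d N × ι => gaussianReal 0 1) := shiftedZ_eq_lintegral i a ρ hS h
  rw [← e] at hCS
  calc shiftedZ ρ S h ^ 2 ≤ _ ^ 2 := pow_le_pow_left' hCS 2
    _ = _ := by
      rw [mul_pow, ← ENNReal.rpow_two, ← ENNReal.rpow_two, ← ENNReal.rpow_mul,
        ← ENNReal.rpow_mul]
      norm_num
      rfl

end ReflectionPositivity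

theorem shiftedZ_le_one {ι Ω : Type*} [Fintype ι] [MeasurableSpace Ω] (ρ : Measure Ω)
    [IsProbabilityMeasure ρ] (S : Ω → ι → ℝ) (h : Torus d N → ℝ) : shiftedZ ρ S h ≤ 1 := by
  refine (lintegral_mono (g := fun _ => 1) fun ω => ?_).trans (by simp)
  rw [ENNReal.ofReal_le_one, Real.exp_le_one_iff]
  have : 0 ≤ edgeSum sqDist fun x m => S (ω x) m - h x :=
    Finset.sum_nonneg fun _ _ => Finset.sum_nonneg fun _ _ => sqDist_nonneg _ _
  linarith

/-- Gaussian domination. -/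
theorem shiftedZ_le_shiftedZ_zero {ι Ω : Type*} [Fintype ι] [MeasurableSpace Ω] (ρ : Measure Ω)
    [IsProbabilityMeasure ρ] {S : Ω → ι → ℝ} (hS : Measurable S) (h : Torus d N → ℝ) :
    shiftedZ ρ S h ≤ shiftedZ ρ S (0 : Torus d N → ℝ) := by
  classical
  let Z : (Torus d N → Torus d N) → ENNReal := fun φ => shiftedZ ρ S (h ∘ φ)
  let ψ : ℝ → ℝ → ℝ := fun p q => if p = q then 0 else 1
  have hψ : ∀ p q, ψ p q = ψ q p := fun p q => by simp only [ψ, eq_comm]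
  have hψ0 : ∀ p, ψ p p = 0 := fun p => by simp [ψ]
  have hψn : ∀ p q, 0 ≤ ψ p q := fun p q => by simp only [ψ]; split_ifs <;> simp
  obtain ⟨φ₀, -, hφ₀⟩ := Finset.exists_max_image Finset.univ Z Finset.univ_nonempty
  obtain ⟨φ, hφ, hmin⟩ := Finset.exists_min_image (Finset.univ.filter fun φ => Z φ = Z φ₀)
    (fun φ => edgeSum ψ (h ∘ φ)) ⟨φ₀, by simp⟩
  have hφZ : Z φ = Z φ₀ := (Finset.mem_filter.1 hφ).2
  have hmax : ∀ φ', Z φ' ≤ Z φ := fun φ' => hφZ ▸ hφ₀ φ' (Finset.mem_univ _)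
  have hid : shiftedZ ρ S h ≤ Z φ := hmax id
  rcases eq_or_ne (Z φ) 0 with h0 | h0
  · exact (hid.trans h0.le).trans bot_le
  have htop : Z φ ≠ ⊤ := ((shiftedZ_le_one ρ S _).trans_lt ENNReal.one_lt_top).ne
  have hgrad : ∀ (x : Torus d N) (i : Fin d), h (φ (x + Pi.single i 1)) = h (φ x) := by
    intro x i
    by_contra hne
    set a : ZMod (2 * N) := x i + 1 with ha
    have hsq := shiftedZ_sq_le i a ρ hS (h ∘ φ)
    have hboth : ∀ φ₁ φ₂, Z φ ^ 2 ≤ Z φ₁ * Z φ₂ → Z φ₁ = Z φ := fun φ₁ φ₂ hle => by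
      refine le_antisymm (hmax _) ?_
      have := hle.trans (mul_le_mul_right (hmax φ₂) _)
      rw [sq] at this
      exact (ENNReal.mul_le_mul_iff_left h0 htop).1 this
    have h1 : Z (φ ∘ toHalf i a) = Z φ := hboth _ (φ ∘ reflect i a ∘ toHalf i a) hsq
    have h2 : Z (φ ∘ reflect i a ∘ toHalf i a) = Z φ :=
      hboth _ (φ ∘ toHalf i a) (hsq.trans_eq (mul_comm _ _))
    have m1 := hmin _ (Finset.mem_filter.2 ⟨Finset.mem_univ _, h1.trans hφZ⟩)
    have m2 := hmin _ (Finset.mem_filter.2 ⟨Finset.mem_univ _, h2.trans hφZ⟩)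
    have b1 : edgeSum ψ (h ∘ φ ∘ toHalf i a) = 2 * innerSum i a ψ (h ∘ φ) :=
      edgeSum_comp_toHalf i a hψ hψ0 (h ∘ φ)
    have b2 : edgeSum ψ (h ∘ φ ∘ reflect i a ∘ toHalf i a) =
        2 * innerSum i a ψ ((h ∘ φ) ∘ reflect i a) :=
      edgeSum_comp_toHalf i a hψ hψ0 ((h ∘ φ) ∘ reflect i a)
    have hN := NeZero.pos N
    have hx : ¬ InHalf i a x := by
      have e : x i - a = -1 - 0 := by rw [ha]; ring
      rw [InHalf, e, val_neg_one_sub, ZMod.val_zero]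
      omega
    have hx' : InHalf i a (x + Pi.single i 1) := by
      have e : (x + Pi.single i 1 : Torus d N) i - a = 0 := by simp [ha]
      rw [InHalf, e, ZMod.val_zero]
      exact hN
    have hcr : ¬ (InHalf i a x ↔ InHalf i a (x + Pi.single i 1)) := by tauto
    have hpos : 0 < ∑ x, crossing i a x * ψ ((h ∘ φ) (toHalf i a x))
        ((h ∘ φ) (reflect i a (toHalf i a x))) := by
      refine Finset.sum_pos' (fun y _ => mul_nonneg (crossing_nonneg i a y) (hψn _ _))
        ⟨x, Finset.mem_univ x, ?_⟩
      have t1 : toHalf i a x = x + Pi.single i 1 := by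
        rw [add_single_eq_reflect i a hcr, toHalf, if_neg hx]
      have t2 : reflect i a (x + Pi.single i 1) = x := by
        rw [add_single_eq_reflect i a hcr, reflect_reflect]
      rw [t1, t2, crossing, if_neg hcr]
      simp [ψ, hne]
    have hdec := edgeSum_eq i a hψ (h ∘ φ)
    linarith
  refine hid.trans_eq (lintegral_congr fun ω => ?_)
  congr 3
  refine Finset.sum_congr rfl fun x _ => Finset.sum_congr rfl fun j _ => ?_
  simp only [sqDist, Function.comp_apply, hgrad x j, Pi.zero_apply]
  exact Finset.sum_congr rfl fun m _ => by ring

/-! ### Symmetries of the two-point function -/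

theorem flipAt_comm (x : Torus d N) (s s' : Torus d N → Fin 2) : flipAt x s s' = flipAt x s' s := by
  simp only [flipAt, eq_comm]

theorem transpose_diagOf (f : (Torus d N → ℝ) → ℝ) : (diagOf f : RealOp d N).transpose = diagOf f :=
  Matrix.diagonal_transpose _

theorem transpose_generator (δ lam : ℝ) :
    (generator d N δ lam).transpose = generator d N δ lam := by
  have h : ∀ x : Torus d N, (flipAt x : RealOp d N).transpose = flipAt x := fun x => by
    ext s s'
    exact flipAt_comm x s' s
  simp [generator, transpose_diagOf, Matrix.transpose_sum, h]

theorem transpose_semigroup (δ lam t : ℝ) :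
    (semigroup d N δ lam t).transpose = semigroup d N δ lam t := by
  rw [semigroup, ← Matrix.exp_transpose, Matrix.transpose_smul, transpose_generator]

theorem transpose_spinOp (x : Torus d N) : (spinOp x : RealOp d N).transpose = spinOp x :=
  transpose_diagOf _

theorem traceTwoPoint_sub (β δ lam : ℝ) (x y : Torus d N) (t : ℝ) :
    traceTwoPoint β δ lam x y (β - t) = traceTwoPoint β δ lam x y t := by
  unfold traceTwoPoint
  rw [← Matrix.trace_transpose]
  simp only [Matrix.transpose_mul, transpose_semigroup, transpose_spinOp, sub_sub_cancel]
  rw [← mul_assoc, ← mul_assoc, Matrix.trace_mul_comm]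
  simp only [mul_assoc]

theorem traceTwoPoint_comm (β δ lam : ℝ) (x y : Torus d N) (t : ℝ) :
    traceTwoPoint β δ lam x y t = traceTwoPoint β δ lam y x t := by
  rw [← traceTwoPoint_sub β δ lam y x]
  unfold traceTwoPoint
  rw [sub_sub_cancel, mul_assoc, Matrix.trace_mul_comm]
  simp only [mul_assoc]

/-- The translation of basis labels. -/
def shiftState (z : Torus d N) : (Torus d N → Fin 2) ≃ (Torus d N → Fin 2) :=
  Equiv.arrowCongr (Equiv.subRight z) (Equiv.refl _)

theorem shiftState_apply (z : Torus d N) (s : Torus d N → Fin 2) (x : Torus d N) :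
    shiftState z s x = s (x + z) := rfl

theorem bondSum_shift {R : Type*} [Semiring R] (z : Torus d N) (v : Torus d N → R) :
    bondSum (fun x => v (x + z)) = bondSum v := by
  unfold bondSum
  refine Eq.trans ?_ (Equiv.sum_comp (Equiv.addRight z) _)
  refine Finset.sum_congr rfl fun x _ => Finset.sum_congr rfl fun j _ => ?_
  simp only [Equiv.coe_addRight]
  rw [add_right_comm]

theorem submatrix_shift_diagOf (z : Torus d N) (f : (Torus d N → ℝ) → ℝ) :
    (diagOf f : RealOp d N).submatrix (shiftState z) (shiftState z) =
      diagOf fun v => f fun x => v (x + z) := by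
  unfold diagOf
  rw [Matrix.submatrix_diagonal_equiv]
  rfl

theorem submatrix_shift_flipAt (z x : Torus d N) :
    (flipAt x : RealOp d N).submatrix (shiftState z) (shiftState z) = flipAt (x + z) := by
  ext s s'
  simp only [Matrix.submatrix_apply, flipAt, shiftState_apply]
  have : (∀ y, y ≠ x → s (y + z) = s' (y + z)) ↔ ∀ y, y ≠ x + z → s y = s' y :=
    ⟨fun h y hy => by
      simpa using h (y - z) fun h' => hy (by rw [← h', sub_add_cancel]),
    fun h y hy => h _ fun h' => hy (add_right_cancel h')⟩
  exact if_congr this rfl rfl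

theorem submatrix_shift_generator (z : Torus d N) (δ lam : ℝ) :
    (generator d N δ lam).submatrix (shiftState z) (shiftState z) = generator d N δ lam := by
  have h1 : (∑ x : Torus d N, (flipAt x : RealOp d N)).submatrix (shiftState z) (shiftState z) =
      ∑ x : Torus d N, flipAt x := by
    ext s s'
    rw [Matrix.submatrix_apply, Matrix.sum_apply, Matrix.sum_apply]
    exact (Finset.sum_congr rfl fun x _ => congrFun₂ (submatrix_shift_flipAt z x) s s').trans
      (Equiv.sum_comp (Equiv.addRight z) fun x => flipAt x s s')
  have h2 : (diagOf bondSum : RealOp d N).submatrix (shiftState z) (shiftState z) =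
      diagOf bondSum := by
    rw [submatrix_shift_diagOf]
    simp only [bondSum_shift]
  rw [generator, Matrix.submatrix_add, Matrix.submatrix_smul, Matrix.submatrix_smul]
  simp only [Pi.add_apply, Pi.smul_apply, h1, h2]

open scoped Matrix.Norms.Operator in
theorem submatrix_shift_semigroup (z : Torus d N) (δ lam t : ℝ) :
    (semigroup d N δ lam t).submatrix (shiftState z) (shiftState z) = semigroup d N δ lam t := by
  have h := NormedSpace.map_exp (Matrix.reindexAlgEquiv ℝ ℝ (shiftState z).symm)
    (by
      exact Continuous.matrix_submatrix continuous_id _ _) (t • generator d N δ lam)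
  rw [map_smul] at h
  simp only [Matrix.coe_reindexAlgEquiv, Matrix.reindex_apply, Equiv.symm_symm,
    submatrix_shift_generator] at h
  exact h

theorem traceTwoPoint_add (β δ lam : ℝ) (x y z : Torus d N) (t : ℝ) :
    traceTwoPoint β δ lam (x + z) (y + z) t = traceTwoPoint β δ lam x y t := by
  have hs : ∀ x : Torus d N, (spinOp (x + z) : RealOp d N) =
      (spinOp x : RealOp d N).submatrix (shiftState z) (shiftState z) := fun x => by
    rw [spinOp, spinOp, submatrix_shift_diagOf]
  unfold traceTwoPoint
  rw [hs, hs, ← submatrix_shift_semigroup z δ lam t, ← submatrix_shift_semigroup z δ lam (β - t),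
    Matrix.submatrix_mul_equiv, Matrix.submatrix_mul_equiv, Matrix.submatrix_mul_equiv,
    submatrix_shift_semigroup, submatrix_shift_semigroup]
  simp only [Matrix.trace, Matrix.diag, Matrix.submatrix_apply]
  exact Equiv.sum_comp (shiftState z) fun s => (spinOp x * semigroup d N δ lam t * spinOp y *
    semigroup d N δ lam (β - t)) s s

/-! ### Positivity and convexity -/

theorem trace_mul_transpose_nonneg (B : RealOp d N) : 0 ≤ (B * B.transpose).trace := by
  simp only [Matrix.trace, Matrix.diag, Matrix.mul_apply, Matrix.transpose_apply]
  exact Finset.sum_nonneg fun s _ => Finset.sum_nonneg fun s' _ => mul_self_nonneg _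

theorem trace_transpose_mul_semigroup_nonneg (δ lam s t : ℝ) (B : RealOp d N) :
    0 ≤ (B.transpose * semigroup d N δ lam s * B * semigroup d N δ lam t).trace := by
  have h := trace_mul_transpose_nonneg
    (semigroup d N δ lam (t / 2) * B.transpose * semigroup d N δ lam (s / 2))
  simp only [Matrix.transpose_mul, transpose_semigroup, Matrix.transpose_transpose] at h
  have e1 : semigroup d N δ lam s = semigroup d N δ lam (s / 2) * semigroup d N δ lam (s / 2) := by
    rw [semigroup_mul, add_halves]
  have e2 : semigroup d N δ lam t = semigroup d N δ lam (t / 2) * semigroup d N δ lam (t / 2) := by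
    rw [semigroup_mul, add_halves]
  rw [e1, e2, ← mul_assoc, Matrix.trace_mul_comm]
  simp only [mul_assoc] at h ⊢
  exact h

section Derivative
open scoped Matrix.Norms.Operator

theorem hasDerivAt_trace {f : ℝ → RealOp d N} {f' : RealOp d N} {t : ℝ}
    (h : HasDerivAt f f' t) : HasDerivAt (fun u => (f u).trace) f'.trace t :=
  ((Matrix.traceLinearMap (Torus d N → Fin 2) ℝ ℝ).toContinuousLinearMap.hasFDerivAt.comp_hasDerivAt
    t h)

theorem hasDerivAt_semigroup (δ lam t : ℝ) :
    HasDerivAt (fun u => semigroup d N δ lam u)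
      (semigroup d N δ lam t * generator d N δ lam) t :=
  hasDerivAt_exp_smul_const _ t

theorem generator_mul_semigroup (δ lam t : ℝ) :
    generator d N δ lam * semigroup d N δ lam t = semigroup d N δ lam t * generator d N δ lam :=
  ((hasDerivAt_exp_smul_const' (generator d N δ lam) t).unique (hasDerivAt_semigroup δ lam t) :)

/-- The derivative of a two-point function is a commutator. -/
theorem hasDerivAt_trace_semigroup (β δ lam : ℝ) (B C : RealOp d N) (t : ℝ) :
    HasDerivAt (fun u => (B * semigroup d N δ lam u * C * semigroup d N δ lam (β - u)).trace)
      (B * semigroup d N δ lam t * (generator d N δ lam * C - C * generator d N δ lam) *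
        semigroup d N δ lam (β - t)).trace t := by
  have h1 := ((hasDerivAt_semigroup (d := d) (N := N) δ lam t).const_mul B).mul_const C
  have h2 : HasDerivAt (fun u => semigroup d N δ lam (β - u))
      (-(semigroup d N δ lam (β - t) * generator d N δ lam)) t :=
    (hasDerivAt_semigroup (d := d) (N := N) δ lam (β - t)).comp_const_sub β t
  convert! hasDerivAt_trace (h1.mul h2) using 1
  rw [← generator_mul_semigroup δ lam (β - t)]
  congr 1
  noncomm_ring

end Derivative

/-! ### The two-point function of a linear combination of spins -/

/-- The operator `∑ₓ hₓ σₓ⁽³⁾`. -/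
def modeOp (h : Torus d N → ℝ) : RealOp d N := diagOf fun v => ∑ x, h x * v x

/-- The unnormalized two-point function of `∑ₓ hₓ σₓ⁽³⁾`. -/
def modeTrace (β δ lam : ℝ) (h : Torus d N → ℝ) (t : ℝ) : ℝ :=
  (modeOp h * semigroup d N δ lam t * modeOp h * semigroup d N δ lam (β - t)).trace

/-- The commutator of the generator with `∑ₓ hₓ σₓ⁽³⁾`. -/
def modeComm (δ lam : ℝ) (h : Torus d N → ℝ) : RealOp d N :=
  generator d N δ lam * modeOp h - modeOp h * generator d N δ lam

theorem modeOp_eq_sum (h : Torus d N → ℝ) : modeOp h = ∑ x, h x • spinOp x := by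
  ext s s'
  rw [Matrix.sum_apply]
  by_cases hs : s = s'
  · subst hs
    simp [modeOp, spinOp, diagOf]
  · simp [modeOp, spinOp, diagOf, hs]

theorem modeTrace_eq_sum (β δ lam : ℝ) (h : Torus d N → ℝ) (t : ℝ) :
    modeTrace β δ lam h t = ∑ x, ∑ y, h x * h y * traceTwoPoint β δ lam x y t := by
  simp only [modeTrace, modeOp_eq_sum, Finset.sum_mul, Finset.mul_sum, Matrix.trace_sum,
    Matrix.smul_mul, Matrix.mul_smul, Matrix.trace_smul, smul_eq_mul, traceTwoPoint]
  rw [Finset.sum_comm]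
  exact Finset.sum_congr rfl fun x _ => Finset.sum_congr rfl fun y _ => by ring

theorem transpose_modeOp (h : Torus d N → ℝ) : (modeOp h).transpose = modeOp h :=
  transpose_diagOf _

theorem modeTrace_nonneg (β δ lam : ℝ) (h : Torus d N → ℝ) (t : ℝ) :
    0 ≤ modeTrace β δ lam h t := by
  have := trace_transpose_mul_semigroup_nonneg δ lam t (β - t) (modeOp h)
  rwa [transpose_modeOp] at this

theorem modeTrace_sub (β δ lam : ℝ) (h : Torus d N → ℝ) (t : ℝ) :
    modeTrace β δ lam h (β - t) = modeTrace β δ lam h t := by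
  simp only [modeTrace_eq_sum, traceTwoPoint_sub]

/-- The time derivative of `modeTrace`. -/
def modeTraceDeriv (β δ lam : ℝ) (h : Torus d N → ℝ) (t : ℝ) : ℝ :=
  (modeOp h * semigroup d N δ lam t * modeComm δ lam h * semigroup d N δ lam (β - t)).trace

/-- The second time derivative of `modeTrace`. -/
def modeTraceDeriv₂ (β δ lam : ℝ) (h : Torus d N → ℝ) (t : ℝ) : ℝ :=
  (modeOp h * semigroup d N δ lam t * (generator d N δ lam * modeComm δ lam h -
    modeComm δ lam h * generator d N δ lam) * semigroup d N δ lam (β - t)).trace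

theorem hasDerivAt_modeTrace (β δ lam : ℝ) (h : Torus d N → ℝ) (t : ℝ) :
    HasDerivAt (modeTrace β δ lam h) (modeTraceDeriv β δ lam h t) t :=
  hasDerivAt_trace_semigroup β δ lam _ _ t

theorem hasDerivAt_modeTraceDeriv (β δ lam : ℝ) (h : Torus d N → ℝ) (t : ℝ) :
    HasDerivAt (modeTraceDeriv β δ lam h) (modeTraceDeriv₂ β δ lam h t) t :=
  hasDerivAt_trace_semigroup β δ lam _ _ t

theorem continuous_modeTrace (β δ lam : ℝ) (h : Torus d N → ℝ) :
    Continuous (modeTrace β δ lam h) :=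
  continuous_iff_continuousAt.2 fun t => (hasDerivAt_modeTrace β δ lam h t).continuousAt

theorem continuous_modeTraceDeriv₂ (β δ lam : ℝ) (h : Torus d N → ℝ) :
    Continuous (modeTraceDeriv₂ β δ lam h) :=
  continuous_iff_continuousAt.2 fun t => (hasDerivAt_trace_semigroup β δ lam _ _ t).continuousAt

theorem modeTraceDeriv₂_nonneg (β δ lam : ℝ) (h : Torus d N → ℝ) (t : ℝ) :
    0 ≤ modeTraceDeriv₂ β δ lam h t := by
  have h0 := trace_transpose_mul_semigroup_nonneg δ lam t (β - t) (modeComm δ lam h)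
  have hC : (modeComm δ lam h).transpose =
      modeOp h * generator d N δ lam - generator d N δ lam * modeOp h := by
    simp [modeComm, Matrix.transpose_mul, transpose_modeOp, transpose_generator]
  set C := modeComm δ lam h
  set A := generator d N δ lam with hA
  set M := modeOp h
  set S := semigroup d N δ lam t with hS
  set S' := semigroup d N δ lam (β - t) with hS'
  have c1 : A * S = S * A := generator_mul_semigroup δ lam t
  have c2 : A * S' = S' * A := generator_mul_semigroup δ lam (β - t)
  have e : modeTraceDeriv₂ β δ lam h t = (C.transpose * S * C * S').trace := by
    change (M * S * (A * C - C * A) * S').trace = _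
    have e1 : M * S * (A * C - C * A) * S' = M * A * S * C * S' - M * S * C * S' * A := by
      calc M * S * (A * C - C * A) * S' = M * (S * A) * C * S' - M * S * C * (A * S') := by
            noncomm_ring
        _ = M * (A * S) * C * S' - M * S * C * (S' * A) := by rw [c1, c2]
        _ = _ := by noncomm_ring
    rw [e1, Matrix.trace_sub, Matrix.trace_mul_comm _ A, ← Matrix.trace_sub, hC]
    congr 1
    noncomm_ring
  rwa [e]

theorem modeTraceDeriv_end (β δ lam : ℝ) (h : Torus d N → ℝ) :
    modeTraceDeriv β δ lam h β = -modeTraceDeriv β δ lam h 0 := by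
  have h1 : HasDerivAt (fun t => modeTrace β δ lam h (β - t)) (-modeTraceDeriv β δ lam h (β - 0)) 0 :=
    (hasDerivAt_modeTrace β δ lam h (β - 0)).comp_const_sub β 0
  simp only [modeTrace_sub, sub_zero] at h1
  have := h1.unique (hasDerivAt_modeTrace β δ lam h 0)
  linarith

theorem sum_flipAt (x : Torus d N) (s : Torus d N → Fin 2) : ∑ s', flipAt x s s' = 1 := by
  classical
  rw [Finset.sum_eq_single (Function.update s x (s x + 1))]
  · have h1 : ∀ y, y ≠ x → s y = Function.update s x (s x + 1) y := fun y hy => by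
      rw [Function.update_of_ne hy]
    have h2 : s x ≠ Function.update s x (s x + 1) x := by
      rw [Function.update_self]
      generalize s x = a
      fin_cases a <;> decide
    rw [flipAt, if_pos h1, if_neg h2]
  · intro s' _ hs'
    unfold flipAt
    split_ifs with h1 h2
    · rfl
    · refine absurd (funext fun y => ?_) hs'
      by_cases hy : y = x
      · subst hy
        rw [Function.update_self]
        revert h2
        generalize s y = a
        generalize s' y = b
        fin_cases a <;> fin_cases b <;> simp
      · rw [Function.update_of_ne hy, h1 y hy]
    · rfl
  · simp

theorem flipAt_nonneg (x : Torus d N) (s s' : Torus d N → Fin 2) : 0 ≤ flipAt x s s' := by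
  unfold flipAt; split_ifs <;> simp

theorem trace_flipAt_mul_semigroup_le (δ lam t : ℝ) (x : Torus d N) :
    (flipAt x * semigroup d N δ lam t).trace ≤ (semigroup d N δ lam t).trace := by
  have hS : semigroup d N δ lam t =
      semigroup d N δ lam (t / 2) * (semigroup d N δ lam (t / 2)).transpose := by
    rw [transpose_semigroup, semigroup_mul, add_halves]
  set B := semigroup d N δ lam (t / 2)
  set S := semigroup d N δ lam t
  have h : ∀ s s', S s' s ≤ (S s s + S s' s') / 2 := fun s s' => by
    simp only [hS, Matrix.mul_apply, Matrix.transpose_apply, ← Finset.sum_add_distrib,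
      Finset.sum_div]
    exact Finset.sum_le_sum fun r _ => by nlinarith [sq_nonneg (B s r - B s' r)]
  calc (flipAt x * S).trace = ∑ s, ∑ s', flipAt x s s' * S s' s := by
        simp [Matrix.trace, Matrix.mul_apply]
    _ ≤ ∑ s, ∑ s', flipAt x s s' * ((S s s + S s' s') / 2) :=
        Finset.sum_le_sum fun s _ => Finset.sum_le_sum fun s' _ =>
          mul_le_mul_of_nonneg_left (h s s') (flipAt_nonneg x s s')
    _ = (∑ s, (∑ s', flipAt x s s') * (S s s / 2)) +
          ∑ s', (∑ s, flipAt x s' s) * (S s' s' / 2) := by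
        have e : ∑ s, ∑ s', flipAt x s s' * (S s' s' / 2) =
            ∑ s', (∑ s, flipAt x s' s) * (S s' s' / 2) := by
          rw [Finset.sum_comm]
          simp only [Finset.sum_mul]
          exact Finset.sum_congr rfl fun s' _ => Finset.sum_congr rfl fun s _ => by
            rw [flipAt_comm x s' s]
        simp only [add_div, mul_add, Finset.sum_add_distrib]
        rw [e]
        simp only [Finset.sum_mul]
    _ = S.trace := by
        simp only [sum_flipAt, one_mul, ← Finset.sum_add_distrib, add_halves]
        rfl

/-- The double commutator of the generator with `∑ₓ hₓ σₓ⁽³⁾`. -/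
theorem double_comm_modeOp (δ lam : ℝ) (h : Torus d N → ℝ) :
    (2 : ℝ) • (modeOp h * generator d N δ lam * modeOp h) - modeOp h * modeOp h * generator d N δ lam -
      generator d N δ lam * modeOp h * modeOp h = -((4 * δ) • ∑ x, h x ^ 2 • flipAt x) := by
  ext s s'
  set m : (Torus d N → Fin 2) → ℝ := fun s => ∑ x, h x * sgn (s x) with hm
  have hM : modeOp h = Matrix.diagonal m := rfl
  have hflip : ∀ x, (m s - m s') ^ 2 * flipAt x s s' = 4 * (h x ^ 2 * flipAt x s s') := fun x => by
    unfold flipAt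
    split_ifs with h1 h2
    · simp
    · have : m s - m s' = h x * (sgn (s x) - sgn (s' x)) := by
        rw [hm, ← Finset.sum_sub_distrib, Finset.sum_eq_single x]
        · ring
        · intro y _ hy
          rw [h1 y hy, sub_self]
        · simp
      have h4 : ∀ a b : Fin 2, a ≠ b → (sgn a - sgn b) ^ 2 = 4 := fun a b hab => by
        fin_cases a <;> fin_cases b <;> simp_all <;> norm_num
      rw [this, mul_pow, h4 _ _ h2]
      ring
    · simp
  have hdiag : (m s - m s') ^ 2 * (diagOf bondSum : RealOp d N) s s' = 0 := by
    by_cases hs : s = s'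
    · simp [hs]
    · simp [diagOf, hs]
  have hgen : (m s - m s') ^ 2 * generator d N δ lam s s' =
      4 * δ * ∑ x, h x ^ 2 * flipAt x s s' := by
    simp only [generator, Matrix.add_apply, Matrix.smul_apply, smul_eq_mul, Matrix.sum_apply]
    rw [mul_add, mul_left_comm, hdiag, mul_zero, zero_add, mul_left_comm, Finset.mul_sum,
      Finset.sum_congr rfl fun x _ => hflip x, ← Finset.mul_sum]
    ring
  rw [hM, mul_assoc (Matrix.diagonal m) (Matrix.diagonal m), mul_assoc (generator d N δ lam)]
  simp only [Matrix.sub_apply, Matrix.smul_apply, Matrix.neg_apply, Matrix.diagonal_mul,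
    Matrix.mul_diagonal, Matrix.diagonal_mul_diagonal, Matrix.sum_apply, smul_eq_mul,
    ← hgen]
  ring

theorem neg_modeTraceDeriv_zero_le {δ : ℝ} (β lam : ℝ) (hδ : 0 < δ) (h : Torus d N → ℝ) :
    -modeTraceDeriv β δ lam h 0 ≤ 2 * δ * (∑ x, h x ^ 2) * (semigroup d N δ lam β).trace := by
  have hd := double_comm_modeOp δ lam h
  have htr : modeTraceDeriv β δ lam h 0 =
      (modeOp h * generator d N δ lam * modeOp h * semigroup d N δ lam β).trace -
        (modeOp h * modeOp h * generator d N δ lam * semigroup d N δ lam β).trace := by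
    rw [modeTraceDeriv, semigroup_zero, modeComm, sub_zero, ← Matrix.trace_sub]
    congr 1
    noncomm_ring
  have hsym : (modeOp h * modeOp h * generator d N δ lam * semigroup d N δ lam β).trace =
      (generator d N δ lam * modeOp h * modeOp h * semigroup d N δ lam β).trace := by
    rw [← Matrix.trace_transpose]
    simp only [Matrix.transpose_mul, transpose_semigroup, transpose_modeOp, transpose_generator]
    rw [Matrix.trace_mul_comm]
    simp only [mul_assoc]
  have h2 : 2 * modeTraceDeriv β δ lam h 0 =
      -(4 * δ * ∑ x, h x ^ 2 * (flipAt x * semigroup d N δ lam β).trace) := by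
    have := congrArg (fun M => (M * semigroup d N δ lam β).trace) hd
    simp only [sub_mul, Matrix.trace_sub, neg_mul, Matrix.trace_neg, Matrix.smul_mul,
      Matrix.trace_smul, Finset.sum_mul, Matrix.trace_sum, smul_eq_mul] at this
    rw [← this, htr, ← hsym]
    ring
  have h3 : ∑ x, h x ^ 2 * (flipAt x * semigroup d N δ lam β).trace ≤
      (∑ x, h x ^ 2) * (semigroup d N δ lam β).trace := by
    rw [Finset.sum_mul]
    exact Finset.sum_le_sum fun x _ => mul_le_mul_of_nonneg_left
      (trace_flipAt_mul_semigroup_le δ lam β x) (sq_nonneg _)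
  nlinarith [mul_le_mul_of_nonneg_left h3 hδ.le]

/-- Integration by parts against a cosine for a function with nonnegative second derivative. -/
theorem sq_mul_integral_mul_cos_le {R R' R'' : ℝ → ℝ} {β l : ℝ} (hβ : 0 ≤ β)
    (h1 : ∀ t, HasDerivAt R (R' t) t) (h2 : ∀ t, HasDerivAt R' (R'' t) t) (h3 : Continuous R'')
    (h4 : ∀ t, 0 ≤ R'' t) (hc : Real.cos (l * β) = 1) (hs : Real.sin (l * β) = 0) :
    l ^ 2 * ∫ t in (0 : ℝ)..β, R t * Real.cos (l * t) ≤ 2 * (R' β - R' 0) := by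
  have hR : Continuous R := continuous_iff_continuousAt.2 fun t => (h1 t).continuousAt
  have hd : ∀ t, HasDerivAt (fun t => R' t * (1 + Real.cos (l * t)) + l * (R t * Real.sin (l * t)))
      (R'' t * (1 + Real.cos (l * t)) + l ^ 2 * (R t * Real.cos (l * t))) t := fun t => by
    have hl : HasDerivAt (fun t : ℝ => l * t) l t := by
      simpa using (hasDerivAt_id t).const_mul l
    convert! ((h2 t).mul (hl.cos.const_add 1)).add (((h1 t).mul hl.sin).const_mul l) using 1
    ring
  have hcont : Continuous fun t => R'' t * (1 + Real.cos (l * t)) := by fun_prop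
  have hcont' : Continuous fun t => l ^ 2 * (R t * Real.cos (l * t)) := by fun_prop
  have hI := intervalIntegral.integral_eq_sub_of_hasDerivAt (a := 0) (b := β) (fun t _ => hd t)
    ((hcont.add hcont').intervalIntegrable _ _)
  rw [intervalIntegral.integral_add (hcont.intervalIntegrable _ _)
    (hcont'.intervalIntegrable _ _), intervalIntegral.integral_const_mul, hc, hs] at hI
  have hpos : 0 ≤ ∫ t in (0 : ℝ)..β, R'' t * (1 + Real.cos (l * t)) :=
    intervalIntegral.integral_nonneg hβ fun t _ =>
      mul_nonneg (h4 t) (by linarith [Real.neg_one_le_cos (l * t)])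
  simp only [mul_zero, Real.cos_zero, Real.sin_zero, add_zero] at hI
  linarith

theorem sq_mul_integral_modeTrace_mul_cos_le {β δ l : ℝ} (lam : ℝ) (hβ : 0 < β) (hδ : 0 < δ)
    (h : Torus d N → ℝ) (hc : Real.cos (l * β) = 1) (hs : Real.sin (l * β) = 0) :
    l ^ 2 * ∫ t in (0 : ℝ)..β, modeTrace β δ lam h t * Real.cos (l * t) ≤
      8 * δ * (∑ x, h x ^ 2) * (semigroup d N δ lam β).trace := by
  have h1 := sq_mul_integral_mul_cos_le hβ.le (hasDerivAt_modeTrace β δ lam h)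
    (hasDerivAt_modeTraceDeriv β δ lam h) (continuous_modeTraceDeriv₂ β δ lam h)
    (modeTraceDeriv₂_nonneg β δ lam h) hc hs
  have h2 := neg_modeTraceDeriv_zero_le β lam hδ h
  rw [modeTraceDeriv_end] at h1
  linarith

/-! ### Gaussian domination for the space–time Ising model -/

/-- The Dirichlet form of `v - h`. -/
def gradSq (h v : Torus d N → ℝ) : ℝ :=
  edgeSum (fun p q : ℝ => (p - q) ^ 2) fun x => v x - h x

/-- The polarized Dirichlet form. -/
def gradDot (h v : Torus d N → ℝ) : ℝ :=
  ∑ x, ∑ j, (h (x + Pi.single j 1) - h x) * (v (x + Pi.single j 1) - v x)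

/-- The spin at a single site. -/
def siteSpin (ω : Points × Fin 2) (t : ℝ) : ℝ :=
  (-1) ^ (ω.2 : ℕ) * ω.1.prodOver (flipBefore t)

theorem measurable_siteSpin (t : ℝ) : Measurable fun ω : Points × Fin 2 => siteSpin ω t :=
  ((measurable_of_countable fun a : Fin 2 => (-1 : ℝ) ^ (a : ℕ)).comp measurable_snd).mul
    ((Points.measurable_prodOver (measurable_flipBefore t)).comp measurable_fst)

theorem gradSq_nonneg (h v : Torus d N → ℝ) : 0 ≤ gradSq h v :=
  Finset.sum_nonneg fun _ _ => Finset.sum_nonneg fun _ _ => sq_nonneg _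

theorem lintegral_exp_gradSq_eq_shiftedZ {β δ : ℝ} (hβ : 0 < β) (hδ : 0 < δ) {J : ℝ} (hJ : 0 ≤ J)
    {n : ℕ} (τ : Fin n → ℝ) (h : Torus d N → ℝ) :
    ∫⁻ ω, ENNReal.ofReal (Real.exp (-(1 / 2) * (J * ∑ m, gradSq h fun x => spin ω x (τ m))))
        ∂(aPriori d N β δ) =
      shiftedZ ((evenPoissonProcess β δ).prod (uniformOn (Set.univ : Set (Fin 2))))
        (fun ω m => Real.sqrt J * siteSpin ω (τ m)) fun x => Real.sqrt J * h x := by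
  have := isProbabilityMeasure_evenPoissonProcess hβ hδ
  have := isProbabilityMeasure_uniformOn_fin_two
  have hmp := measurePreserving_arrowProdEquivProdArrow Points (Fin 2) (Torus d N)
    (fun _ => evenPoissonProcess β δ) (fun _ => uniformOn (Set.univ : Set (Fin 2)))
  rw [aPriori, ← hmp.lintegral_comp_emb (MeasurableEquiv.measurableEmbedding _), shiftedZ]
  refine lintegral_congr fun ω => ?_
  congr 3
  have hs : ∀ x t, spin (MeasurableEquiv.arrowProdEquivProdArrow Points (Fin 2) (Torus d N) ω) x t =
      siteSpin (ω x) t := fun x t => spin_eq_mul _ _ _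
  simp only [hs, gradSq, edgeSum, sqDist]
  rw [Finset.mul_sum, Finset.sum_congr rfl fun m _ => Finset.mul_sum _ _ _, Finset.sum_comm]
  refine Finset.sum_congr rfl fun x _ => ?_
  rw [Finset.sum_congr rfl fun m _ => Finset.mul_sum _ _ _, Finset.sum_comm]
  refine Finset.sum_congr rfl fun j _ => Finset.sum_congr rfl fun m _ => ?_
  rw [← mul_sub, ← mul_sub, ← mul_sub, mul_pow, Real.sq_sqrt hJ]

theorem lintegral_exp_gradSq_le {β δ : ℝ} (hβ : 0 < β) (hδ : 0 < δ) {J : ℝ} (hJ : 0 ≤ J)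
    {n : ℕ} (τ : Fin n → ℝ) (h : Torus d N → ℝ) :
    ∫⁻ ω, ENNReal.ofReal (Real.exp (-(1 / 2) * (J * ∑ m, gradSq h fun x => spin ω x (τ m))))
        ∂(aPriori d N β δ) ≤
      ∫⁻ ω, ENNReal.ofReal (Real.exp (-(1 / 2) * (J * ∑ m, gradSq 0 fun x => spin ω x (τ m))))
        ∂(aPriori d N β δ) := by
  have := isProbabilityMeasure_evenPoissonProcess hβ hδ
  have := isProbabilityMeasure_uniformOn_fin_two
  rw [lintegral_exp_gradSq_eq_shiftedZ hβ hδ hJ, lintegral_exp_gradSq_eq_shiftedZ hβ hδ hJ]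
  have h0 : (fun x => Real.sqrt J * (0 : Torus d N → ℝ) x) = 0 := by
    funext x
    simp
  rw [h0]
  exact shiftedZ_le_shiftedZ_zero _ (measurable_pi_iff.2 fun m =>
    (measurable_siteSpin (τ m)).const_mul _) _

open Filter Topology in
theorem integral_exp_gradSq_le {β δ lam : ℝ} (hβ : 0 < β) (hδ : 0 < δ) (hlam : 0 ≤ lam)
    (h : Torus d N → ℝ) :
    ∫ ω, Real.exp (-(1 / 2) * (lam * ∫ t in (0 : ℝ)..β, gradSq h fun x => spin ω x t))
        ∂(aPriori d N β δ) ≤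
      ∫ ω, Real.exp (-(1 / 2) * (lam * ∫ t in (0 : ℝ)..β, gradSq 0 fun x => spin ω x t))
        ∂(aPriori d N β δ) := by
  have := isProbabilityMeasure_aPriori (d := d) (N := N) hβ hδ
  set I : ℕ → (Torus d N → ℝ) → Config d N → ℝ := fun n h ω =>
    Real.exp (-(1 / 2) * (lam * ∑ m ∈ Finset.range n,
      (β - 0) / n * gradSq h fun x => spin ω x (0 + m * ((β - 0) / n))))
  have hmeas : ∀ n h, Measurable (I n h) := fun n h =>
    (measurable_const.mul (measurable_const.mul (Finset.measurable_sum _ fun m _ =>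
      measurable_const.mul (measurable_comp_spin _ _)))).exp
  have hlim : ∀ h : Torus d N → ℝ, Tendsto (fun n => ∫ ω, I n h ω ∂(aPriori d N β δ)) atTop
      (𝓝 (∫ ω, Real.exp (-(1 / 2) * (lam * ∫ t in (0 : ℝ)..β, gradSq h fun x => spin ω x t))
        ∂(aPriori d N β δ))) := fun h => by
    refine tendsto_integral_of_dominated_convergence (fun _ => 1)
      (fun n => (hmeas n h).aestronglyMeasurable) (integrable_const _) (fun n => ?_) ?_
    · refine Eventually.of_forall fun ω => ?_
      rw [Real.norm_eq_abs, Real.abs_exp, Real.exp_le_one_iff]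
      have : 0 ≤ ∑ m ∈ Finset.range n, (β - 0) / n * gradSq h fun x =>
          spin ω x (0 + m * ((β - 0) / n)) := Finset.sum_nonneg fun m _ =>
        mul_nonneg (div_nonneg (by linarith) n.cast_nonneg) (gradSq_nonneg _ _)
      have := mul_nonneg hlam this
      linarith
    · exact Eventually.of_forall fun ω =>
        (((tendsto_riemannSum_comp_spin (gradSq h) ω 0 β).const_mul lam).const_mul _).rexp
  refine le_of_tendsto_of_tendsto' (hlim h) (hlim 0) fun n => ?_
  have hI : ∀ h : Torus d N → ℝ, ∫ ω, I n h ω ∂(aPriori d N β δ) = (∫⁻ ω, ENNReal.ofReal (Real.exp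
      (-(1 / 2) * (lam * ((β - 0) / n) * ∑ m : Fin n, gradSq h fun x =>
        spin ω x (0 + (m : ℕ) * ((β - 0) / n))))) ∂(aPriori d N β δ)).toReal := fun h => by
    rw [integral_eq_lintegral_of_nonneg_ae (Eventually.of_forall fun _ => Real.exp_nonneg _)
      (hmeas n h).aestronglyMeasurable]
    simp only [← Finset.mul_sum, Finset.sum_range, mul_assoc]
  rw [hI, hI]
  refine ENNReal.toReal_mono ?_ (lintegral_exp_gradSq_le hβ hδ
    (mul_nonneg hlam (div_nonneg (by linarith) n.cast_nonneg)) _ h)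
  refine ((lintegral_mono (g := fun _ => 1) fun ω => ?_).trans_lt (by simp)).ne
  rw [ENNReal.ofReal_le_one, Real.exp_le_one_iff]
  have : 0 ≤ ∑ m : Fin n, gradSq 0 fun x => spin ω x (0 + (m : ℕ) * ((β - 0) / n)) :=
    Finset.sum_nonneg fun m _ => gradSq_nonneg _ _
  have := mul_nonneg (mul_nonneg hlam (div_nonneg (sub_nonneg.2 hβ.le) n.cast_nonneg)) this
  linarith

theorem gradSq_eq (h : Torus d N → ℝ) {v : Torus d N → ℝ} (hv : ∀ x, v x = 1 ∨ v x = -1) :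
    gradSq h v = 2 * (∑ _x : Torus d N, ∑ _j : Fin d, (1 : ℝ)) - 2 * bondSum v -
      2 * gradDot h v + gradDot h h := by
  have hv2 : ∀ x, v x ^ 2 = 1 := fun x => by rcases hv x with h | h <;> simp [h]
  simp only [gradSq, edgeSum, bondSum, gradDot, Finset.mul_sum, ← Finset.sum_sub_distrib,
    ← Finset.sum_add_distrib]
  refine Finset.sum_congr rfl fun x _ => Finset.sum_congr rfl fun j _ => ?_
  linear_combination hv2 x + hv2 (x + Pi.single j 1)

theorem integral_gradSq_spin (β : ℝ) (h : Torus d N → ℝ) (ω : Config d N) :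
    ∫ t in (0 : ℝ)..β, gradSq h (fun x => spin ω x t) =
      β * (2 * (∑ _x : Torus d N, ∑ _j : Fin d, (1 : ℝ))) -
        2 * (∫ t in (0 : ℝ)..β, bondSum fun x => spin ω x t) -
        2 * (∫ t in (0 : ℝ)..β, gradDot h fun x => spin ω x t) + β * gradDot h h := by
  have e : ∀ t, gradSq h (fun x => spin ω x t) = _ := fun t =>
    gradSq_eq h fun x => spin_eq_or ω x t
  simp_rw [e]
  have i1 := (intervalIntegrable_comp_spin (bondSum (R := ℝ)) ω 0 β).const_mul 2
  have i2 := (intervalIntegrable_comp_spin (gradDot h) ω 0 β).const_mul 2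
  have i0 : ∀ c : ℝ, IntervalIntegrable (fun _ => c) volume 0 β := fun c =>
    intervalIntegrable_const
  rw [intervalIntegral.integral_add (((i0 _).sub i1).sub i2) (i0 _),
    intervalIntegral.integral_sub ((i0 _).sub i1) i2, intervalIntegral.integral_sub (i0 _) i1,
    intervalIntegral.integral_const_mul, intervalIntegral.integral_const_mul,
    intervalIntegral.integral_const_mul, intervalIntegral.integral_const,
    intervalIntegral.integral_const, smul_eq_mul, smul_eq_mul, sub_zero]
  ring

/-- Gaussian domination for the generating function. -/
theorem integral_exp_gradDot_le {β δ lam : ℝ} (hβ : 0 < β) (hδ : 0 < δ) (hlam : 0 ≤ lam)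
    (h : Torus d N → ℝ) :
    ∫ ω, Real.exp (lam * ∫ t in (0 : ℝ)..β, gradDot h fun x => spin ω x t) *
        Real.exp (action β lam (spin ω)) ∂(aPriori d N β δ) ≤
      Real.exp (lam * β * gradDot h h / 2) *
        ∫ ω, Real.exp (action β lam (spin ω)) ∂(aPriori d N β δ) := by
  have hle := integral_exp_gradSq_le (d := d) (N := N) hβ hδ hlam h
  set K : ℝ := lam * β * (∑ _x : Torus d N, ∑ _j : Fin d, (1 : ℝ))
  have e1 : ∀ ω : Config d N,
      Real.exp (-(1 / 2) * (lam * ∫ t in (0 : ℝ)..β, gradSq h fun x => spin ω x t)) =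
        Real.exp (-K - lam * β * gradDot h h / 2) *
          (Real.exp (lam * ∫ t in (0 : ℝ)..β, gradDot h fun x => spin ω x t) *
            Real.exp (action β lam (spin ω))) := fun ω => by
    rw [integral_gradSq_spin, ← Real.exp_add, ← Real.exp_add, action]
    congr 1
    simp only [K]
    ring
  have e0 : ∀ ω : Config d N,
      Real.exp (-(1 / 2) * (lam * ∫ t in (0 : ℝ)..β, gradSq 0 fun x => spin ω x t)) =
        Real.exp (-K) * Real.exp (action β lam (spin ω)) := fun ω => by
    have z : ∀ v : Torus d N → ℝ, gradDot 0 v = 0 := fun v => by simp [gradDot]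
    rw [integral_gradSq_spin, ← Real.exp_add, action]
    congr 1
    simp only [K, z, intervalIntegral.integral_zero]
    ring
  simp_rw [e1, e0] at hle
  rw [integral_const_mul, integral_const_mul, sub_eq_add_neg, Real.exp_add, mul_assoc] at hle
  have hle := le_of_mul_le_mul_left hle (Real.exp_pos _)
  rw [Real.exp_neg, inv_mul_le_iff₀ (Real.exp_pos _)] at hle
  exact hle

open Filter Topology in
theorem le_of_forall_mul_le_exp_sub_one {a c Z : ℝ}
    (h : ∀ η : ℝ, 0 < η → η * a ≤ (Real.exp (η * c) - 1) * Z) : a ≤ c * Z := by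
  have hd : HasDerivAt (fun η : ℝ => Real.exp (η * c)) c 0 := by
    simpa using ((hasDerivAt_id (0 : ℝ)).mul_const c).exp
  have ht := (hd.tendsto_slope_zero_right).mul_const Z
  refine ge_of_tendsto ht ?_
  filter_upwards [self_mem_nhdsWithin] with η hη
  have hη : 0 < η := hη
  have := h η hη
  simp only [zero_add, zero_mul, Real.exp_zero, smul_eq_mul]
  rw [mul_assoc, ← div_eq_inv_mul, le_div_iff₀ hη]
  linarith

theorem one_add_sq_div_two_le_cosh (x : ℝ) : 1 + x ^ 2 / 2 ≤ Real.cosh x := by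
  have h : (x / 2) ^ 2 ≤ Real.sinh (x / 2) ^ 2 := by
    rcases le_total 0 (x / 2) with h | h
    · exact pow_le_pow_left₀ h (Real.self_le_sinh_iff.2 h) 2
    · have := pow_le_pow_left₀ (neg_nonneg.2 h) (neg_le_neg (Real.sinh_le_self_iff.2 h)) 2
      simpa using this
  have e : Real.cosh x = Real.cosh (x / 2) ^ 2 + Real.sinh (x / 2) ^ 2 := by
    rw [← Real.cosh_two_mul]; ring_nf
  rw [e, Real.cosh_sq]
  linarith

theorem gradDot_smul_left (c : ℝ) (h v : Torus d N → ℝ) :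
    gradDot (fun x => c * h x) v = c * gradDot h v := by
  simp only [gradDot, Finset.mul_sum]
  exact Finset.sum_congr rfl fun x _ => Finset.sum_congr rfl fun j _ => by ring

theorem gradDot_smul_smul (c : ℝ) (h : Torus d N → ℝ) :
    gradDot (fun x => c * h x) (fun x => c * h x) = c ^ 2 * gradDot h h := by
  simp only [gradDot, Finset.mul_sum]
  exact Finset.sum_congr rfl fun x _ => Finset.sum_congr rfl fun j _ => by ring

/-- The infrared bound for the Dirichlet form. -/
theorem integral_sq_gradDot_le {β δ lam : ℝ} (hβ : 0 < β) (hδ : 0 < δ) (hlam : 0 < lam)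
    (h : Torus d N → ℝ) :
    lam * ∫ ω, (∫ t in (0 : ℝ)..β, gradDot h fun x => spin ω x t) ^ 2 *
        Real.exp (action β lam (spin ω)) ∂(aPriori d N β δ) ≤
      β * gradDot h h * ∫ ω, Real.exp (action β lam (spin ω)) ∂(aPriori d N β δ) := by
  have := isProbabilityMeasure_aPriori (d := d) (N := N) hβ hδ
  set Y : Config d N → ℝ := fun ω => ∫ t in (0 : ℝ)..β, gradDot h fun x => spin ω x t with hY
  set w : Config d N → ℝ := fun ω => Real.exp (action β lam (spin ω))
  have hYm : Measurable Y := measurable_integral_comp_spin _ _ _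
  obtain ⟨C, hC⟩ := exists_abs_integral_comp_spin_le (gradDot h) 0 β
  have hw : Integrable w (aPriori d N β δ) := integrable_exp_action lam hβ hδ
  have hYw : Integrable (fun ω => Y ω ^ 2 * w ω) (aPriori d N β δ) := by
    refine hw.bdd_mul (c := C ^ 2) (hYm.pow_const 2).aestronglyMeasurable
      (Filter.Eventually.of_forall fun ω => ?_)
    rw [Real.norm_eq_abs, abs_pow]
    exact pow_le_pow_left₀ (abs_nonneg _) (hC ω) 2
  have hexp : ∀ c : ℝ, Integrable (fun ω => Real.exp (lam * (c * Y ω)) * w ω)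
      (aPriori d N β δ) := fun c => by
    refine hw.bdd_mul (c := Real.exp (|lam * c| * C))
      ((hYm.const_mul c).const_mul lam).exp.aestronglyMeasurable
      (Filter.Eventually.of_forall fun ω => ?_)
    rw [Real.norm_eq_abs, Real.abs_exp, ← mul_assoc]
    refine Real.exp_le_exp.2 ((le_abs_self _).trans ?_)
    rw [abs_mul]
    exact mul_le_mul_of_nonneg_left (hC ω) (abs_nonneg _)
  have hdom : ∀ c : ℝ, ∫ ω, Real.exp (lam * (c * Y ω)) * w ω ∂(aPriori d N β δ) ≤
      Real.exp (c ^ 2 * (lam * β * gradDot h h / 2)) * ∫ ω, w ω ∂(aPriori d N β δ) := fun c => by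
    have := integral_exp_gradDot_le (d := d) (N := N) hβ hδ hlam.le fun x => c * h x
    simp only [gradDot_smul_left, intervalIntegral.integral_const_mul] at this
    refine this.trans_eq ?_
    congr 2
    rw [← mul_div_assoc]
    congr 1
    have := gradDot_smul_smul c h
    rw [gradDot_smul_left] at this
    linear_combination (lam * β) * this
  have key : lam ^ 2 / 2 * ∫ ω, Y ω ^ 2 * w ω ∂(aPriori d N β δ) ≤
      lam * β * gradDot h h / 2 * ∫ ω, w ω ∂(aPriori d N β δ) := by
    refine le_of_forall_mul_le_exp_sub_one fun η hη => ?_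
    have h1 := hdom (Real.sqrt η)
    have h2 := hdom (-Real.sqrt η)
    rw [neg_sq, Real.sq_sqrt hη.le] at h2
    rw [Real.sq_sqrt hη.le] at h1
    have hpt : ∫ ω, (2 * w ω + η * lam ^ 2 * (Y ω ^ 2 * w ω)) ∂(aPriori d N β δ) ≤
        ∫ ω, (Real.exp (lam * (Real.sqrt η * Y ω)) * w ω +
          Real.exp (lam * (-Real.sqrt η * Y ω)) * w ω) ∂(aPriori d N β δ) := by
      refine integral_mono ((hw.const_mul 2).add (hYw.const_mul _))
        ((hexp _).add (hexp _)) fun ω => ?_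
      have hcosh := one_add_sq_div_two_le_cosh (lam * (Real.sqrt η * Y ω))
      rw [Real.cosh_eq] at hcosh
      have e : lam * (-Real.sqrt η * Y ω) = -(lam * (Real.sqrt η * Y ω)) := by ring
      have e2 : (lam * (Real.sqrt η * Y ω)) ^ 2 = η * lam ^ 2 * Y ω ^ 2 := by
        rw [mul_pow, mul_pow, Real.sq_sqrt hη.le]; ring
      have hwpos : 0 < w ω := Real.exp_pos _
      simp only
      rw [e, ← add_mul, ← mul_assoc, ← add_mul]
      refine mul_le_mul_of_nonneg_right ?_ hwpos.le
      linarith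
    rw [integral_add (hw.const_mul 2) (hYw.const_mul _), integral_add (hexp _) (hexp _),
      integral_const_mul, integral_const_mul] at hpt
    linarith
  have hl : 0 < lam / 2 := by positivity
  refine le_of_mul_le_mul_left ?_ hl
  linarith

/-! ### Plane waves on the torus -/

theorem exists_dot_add {k : Fin d → ℝ} (hk : k ∈ momenta d N) (x y : Torus d N) :
    ∃ n : ℤ, dot k (x + y) = dot k x + dot k y + n * (2 * Real.pi) := by
  obtain ⟨m, rfl⟩ := hk
  have hN : (N : ℝ) ≠ 0 := Nat.cast_ne_zero.2 (NeZero.ne N)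
  obtain ⟨q, hq⟩ : ∃ q : Fin d → ℕ, ∀ j, ((x + y) j).val + (2 * N) * q j =
      (x j).val + (y j).val := ⟨fun j => ((x j).val + (y j).val) / (2 * N), fun j => by
    rw [Pi.add_apply, ZMod.val_add, Nat.mod_add_div]⟩
  refine ⟨-∑ j, ((m j).val * q j : ℕ), ?_⟩
  push_cast
  simp only [dot, neg_mul, Finset.sum_mul, ← Finset.sum_add_distrib, ← sub_eq_add_neg,
    ← Finset.sum_sub_distrib]
  refine Finset.sum_congr rfl fun j _ => ?_
  have h : (((x + y) j).val : ℝ) + (2 * N) * q j = (x j).val + (y j).val := mod_cast hq j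
  rw [eq_sub_of_add_eq h]
  field_simp

theorem cos_dot_add {k : Fin d → ℝ} (hk : k ∈ momenta d N) (x y : Torus d N) :
    Real.cos (dot k (x + y)) = Real.cos (dot k x + dot k y) := by
  obtain ⟨n, hn⟩ := exists_dot_add hk x y
  rw [hn, Real.cos_add_int_mul_two_pi]

theorem sin_dot_add {k : Fin d → ℝ} (hk : k ∈ momenta d N) (x y : Torus d N) :
    Real.sin (dot k (x + y)) = Real.sin (dot k x + dot k y) := by
  obtain ⟨n, hn⟩ := exists_dot_add hk x y
  rw [hn, Real.sin_add_int_mul_two_pi]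

theorem dot_zero (k : Fin d → ℝ) : dot k (0 : Torus d N) = 0 := by simp [dot]

theorem dot_single (k : Fin d → ℝ) (j : Fin d) : dot k (Pi.single j 1 : Torus d N) = k j := by
  have hN := NeZero.pos N
  have h1 : (1 : ZMod (2 * N)).val = 1 := ZMod.val_one'' (by omega)
  rw [dot, Finset.sum_eq_single j]
  · simp [h1]
  · intro i _ hi
    simp [Pi.single_eq_of_ne hi]
  · simp

theorem exists_dot_sub {k : Fin d → ℝ} (hk : k ∈ momenta d N) (x y : Torus d N) :
    ∃ n : ℤ, dot k (x - y) = dot k x - dot k y + n * (2 * Real.pi) := by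
  obtain ⟨n, hn⟩ := exists_dot_add hk (x - y) y
  rw [sub_add_cancel] at hn
  refine ⟨-n, ?_⟩
  push_cast
  linarith

theorem cos_dot_sub {k : Fin d → ℝ} (hk : k ∈ momenta d N) (x y : Torus d N) :
    Real.cos (dot k (x - y)) = Real.cos (dot k x - dot k y) := by
  obtain ⟨n, hn⟩ := exists_dot_sub hk x y
  rw [hn, Real.cos_add_int_mul_two_pi]

theorem sin_dot_sub {k : Fin d → ℝ} (hk : k ∈ momenta d N) (x y : Torus d N) :
    Real.sin (dot k (x - y)) = Real.sin (dot k x - dot k y) := by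
  obtain ⟨n, hn⟩ := exists_dot_sub hk x y
  rw [hn, Real.sin_add_int_mul_two_pi]

theorem sum_laplace_cos {k : Fin d → ℝ} (hk : k ∈ momenta d N) (x : Torus d N) :
    ∑ j, (2 * Real.cos (dot k x) - Real.cos (dot k (x + Pi.single j 1)) -
      Real.cos (dot k (x - Pi.single j 1))) = 2 * laplaceHat k * Real.cos (dot k x) := by
  rw [laplaceHat, mul_assoc, Finset.sum_mul, Finset.mul_sum]
  refine Finset.sum_congr rfl fun j _ => ?_
  rw [cos_dot_add hk, cos_dot_sub hk, dot_single, Real.cos_add, Real.cos_sub]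
  ring

theorem sum_laplace_sin {k : Fin d → ℝ} (hk : k ∈ momenta d N) (x : Torus d N) :
    ∑ j, (2 * Real.sin (dot k x) - Real.sin (dot k (x + Pi.single j 1)) -
      Real.sin (dot k (x - Pi.single j 1))) = 2 * laplaceHat k * Real.sin (dot k x) := by
  rw [laplaceHat, mul_assoc, Finset.sum_mul, Finset.mul_sum]
  refine Finset.sum_congr rfl fun j _ => ?_
  rw [sin_dot_add hk, sin_dot_sub hk, dot_single, Real.sin_add, Real.sin_sub]
  ring

/-- Summation by parts for an eigenfunction of the Laplacian. -/
theorem gradDot_of_eigen {h : Torus d N → ℝ} {κ : ℝ}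
    (he : ∀ x, ∑ j, (2 * h x - h (x + Pi.single j 1) - h (x - Pi.single j 1)) = κ * h x)
    (v : Torus d N → ℝ) : gradDot h v = κ * ∑ x, h x * v x := by
  have hj : ∀ j : Fin d, ∑ x, (h (x + Pi.single j 1) - h x) * v (x + Pi.single j 1) =
      ∑ x : Torus d N, (h x - h (x - Pi.single j 1)) * v x := fun j => by
    refine Eq.trans ?_ (Equiv.sum_comp (Equiv.addRight (Pi.single j 1 : Torus d N)) _)
    exact Finset.sum_congr rfl fun x _ => by simp
  have h1 : gradDot h v = ∑ x, (∑ j, (2 * h x - h (x + Pi.single j 1) - h (x - Pi.single j 1))) *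
      v x := by
    rw [gradDot, Finset.sum_comm]
    simp only [Finset.sum_mul]
    rw [Finset.sum_comm (s := Finset.univ (α := Torus d N)) (t := Finset.univ (α := Fin d))]
    refine Finset.sum_congr rfl fun j _ => ?_
    simp only [mul_sub, Finset.sum_sub_distrib, hj]
    rw [← Finset.sum_sub_distrib]
    exact Finset.sum_congr rfl fun x _ => by ring
  rw [h1, Finset.mul_sum]
  exact Finset.sum_congr rfl fun x _ => by rw [he]; ring

/-! ### The variance of the integrated spin -/

theorem measurable_comp_spin_uncurry (f : (Torus d N → ℝ) → ℝ) :
    Measurable fun p : ℝ × Config d N => f fun x => spin p.2 x p.1 := by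
  obtain ⟨coef, hc⟩ := exists_monom_expansion f
  have : (fun p : ℝ × Config d N => f fun x => spin p.2 x p.1) = fun p =>
      ∑ A, coef A * monom (fun x => if x ∈ A then 1 else 0) fun x => spin p.2 x p.1 :=
    funext fun p => hc _ fun x => spin_eq_or p.2 x p.1
  rw [this]
  unfold monom
  exact Finset.measurable_sum _ fun A _ => measurable_const.mul
    (Finset.measurable_prod _ fun x _ =>
      ((measurable_spin_uncurry x).comp measurable_swap).pow_const _)

theorem integral_integral_comp_spin_mul {β δ : ℝ} (hβ : 0 < β) (hδ : 0 < δ)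
    (f : (Torus d N → ℝ) → ℝ) {G : Config d N → ℝ} (hG : Measurable G) {C : ℝ}
    (hC : ∀ ω, |G ω| ≤ C) :
    ∫ ω, (∫ t in (0 : ℝ)..β, f fun x => spin ω x t) * G ω ∂(aPriori d N β δ) =
      ∫ t in (0 : ℝ)..β, ∫ ω, (f fun x => spin ω x t) * G ω ∂(aPriori d N β δ) := by
  have := isProbabilityMeasure_aPriori (d := d) (N := N) hβ hδ
  obtain ⟨C', hC'⟩ := exists_abs_comp_spin_le f
  simp_rw [← intervalIntegral.integral_mul_const]
  have : IsFiniteMeasure (volume.restrict (Set.uIoc 0 β)) := ⟨by simp [Set.uIoc_of_le hβ.le]⟩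
  refine (intervalIntegral_integral_swap ?_).symm
  refine Integrable.of_bound ((measurable_comp_spin_uncurry f).mul
    (hG.comp measurable_snd)).aestronglyMeasurable (C' * C) (Filter.Eventually.of_forall fun p => ?_)
  simp only [Function.uncurry, Real.norm_eq_abs, abs_mul]
  exact mul_le_mul (hC' _ _) (hC _) (abs_nonneg _) ((abs_nonneg _).trans (hC' p.2 p.1))

theorem integral_abs_sub {R : ℝ → ℝ} (hR : Continuous R) {β : ℝ} (hsym : ∀ u, R (β - u) = R u)
    {s : ℝ} (hs : 0 ≤ s) (hsβ : s ≤ β) :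
    ∫ t in (0 : ℝ)..β, R |t - s| = ∫ t in (0 : ℝ)..β, R t := by
  have hc : Continuous fun t => R |t - s| := by fun_prop
  rw [← intervalIntegral.integral_add_adjacent_intervals (hc.intervalIntegrable 0 s)
    (hc.intervalIntegrable s β)]
  have h1 : ∫ t in (0 : ℝ)..s, R |t - s| = ∫ t in (0 : ℝ)..s, R t := by
    rw [intervalIntegral.integral_congr (g := fun t => R (s - t)),
      intervalIntegral.integral_comp_sub_left]
    · simp
    · intro t ht
      rw [Set.uIcc_of_le hs] at ht
      simp only
      rw [abs_of_nonpos (by linarith [ht.2]), neg_sub]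
  have h2 : ∫ t in s..β, R |t - s| = ∫ t in s..β, R t := by
    rw [intervalIntegral.integral_congr (g := fun t => R (t - s)),
      intervalIntegral.integral_comp_sub_right]
    · have : ∫ t in s..β, R t = ∫ t in s..β, R (β - t) := by simp only [hsym]
      rw [this, intervalIntegral.integral_comp_sub_left, sub_self, sub_self]
    · intro t ht
      rw [Set.uIcc_of_le hsβ] at ht
      simp only
      rw [abs_of_nonneg (by linarith [ht.1])]
  rw [h1, h2, intervalIntegral.integral_add_adjacent_intervals (hR.intervalIntegrable 0 s)
    (hR.intervalIntegrable s β)]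

theorem integral_mode_mul_mode {β δ : ℝ} (lam : ℝ) (hβ : 0 < β) (hδ : 0 < δ) (h : Torus d N → ℝ)
    {s t : ℝ} (hs : s ∈ Set.Icc 0 β) (ht : t ∈ Set.Icc 0 β) :
    ∫ ω, (∑ x, h x * spin ω x t) * ((∑ x, h x * spin ω x s) *
        Real.exp (action β lam (spin ω))) ∂(aPriori d N β δ) =
      modeTrace β δ lam h |t - s| / (2 * Real.cosh (δ * β)) ^ Fintype.card (Torus d N) := by
  wlog hst : s ≤ t generalizing s t
  · rw [abs_sub_comm, ← this ht hs (le_of_not_ge hst)]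
    congr 1
    funext ω
    ring
  have := integral_mul_exp_action (d := d) (N := N) (lam := lam) hβ hδ hs.1 hst ht.2
    (fun v => ∑ x, h x * v x) (fun v => ∑ x, h x * v x)
  rw [trace_semigroup_cycle] at this
  rw [abs_of_nonneg (sub_nonneg.2 hst), modeTrace, modeOp, ← this]
  congr 1
  funext ω
  ring

theorem integral_sq_mode {β δ : ℝ} (lam : ℝ) (hβ : 0 < β) (hδ : 0 < δ) (h : Torus d N → ℝ) :
    ∫ ω, (∫ t in (0 : ℝ)..β, ∑ x, h x * spin ω x t) ^ 2 * Real.exp (action β lam (spin ω))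
        ∂(aPriori d N β δ) =
      β * (∫ t in (0 : ℝ)..β, modeTrace β δ lam h t) /
        (2 * Real.cosh (δ * β)) ^ Fintype.card (Torus d N) := by
  set f : (Torus d N → ℝ) → ℝ := fun v => ∑ x, h x * v x with hf
  set w : Config d N → ℝ := fun ω => Real.exp (action β lam (spin ω)) with hw
  have hwm : Measurable w := (measurable_action_spin β lam).exp
  obtain ⟨Cw, hCw⟩ : ∃ C, ∀ ω, |w ω| ≤ C := by
    obtain ⟨C, hC⟩ := exists_abs_action_spin_le (d := d) (N := N) β lam
    refine ⟨Real.exp C, fun ω => ?_⟩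
    rw [hw, Real.abs_exp]
    exact Real.exp_le_exp.2 ((le_abs_self _).trans (hC ω))
  obtain ⟨Cf, hCf⟩ := exists_abs_comp_spin_le f
  obtain ⟨CX, hCX⟩ := exists_abs_integral_comp_spin_le f 0 β
  have step1 := integral_integral_comp_spin_mul (d := d) (N := N) hβ hδ f
    (G := fun ω => (∫ t in (0 : ℝ)..β, f fun x => spin ω x t) * w ω)
    ((measurable_integral_comp_spin f 0 β).mul hwm) (C := CX * Cw) fun ω => by
      rw [abs_mul]
      exact mul_le_mul (hCX ω) (hCw ω) (abs_nonneg _) ((abs_nonneg _).trans (hCX ω))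
  have step2 : ∀ s, ∫ ω, (∫ t in (0 : ℝ)..β, f fun x => spin ω x t) *
      ((f fun x => spin ω x s) * w ω) ∂(aPriori d N β δ) = _ := fun s =>
    integral_integral_comp_spin_mul (d := d) (N := N) hβ hδ f
    (G := fun ω => (f fun x => spin ω x s) * w ω)
    ((measurable_comp_spin f s).mul hwm) (C := Cf * Cw) fun ω => by
      rw [abs_mul]
      exact mul_le_mul (hCf ω s) (hCw ω) (abs_nonneg _) ((abs_nonneg _).trans (hCf ω s))
  have e : ∀ ω, (∫ t in (0 : ℝ)..β, ∑ x, h x * spin ω x t) ^ 2 * Real.exp (action β lam (spin ω)) =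
      (∫ t in (0 : ℝ)..β, f fun x => spin ω x t) *
        ((∫ t in (0 : ℝ)..β, f fun x => spin ω x t) * w ω) := fun ω => by
    rw [sq, mul_assoc]
  simp_rw [e]
  rw [step1]
  have inner : ∀ s ∈ Set.uIcc 0 β, ∫ ω, (f fun x => spin ω x s) *
      ((∫ t in (0 : ℝ)..β, f fun x => spin ω x t) * w ω) ∂(aPriori d N β δ) =
        (∫ t in (0 : ℝ)..β, modeTrace β δ lam h t) /
          (2 * Real.cosh (δ * β)) ^ Fintype.card (Torus d N) := fun s hs => by
    rw [Set.uIcc_of_le hβ.le] at hs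
    have : ∀ ω, (f fun x => spin ω x s) * ((∫ t in (0 : ℝ)..β, f fun x => spin ω x t) * w ω) =
        (∫ t in (0 : ℝ)..β, f fun x => spin ω x t) * ((f fun x => spin ω x s) * w ω) :=
      fun ω => mul_left_comm _ _ _
    simp_rw [this]
    rw [step2, intervalIntegral.integral_congr (g := fun t => modeTrace β δ lam h |t - s| /
      (2 * Real.cosh (δ * β)) ^ Fintype.card (Torus d N)), intervalIntegral.integral_div,
      integral_abs_sub (continuous_modeTrace β δ lam h) (modeTrace_sub β δ lam h) hs.1 hs.2]
    intro t ht
    rw [Set.uIcc_of_le hβ.le] at ht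
    exact integral_mode_mul_mode lam hβ hδ h hs ht
  rw [intervalIntegral.integral_congr inner, intervalIntegral.integral_const, smul_eq_mul, sub_zero,
    mul_div_assoc]

/-- The infrared bound for an eigenfunction of the Laplacian. -/
theorem mul_integral_modeTrace_le {β δ lam κ : ℝ} (hβ : 0 < β) (hδ : 0 < δ) (hlam : 0 < lam)
    (hκ : 0 < κ) {h : Torus d N → ℝ}
    (he : ∀ x, ∑ j, (2 * h x - h (x + Pi.single j 1) - h (x - Pi.single j 1)) = κ * h x) :
    lam * κ * ∫ t in (0 : ℝ)..β, modeTrace β δ lam h t ≤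
      (∑ x, h x ^ 2) * (semigroup d N δ lam β).trace := by
  have hb := integral_sq_gradDot_le (d := d) (N := N) hβ hδ hlam h
  simp only [gradDot_of_eigen he, intervalIntegral.integral_const_mul, mul_pow, mul_assoc,
    integral_const_mul] at hb
  rw [integral_sq_mode lam hβ hδ h, integral_exp_action hβ hδ] at hb
  have hc : 0 < (2 * Real.cosh (δ * β)) ^ Fintype.card (Torus d N) := by
    have := Real.cosh_pos (δ * β)
    positivity
  simp only [← sq] at hb
  have hpos : 0 < κ * β / (2 * Real.cosh (δ * β)) ^ Fintype.card (Torus d N) := by positivity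
  refine le_of_mul_le_mul_left ?_ hpos
  calc _ = lam * (κ ^ 2 * (β * (∫ t in (0 : ℝ)..β, modeTrace β δ lam h t) /
        (2 * Real.cosh (δ * β)) ^ Fintype.card (Torus d N))) := by ring
    _ ≤ _ := hb
    _ = _ := by ring

/-! ### The spatial Fourier transform of the two-point function -/

/-- The spatial Fourier transform of the unnormalized two-point function. -/
def waveTrace (β δ lam : ℝ) (k : Fin d → ℝ) (t : ℝ) : ℝ :=
  ∑ z : Torus d N, Real.cos (dot k z) * traceTwoPoint β δ lam 0 z t

theorem continuous_traceTwoPoint (β δ lam : ℝ) (x y : Torus d N) :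
    Continuous (traceTwoPoint β δ lam x y) :=
  continuous_iff_continuousAt.2 fun t => (hasDerivAt_trace_semigroup β δ lam _ _ t).continuousAt

theorem modeTrace_cos_add_modeTrace_sin {k : Fin d → ℝ} (hk : k ∈ momenta d N) (β δ lam t : ℝ) :
    modeTrace β δ lam (fun x : Torus d N => Real.cos (dot k x)) t +
      modeTrace β δ lam (fun x : Torus d N => Real.sin (dot k x)) t =
        Fintype.card (Torus d N) * waveTrace (N := N) β δ lam k t := by
  simp only [modeTrace_eq_sum, ← Finset.sum_add_distrib]
  rw [← nsmul_eq_mul, ← Finset.card_univ, ← Finset.sum_const]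
  refine Finset.sum_congr rfl fun x _ => ?_
  rw [waveTrace]
  refine Eq.trans ?_ (Equiv.sum_comp (Equiv.subRight x) _)
  refine Finset.sum_congr rfl fun y _ => ?_
  have h := traceTwoPoint_add β δ lam 0 (y - x) x t
  rw [zero_add, sub_add_cancel] at h
  rw [Equiv.subRight_apply, cos_dot_sub hk, Real.cos_sub, h]
  ring

theorem sum_cos_sq_add_sum_sin_sq (k : Fin d → ℝ) :
    ∑ x : Torus d N, Real.cos (dot k x) ^ 2 + ∑ x : Torus d N, Real.sin (dot k x) ^ 2 =
      Fintype.card (Torus d N) := by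
  simp [← Finset.sum_add_distrib]

theorem card_torus_pos : (0 : ℝ) < Fintype.card (Torus d N) :=
  Nat.cast_pos.2 Fintype.card_pos

theorem waveTrace_nonneg {k : Fin d → ℝ} (hk : k ∈ momenta d N) (β δ lam t : ℝ) :
    0 ≤ waveTrace (N := N) β δ lam k t := by
  refine nonneg_of_mul_nonneg_right ?_ (card_torus_pos (d := d) (N := N))
  rw [← modeTrace_cos_add_modeTrace_sin hk]
  exact add_nonneg (modeTrace_nonneg _ _ _ _ _) (modeTrace_nonneg _ _ _ _ _)

theorem continuous_waveTrace (β δ lam : ℝ) (k : Fin d → ℝ) :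
    Continuous (waveTrace (N := N) β δ lam k) :=
  continuous_finsetSum _ fun z _ => continuous_const.mul (continuous_traceTwoPoint β δ lam 0 z)

theorem laplaceHat_nonneg (k : Fin d → ℝ) : 0 ≤ laplaceHat k :=
  Finset.sum_nonneg fun _ _ => sub_nonneg.2 (Real.cos_le_one _)

theorem mul_integral_waveTrace_le {β δ lam : ℝ} (hβ : 0 < β) (hδ : 0 < δ) {k : Fin d → ℝ}
    (hk : k ∈ momenta d N) (hlam : 0 < lam) (hL : 0 < laplaceHat k) :
    2 * lam * laplaceHat k * ∫ t in (0 : ℝ)..β, waveTrace (N := N) β δ lam k t ≤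
      (semigroup d N δ lam β).trace := by
  have hκ : 0 < 2 * laplaceHat k := by positivity
  have h1 := mul_integral_modeTrace_le hβ hδ hlam hκ (sum_laplace_cos hk)
  have h2 := mul_integral_modeTrace_le hβ hδ hlam hκ (sum_laplace_sin hk)
  have h := add_le_add h1 h2
  rw [← mul_add, ← add_mul, sum_cos_sq_add_sum_sin_sq, ← intervalIntegral.integral_add
    ((continuous_modeTrace _ _ _ _).intervalIntegrable _ _)
    ((continuous_modeTrace _ _ _ _).intervalIntegrable _ _)] at h
  simp only [modeTrace_cos_add_modeTrace_sin hk, intervalIntegral.integral_const_mul] at h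
  refine le_of_mul_le_mul_left ?_ (card_torus_pos (d := d) (N := N))
  linarith

theorem sq_mul_integral_waveTrace_mul_cos_le {β δ l : ℝ} (lam : ℝ) (hβ : 0 < β) (hδ : 0 < δ)
    {k : Fin d → ℝ} (hk : k ∈ momenta d N) (hc : Real.cos (l * β) = 1)
    (hs : Real.sin (l * β) = 0) :
    l ^ 2 * ∫ t in (0 : ℝ)..β, waveTrace (N := N) β δ lam k t * Real.cos (l * t) ≤
      8 * δ * (semigroup d N δ lam β).trace := by
  have h1 := sq_mul_integral_modeTrace_mul_cos_le (d := d) (N := N) lam hβ hδ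
    (fun x => Real.cos (dot k x)) hc hs
  have h2 := sq_mul_integral_modeTrace_mul_cos_le (d := d) (N := N) lam hβ hδ
    (fun x => Real.sin (dot k x)) hc hs
  have h := add_le_add h1 h2
  have hi : ∀ f : Torus d N → ℝ, IntervalIntegrable
      (fun t => modeTrace β δ lam f t * Real.cos (l * t)) volume 0 β := fun f =>
    ((continuous_modeTrace β δ lam f).mul (by fun_prop)).intervalIntegrable _ _
  rw [← mul_add, ← add_mul, ← mul_add, sum_cos_sq_add_sum_sin_sq,
    ← intervalIntegral.integral_add (hi _) (hi _)] at h
  simp only [← add_mul, modeTrace_cos_add_modeTrace_sin hk] at h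
  simp only [mul_assoc, intervalIntegral.integral_const_mul] at h
  refine le_of_mul_le_mul_left ?_ (card_torus_pos (d := d) (N := N))
  linarith

theorem integral_waveTrace_mul_cos_le {β δ : ℝ} (lam : ℝ) (hβ : 0 < β) {k : Fin d → ℝ}
    (hk : k ∈ momenta d N) (l : ℝ) :
    ∫ t in (0 : ℝ)..β, waveTrace (N := N) β δ lam k t * Real.cos (l * t) ≤
      ∫ t in (0 : ℝ)..β, waveTrace (N := N) β δ lam k t := by
  have hc := continuous_waveTrace (N := N) β δ lam k
  refine intervalIntegral.integral_mono_on hβ.le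
    ((hc.mul (by fun_prop)).intervalIntegrable _ _) (hc.intervalIntegrable _ _) fun t _ => ?_
  exact mul_le_of_le_one_right (waveTrace_nonneg hk _ _ _ _) (Real.cos_le_one _)

/-! ### The Fourier transform of the Schwinger function -/

theorem integral_mul_sin_eq_zero {R : ℝ → ℝ} {β l : ℝ} (hsym : ∀ t, R (β - t) = R t)
    (hc : Real.cos (l * β) = 1) (hs : Real.sin (l * β) = 0) :
    ∫ t in (0 : ℝ)..β, R t * Real.sin (l * t) = 0 := by
  have h := intervalIntegral.integral_comp_sub_left (a := 0) (b := β)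
    (fun t => R t * Real.sin (l * t)) β
  simp only [hsym, mul_sub, Real.sin_sub, hc, hs, zero_mul, one_mul, zero_sub, mul_neg,
    intervalIntegral.integral_neg, sub_zero, sub_self] at h
  linarith

theorem integral_mul_cexp {R : ℝ → ℝ} (hR : Continuous R) {β l : ℝ}
    (hsym : ∀ t, R (β - t) = R t) (hc : Real.cos (l * β) = 1) (hs : Real.sin (l * β) = 0) :
    ∫ t in (0 : ℝ)..β, (R t : ℂ) * Complex.exp (Complex.I * l * t) =
      ((∫ t in (0 : ℝ)..β, R t * Real.cos (l * t) : ℝ) : ℂ) := by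
  have e : ∀ t : ℝ, (R t : ℂ) * Complex.exp (Complex.I * l * t) =
      ((R t * Real.cos (l * t) : ℝ) : ℂ) + ((R t * Real.sin (l * t) : ℝ) : ℂ) * Complex.I := by
    intro t
    rw [show Complex.I * l * t = ((l * t : ℝ) : ℂ) * Complex.I by push_cast; ring,
      Complex.exp_mul_I]
    push_cast
    ring
  simp_rw [e]
  rw [intervalIntegral.integral_add, intervalIntegral.integral_mul_const,
    intervalIntegral.integral_ofReal, intervalIntegral.integral_ofReal,
    integral_mul_sin_eq_zero hsym hc hs]
  · simp
  · exact Continuous.intervalIntegrable (by fun_prop) _ _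
  · exact Continuous.intervalIntegrable (by fun_prop) _ _

theorem sum_mul_cexp_dot {k : Fin d → ℝ} (hk : k ∈ momenta d N) {a : Torus d N → ℝ}
    (ha : ∀ x, a (-x) = a x) :
    ∑ x, (a x : ℂ) * Complex.exp (Complex.I * (dot k x : ℂ)) =
      ((∑ x, Real.cos (dot k x) * a x : ℝ) : ℂ) := by
  have h0 : ∑ x, Real.sin (dot k x) * a x = 0 := by
    have h := Equiv.sum_comp (Equiv.neg (Torus d N)) fun x => Real.sin (dot k x) * a x
    have e : ∀ x : Torus d N, Real.sin (dot k (-x)) = -Real.sin (dot k x) := fun x => by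
      rw [← zero_sub, sin_dot_sub hk, dot_zero, zero_sub, Real.sin_neg]
    simp only [Equiv.neg_apply, ha, e, neg_mul, Finset.sum_neg_distrib] at h
    linarith
  have e : ∀ x, (a x : ℂ) * Complex.exp (Complex.I * (dot k x : ℂ)) =
      ((Real.cos (dot k x) * a x : ℝ) : ℂ) + ((Real.sin (dot k x) * a x : ℝ) : ℂ) * Complex.I := by
    intro x
    rw [mul_comm Complex.I, Complex.exp_mul_I]
    push_cast
    ring
  simp_rw [e]
  rw [Finset.sum_add_distrib, ← Finset.sum_mul, ← Complex.ofReal_sum, ← Complex.ofReal_sum, h0]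
  simp

theorem traceTwoPoint_zero_neg (β δ lam : ℝ) (x : Torus d N) (t : ℝ) :
    traceTwoPoint β δ lam 0 (-x) t = traceTwoPoint β δ lam 0 x t := by
  have h := traceTwoPoint_add β δ lam 0 (-x) x t
  rw [zero_add, neg_add_cancel] at h
  rw [← h, traceTwoPoint_comm]

theorem cos_sin_frequency {β l : ℝ} (hβ : 0 < β) (hl : l ∈ frequencies β) :
    Real.cos (l * β) = 1 ∧ Real.sin (l * β) = 0 := by
  obtain ⟨n, rfl⟩ := hl
  have : 2 * Real.pi / β * n * β = n * (2 * Real.pi) := by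
    field_simp
  simp only [this]
  refine ⟨Real.cos_int_mul_two_pi n, ?_⟩
  have := Real.sin_add_int_mul_two_pi 0 n
  rwa [zero_add, Real.sin_zero] at this

theorem schwinger_zero_eq {β δ lam t : ℝ} (hβ : 0 < β) (hδ : 0 < δ) (ht : t ∈ Set.uIcc 0 β)
    (x : Torus d N) : schwinger β δ lam 0 0 x t =
      traceTwoPoint β δ lam 0 x t / (semigroup d N δ lam β).trace := by
  rw [Set.uIcc_of_le hβ.le] at ht
  rw [schwinger_eq_traceTwoPoint hβ hδ le_rfl ht.1 ht.2, sub_zero]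

theorem schwingerHat_eq {β δ lam l : ℝ} (hβ : 0 < β) (hδ : 0 < δ) {k : Fin d → ℝ}
    (hk : k ∈ momenta d N) (hl : l ∈ frequencies β) :
    schwingerHat d N β δ lam k l =
      (((∫ t in (0 : ℝ)..β, waveTrace (N := N) β δ lam k t * Real.cos (l * t)) /
        (semigroup d N δ lam β).trace : ℝ) : ℂ) := by
  obtain ⟨hc, hs⟩ := cos_sin_frequency hβ hl
  set Z := (semigroup d N δ lam β).trace
  have h : ∀ x : Torus d N, ∫ t in (0 : ℝ)..β,
      (schwinger β δ lam 0 0 x t : ℂ) * Complex.exp (Complex.I * (dot k x : ℂ)) *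
        Complex.exp (Complex.I * (l : ℂ) * (t : ℂ)) =
      ((∫ t in (0 : ℝ)..β, traceTwoPoint β δ lam 0 x t / Z * Real.cos (l * t) : ℝ) : ℂ) *
        Complex.exp (Complex.I * (dot k x : ℂ)) := fun x => by
    rw [← integral_mul_cexp ((continuous_traceTwoPoint β δ lam 0 x).div_const Z)
      (fun t => by rw [traceTwoPoint_sub]) hc hs, ← intervalIntegral.integral_mul_const]
    refine intervalIntegral.integral_congr fun t ht => ?_
    rw [schwinger_zero_eq hβ hδ ht]
    ring
  rw [schwingerHat, Finset.sum_congr rfl fun x _ => h x,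
    sum_mul_cexp_dot hk fun x => by simp only [traceTwoPoint_zero_neg]]
  congr 1
  simp only [← intervalIntegral.integral_const_mul]
  have hi : ∀ x ∈ (Finset.univ : Finset (Torus d N)), IntervalIntegrable (fun t =>
      Real.cos (dot k x) * (traceTwoPoint β δ lam 0 x t / Z * Real.cos (l * t))) volume 0 β :=
    fun x _ => (continuous_const.mul (((continuous_traceTwoPoint β δ lam 0 x).div_const Z).mul
      (by fun_prop))).intervalIntegrable _ _
  rw [← intervalIntegral.integral_finsetSum hi, ← intervalIntegral.integral_div]
  refine intervalIntegral.integral_congr fun t _ => ?_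
  simp only [waveTrace, Finset.sum_mul, Finset.sum_div]
  exact Finset.sum_congr rfl fun x _ => by ring

/-! ### The Duhamel two-point function -/

/-- Real operators as complex operators. -/
def complexify : RealOp d N →ₐ[ℝ] Op d N := Complex.ofRealAm.mapMatrix

theorem complexify_apply (A : RealOp d N) (s s' : Torus d N → Fin 2) :
    complexify A s s' = (A s s' : ℂ) := rfl

theorem trace_complexify (A : RealOp d N) : (complexify A).trace = (A.trace : ℂ) := by
  simp [Matrix.trace, complexify_apply]

theorem pauli3_eq (x : Torus d N) : (pauli3 x : Op d N) = complexify (spinOp x) := by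
  ext s s'
  rw [complexify_apply, pauli3, siteOp, spinOp, diagOf]
  by_cases hs : s = s'
  · subst hs
    rw [if_pos fun _ _ => rfl, Matrix.diagonal_apply_eq]
    simp only
    generalize s x = a
    fin_cases a <;> simp
  · rw [Matrix.diagonal_apply_ne _ hs, Complex.ofReal_zero]
    split_ifs with h
    · have hx : s x ≠ s' x := fun hx => hs <| funext fun y => by
        by_cases hy : y = x
        · rw [hy, hx]
        · exact h y hy
      generalize s x = a at hx
      generalize s' x = b at hx
      fin_cases a <;> fin_cases b <;> simp at hx ⊢
    · rfl

theorem pauli1_eq (x : Torus d N) : (pauli1 x : Op d N) = complexify (flipAt x) := by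
  ext s s'
  rw [complexify_apply, pauli1, siteOp, flipAt]
  by_cases h : ∀ y, y ≠ x → s y = s' y
  · rw [if_pos h, if_pos h]
    generalize s x = a
    generalize s' x = b
    fin_cases a <;> fin_cases b <;> simp
  · rw [if_neg h, if_neg h, Complex.ofReal_zero]

theorem bondSum_spinOp : (bondSum fun x : Torus d N => (spinOp x : RealOp d N)) = diagOf bondSum := by
  ext s s'
  simp only [bondSum, spinOp, diagOf_mul, Matrix.sum_apply]
  by_cases hs : s = s'
  · subst hs
    simp [diagOf, bondSum]
  · simp [diagOf, hs]

theorem hamiltonian_eq (δ lam : ℝ) :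
    hamiltonian d N δ lam = -complexify (generator d N δ lam) := by
  have h : (bondSum fun x : Torus d N => (pauli3 x : Op d N)) =
      complexify (diagOf bondSum : RealOp d N) := by
    rw [← bondSum_spinOp]
    simp only [bondSum, pauli3_eq, map_sum, map_mul]
  rw [hamiltonian, h, generator, map_add, map_smul, map_smul, map_sum]
  simp only [pauli1_eq, neg_add, Complex.coe_smul, sub_eq_add_neg]

open scoped Matrix.Norms.Operator in
theorem exp_hamiltonian (δ lam t : ℝ) :
    NormedSpace.exp (((-t : ℝ) : ℂ) • hamiltonian d N δ lam) =
      complexify (semigroup d N δ lam t) := by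
  have h := NormedSpace.map_exp (complexify (d := d) (N := N))
    (Continuous.matrix_map continuous_id Complex.continuous_ofReal) (t • generator d N δ lam)
  refine Eq.trans ?_ h.symm
  rw [map_smul, hamiltonian_eq, Complex.coe_smul, neg_smul_neg]
  rfl

theorem duhamel_eq (β δ lam : ℝ) (x : Torus d N) :
    duhamel d N β δ lam x = (((∫ t in (0 : ℝ)..β, traceTwoPoint β δ lam 0 x t) /
      (semigroup d N δ lam β).trace : ℝ) : ℂ) := by
  have h : ∀ t, (semigroup d N δ lam (β - t) * spinOp x * semigroup d N δ lam t *
      spinOp 0).trace = traceTwoPoint β δ lam 0 x t := fun t => by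
    rw [← traceTwoPoint_sub, traceTwoPoint, sub_sub_cancel, Matrix.trace_mul_comm]
    simp only [mul_assoc]
  simp only [duhamel, exp_hamiltonian, pauli3_eq, ← map_mul, trace_complexify, h,
    intervalIntegral.integral_ofReal, Complex.ofReal_div]

theorem integral_schwinger_eq_duhamel {β δ : ℝ} (lam : ℝ) (hβ : 0 < β) (hδ : 0 < δ)
    (x : Torus d N) : ((∫ t in (0 : ℝ)..β, schwinger β δ lam 0 0 x t : ℝ) : ℂ) =
      duhamel d N β δ lam x := by
  rw [duhamel_eq, ← intervalIntegral.integral_div,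
    intervalIntegral.integral_congr fun t ht => schwinger_zero_eq hβ hδ ht x]

theorem schwingerHat_zero_eq_duhamelHat {β δ : ℝ} (lam : ℝ) (hβ : 0 < β) (hδ : 0 < δ)
    (k : Fin d → ℝ) : schwingerHat d N β δ lam k 0 = duhamelHat d N β δ lam k := by
  refine Finset.sum_congr rfl fun x _ => ?_
  rw [← integral_schwinger_eq_duhamel lam hβ hδ, ← intervalIntegral.integral_ofReal,
    ← intervalIntegral.integral_mul_const]
  simp

/-! ### The infrared bound -/

theorem le_div_sq_of_mul_le {a b c : ℝ} (ha : 0 ≤ a) (hb : 0 ≤ b) (hab : 0 < a + b)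
    (hac : a * c ≤ 1) (hbc : b * c ≤ 4) :
    c ≤ (a + 48 * b) / (a + b) ^ 2 ∧ c ≤ 48 / (a + b) := by
  rw [le_div_iff₀ (by positivity), le_div_iff₀ hab]
  refine ⟨?_, by linarith⟩
  nlinarith [mul_le_mul_of_nonneg_left hac ha, mul_le_mul_of_nonneg_left hac hb,
    mul_le_mul_of_nonneg_left hbc hb]

theorem mul_integral_waveTrace_mul_cos_le {β δ lam : ℝ} (hβ : 0 < β) (hδ : 0 < δ) {k : Fin d → ℝ}
    (hk : k ∈ momenta d N) (hlam : 0 ≤ lam) (l : ℝ) :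
    2 * lam * laplaceHat k * ∫ t in (0 : ℝ)..β, waveTrace (N := N) β δ lam k t * Real.cos (l * t) ≤
      (semigroup d N δ lam β).trace := by
  have hL := laplaceHat_nonneg k
  have hZ := trace_semigroup_pos (d := d) (N := N) lam hβ hδ
  rcases hlam.eq_or_lt with h0 | h0
  · rw [← h0] at hZ ⊢
    simpa using hZ.le
  rcases hL.eq_or_lt with h1 | h1
  · rw [← h1]
    simpa using hZ.le
  exact (mul_le_mul_of_nonneg_left (integral_waveTrace_mul_cos_le lam hβ hk l)
    (by positivity)).trans (mul_integral_waveTrace_le hβ hδ hk h0 h1)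

theorem schwingerHat_re_le {β δ lam l : ℝ} (hβ : 0 < β) (hδ : 0 < δ) (hlam : 0 ≤ lam)
    {k : Fin d → ℝ} (hk : k ∈ momenta d N) (hl : l ∈ frequencies β) :
    2 * lam * laplaceHat k * (schwingerHat d N β δ lam k l).re ≤ 1 ∧
      l ^ 2 / (2 * δ) * (schwingerHat d N β δ lam k l).re ≤ 4 := by
  have hZ := trace_semigroup_pos (d := d) (N := N) lam hβ hδ
  obtain ⟨hc, hs⟩ := cos_sin_frequency hβ hl
  rw [schwingerHat_eq hβ hδ hk hl, Complex.ofReal_re, mul_div, mul_div, div_le_iff₀ hZ,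
    div_le_iff₀ hZ, one_mul]
  refine ⟨mul_integral_waveTrace_mul_cos_le hβ hδ hk hlam l, ?_⟩
  have := sq_mul_integral_waveTrace_mul_cos_le lam hβ hδ hk hc hs
  rw [div_mul_eq_mul_div, div_le_iff₀ (by positivity)]
  linarith

end SpaceTimeIsing

end

theorem theorem1p1 (d N : ℕ) [NeZero N] (β δ lam : ℝ) (hβ : 0 < β) (hδ : 0 < δ) (hlam : 0 ≤ lam) :
    -- the infrared bound, in its precise and in its simple form
    (∀ k ∈ SpaceTimeIsing.momenta d N, ∀ l ∈ SpaceTimeIsing.frequencies β,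
      0 < 2 * lam * SpaceTimeIsing.laplaceHat k + l ^ 2 / (2 * δ) →
        (SpaceTimeIsing.schwingerHat d N β δ lam k l).im = 0 ∧
        (SpaceTimeIsing.schwingerHat d N β δ lam k l).re ≤
          (2 * lam * SpaceTimeIsing.laplaceHat k + 48 * l ^ 2 / (2 * δ)) /
            (2 * lam * SpaceTimeIsing.laplaceHat k + l ^ 2 / (2 * δ)) ^ 2 ∧
        (SpaceTimeIsing.schwingerHat d N β δ lam k l).re ≤
          48 / (2 * lam * SpaceTimeIsing.laplaceHat k + l ^ 2 / (2 * δ))) ∧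
    -- the time integral of the Schwinger function is the Duhamel two-point function
    (∀ x : SpaceTimeIsing.Torus d N,
      ((∫ t in (0 : ℝ)..β, SpaceTimeIsing.schwinger β δ lam 0 0 x t : ℝ) : ℂ) =
        SpaceTimeIsing.duhamel d N β δ lam x) ∧
    -- the case `l = 0`: the Dyson–Lieb–Simon bound
    (∀ k ∈ SpaceTimeIsing.momenta d N, 0 < 2 * lam * SpaceTimeIsing.laplaceHat k →
      SpaceTimeIsing.schwingerHat d N β δ lam k 0 = SpaceTimeIsing.duhamelHat d N β δ lam k ∧
      (SpaceTimeIsing.duhamelHat d N β δ lam k).im = 0 ∧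
      (SpaceTimeIsing.duhamelHat d N β δ lam k).re ≤
        1 / (2 * lam * SpaceTimeIsing.laplaceHat k)) := by
  refine ⟨fun k hk l hl hpos => ?_, SpaceTimeIsing.integral_schwinger_eq_duhamel lam hβ hδ,
    fun k hk hpos => ?_⟩
  · obtain ⟨h1, h2⟩ := SpaceTimeIsing.schwingerHat_re_le hβ hδ hlam hk hl
    have hL := SpaceTimeIsing.laplaceHat_nonneg k
    rw [mul_div_assoc 48]
    refine ⟨?_, SpaceTimeIsing.le_div_sq_of_mul_le (by positivity) (by positivity) hpos h1 h2⟩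
    rw [SpaceTimeIsing.schwingerHat_eq hβ hδ hk hl, Complex.ofReal_im]
  · have h0 : (0 : ℝ) ∈ SpaceTimeIsing.frequencies β := ⟨0, by simp⟩
    have h1 := (SpaceTimeIsing.schwingerHat_re_le hβ hδ hlam hk h0).1
    rw [← SpaceTimeIsing.schwingerHat_zero_eq_duhamelHat lam hβ hδ]
    refine ⟨rfl, ?_, (le_div_iff₀' hpos).2 h1⟩
    rw [SpaceTimeIsing.schwingerHat_eq hβ hδ hk h0, Complex.ofReal_im]
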